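/- Let $q\ge 1$, $\Omega_q=\{\mathbf{x}\in\mathbb{R}^{q+1}:\|\mathbf{x}\|=1\}$ with surface measure, and let $(\mathbf{X}_1,Y_1),(\mathbf{X}_2,Y_2),\ldots$ be i.i.d. in $\Omega_q\times\mathbb{R}$ from the model $Y=m(\mathbf{X})+\sigma(\mathbf{X})\varepsilon$, where $\mathbf{X}$ has density $f$ with respect to the surface measure, $\mathbb{E}[\varepsilon|\mathbf{X}]=0$, $\mathbb{E}[\varepsilon^2|\mathbf{X}]=1$, and $\mathbb{E}[|\varepsilon|^3|\mathbf{X}]$, $\mathbb{E}[\varepsilon^4|\mathbf{X}]$ are bounded random variables. Assume: - **A1.** Extended to $\mathbb{R}^{q+1}\setminus\{\mathbf{0}\}$ by $m(\mathbf{x})=m(\mathbf{x}/\|\mathbf{x}\|)$ and $f(\mathbf{x})=f(\mathbf{x}/\|\mathbf{x}\|)$, $m$ is three times and $f$ twice continuously differentiable, and $f$ is bounded away from zero. - **A2.** $\sigma^2$ is uniformly continuous and bounded away from zero on $\Omega_q$. - **A3.** $L:[0,\infty)\to[0,\infty)$ is continuous, not identically zero, and $L(r)\le Me^{-\alpha r}$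 for all $r\ge 0$, for some $M,\alpha>0$. - **A4.** The bandwidths $h=h_n>0$ satisfy $h\to0$ and $nh^q\to\infty$. Let $\omega_{q-1}=2\pi^{q/2}/\Gamma(q/2)$, $\lambda_{h,q}(L)=\omega_{q-1}\int_0^{2h^{-2}}L(r)r^{\frac q2-1}(2-rh^2)^{\frac q2-1}dr$, $\lambda_q(L)=2^{\frac q2-1}\omega_{q-1}\int_0^\infty L(r)r^{\frac q2-1}dr$, $b_q(L)=\int_0^\infty L(r)r^{\frac q2}dr\big/\int_0^\infty L(r)r^{\frac q2-1}dr$ and $L_h(\mathbf{x},\mathbf{y})=(\lambda_{h,q}(L)h^q)^{-1}L\big((1-\mathbf{x}^T\mathbf{y})/h^2\big)$. For each $\mathbf{x}\in\Omega_q$ let $\mathbf{B}_\mathbf{x}=(\mathbf{b}_1,\ldots,\mathbf{b}_q)$, where $\mathbf{b}_1,\ldots,\mathbf{b}_q$ complete $\mathbf{x}$ to an orthonormal basis of $\mathbb{R}^{q+1}$. For $p\in\{0,1\}$ the projected local estimator is $$\hat m_{h,p}(\mathbf{x})=\mathbf{e}_1^T(\mathcal{X}_{\mathbf{x},p}^T\mathcal{W}_\mathbf{x}\mathcal{X}_{\mathbf{x},p})^{-1}\mathcal{X}_{\mathbf{x},p}^T\mathcal{W}_\mathbf{x}(Y_1,\ldots,Y_n)^T,$$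 where $\mathcal{W}_\mathbf{x}=\mathrm{diag}(L_h(\mathbf{x},\mathbf{X}_1),\ldots,L_h(\mathbf{x},\mathbf{X}_n))$, $\mathcal{X}_{\mathbf{x},0}$ is the column of $n$ ones, and $\mathcal{X}_{\mathbf{x},1}$ has rows $(1,(\mathbf{X}_i-\mathbf{x})^T\mathbf{B}_\mathbf{x})$, $i=1,\ldots,n$ (with the convention that a singular matrix has inverse $0$). Then, for $p=0,1$, with conditional mean and variance taken under the regular conditional distribution given $\mathbf{X}_1,\ldots,\mathbf{X}_n$, $$\mathbb{E}[\hat m_{h,p}(\mathbf{x})-m(\mathbf{x})\,|\,\mathbf{X}_1,\ldots,\mathbf{X}_n]=\frac{b_q(L)}{q}B_p(\mathbf{x})h^2+o_{\mathbb{P}}(h^2)+\delta_{p,0}\,O_{\mathbb{P}}\Big(\frac{h}{\sqrt{nh^q}}\Big),$$ $$\mathbb{V}\mathrm{ar}[\hat m_{h,p}(\mathbf{x})\,|\,\mathbf{X}_1,\ldots,\mathbf{X}_n]=\frac{\lambda_q(L^2)\lambda_q(L)^{-2}}{nh^qf(\mathbf{x})}\sigma^2(\mathbf{x})+o_{\mathbb{P}}\big((nh^q)^{-1}\big),$$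 uniformly in $\mathbf{x}\in\Omega_q$, where, with $\nabla$ the gradient and $\mathcal{H}_m$ the Hessian matrix in $\mathbb{R}^{q+1}$ of the extended functions, $$B_0(\mathbf{x})=2\,\frac{\nabla f(\mathbf{x})^T\nabla m(\mathbf{x})}{f(\mathbf{x})}+\mathrm{tr}\,\mathcal{H}_m(\mathbf{x}),\qquad B_1(\mathbf{x})=\mathrm{tr}\,\mathcal{H}_m(\mathbf{x}).$$ Here $R_n(\mathbf{x})=o_{\mathbb{P}}(r_n)$ uniformly in $\mathbf{x}$ means $\sup_{\mathbf{x}\in\Omega_q}\mathbb{P}(|R_n(\mathbf{x})|>\delta r_n)\to0$ for every $\delta>0$, and $R_n(\mathbf{x})=O_{\mathbb{P}}(r_n)$ uniformly in $\mathbf{x}$ means that for every $\delta>0$ there is $C$ with $\sup_{\mathbf{x}\in\Omega_q}\mathbb{P}(|R_n(\mathbf{x})|>Cr_n)\le\delta$ for all large $n$. -/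

import Mathlib

open MeasureTheory ProbabilityTheory Filter Topology Set

noncomputable section

namespace ProjLocal

/-- The unit sphere `Ω_q` of `ℝ^{q+1}`. -/
abbrev Sph (q : ℕ) : Type :=
  Metric.sphere (0 : EuclideanSpace ℝ (Fin (q + 1))) 1

/-! ### Differential calculus on the sphere through the radial extension -/

/-- The radial extension `x ↦ g (x / ‖x‖)` to `ℝ^{q+1} \ {0}` (the value at `0` is irrelevant). -/
def radialExt {q : ℕ} (g : Sph q → ℝ) (x : EuclideanSpace ℝ (Fin (q + 1))) : ℝ :=
  open Classical in
  if hx : x ≠ 0 then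
    g ⟨‖x‖⁻¹ • x, by simp [norm_smul, norm_ne_zero_iff.mpr hx]⟩
  else 0

/-- The gradient in `ℝ^{q+1}`, at a point of the sphere, of the radial extension of `g`. -/
def sphGrad {q : ℕ} (g : Sph q → ℝ) (x : Sph q) : EuclideanSpace ℝ (Fin (q + 1)) :=
  gradient (radialExt g) (x : EuclideanSpace ℝ (Fin (q + 1)))

/-- The `(q+1) × (q+1)` Hessian matrix, at a point of the sphere, of the radial extension of `g`. -/
def sphHessian {q : ℕ} (g : Sph q → ℝ) (x : Sph q) : Matrix (Fin (q + 1)) (Fin (q + 1)) ℝ :=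
  Matrix.of fun i j =>
    fderiv ℝ (fun y => fderiv ℝ (radialExt g) y (EuclideanSpace.single j 1))
      (x : EuclideanSpace ℝ (Fin (q + 1))) (EuclideanSpace.single i 1)

/-! ### Kernels and their constants -/

/-- The surface area `2 π^{(d+1)/2} / Γ((d+1)/2)` of the `d`-sphere in `ℝ^{d+1}`. -/
def sphereArea (d : ℕ) : ℝ :=
  2 * Real.pi ^ (((d : ℝ) + 1) / 2) / Real.Gamma (((d : ℝ) + 1) / 2)

/-- `λ_{h,q}(L) = ω_{q-1} ∫_0^{2 h⁻²} L(r) r^{q/2-1} (2 - r h²)^{q/2-1} dr` (for `q ≥ 1`). -/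
def lambdaH (q : ℕ) (h : ℝ) (L : ℝ → ℝ) : ℝ :=
  sphereArea (q - 1) *
    ∫ r in (0 : ℝ)..(2 / h ^ 2),
      L r * r ^ ((q : ℝ) / 2 - 1) * (2 - r * h ^ 2) ^ ((q : ℝ) / 2 - 1)

/-- `λ_q(L) = 2^{q/2-1} ω_{q-1} ∫_0^∞ L(r) r^{q/2-1} dr` (for `q ≥ 1`). -/
def lambdaLim (q : ℕ) (L : ℝ → ℝ) : ℝ :=
  (2 : ℝ) ^ ((q : ℝ) / 2 - 1) * sphereArea (q - 1) *
    ∫ r in Ioi (0 : ℝ), L r * r ^ ((q : ℝ) / 2 - 1)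

/-- `b_q(L) = ∫_0^∞ L(r) r^{q/2} dr / ∫_0^∞ L(r) r^{q/2-1} dr`. -/
def bConst (q : ℕ) (L : ℝ → ℝ) : ℝ :=
  (∫ r in Ioi (0 : ℝ), L r * r ^ ((q : ℝ) / 2)) /
    ∫ r in Ioi (0 : ℝ), L r * r ^ ((q : ℝ) / 2 - 1)

/-- The normalized kernel `L_h(x, y) = c_{h,q}(L) L((1 - xᵀy) / h²)`,
with `c_{h,q}(L)⁻¹ = λ_{h,q}(L) h^q`. -/
def kernelH {q : ℕ} (L : ℝ → ℝ) (h : ℝ) (x y : Sph q) : ℝ :=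
  (lambdaH q h L * h ^ q)⁻¹ *
    L ((1 - inner ℝ (x : EuclideanSpace ℝ (Fin (q + 1))) (y : EuclideanSpace ℝ (Fin (q + 1))))
      / h ^ 2)

/-- A directional kernel: a continuous function `L : [0,∞) → [0,∞)`, not identically zero, with
exponential decay (hence bounded). Only the values of `L` on `[0,∞)` matter. -/
structure IsDirectionalKernel (L : ℝ → ℝ) : Prop where
  continuousOn : ContinuousOn L (Ici 0)
  nonneg : ∀ r, 0 ≤ r → 0 ≤ L r
  nonzero : ∃ r, 0 ≤ r ∧ L r ≠ 0
  decay : ∃ M α : ℝ, 0 < M ∧ 0 < α ∧ ∀ r, 0 ≤ r → L r ≤ M * Real.exp (-α * r)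

/-! ### The projected local estimator -/

/-- `b x 0, …, b x (q-1)` complete `x` to an orthonormal basis of `ℝ^{q+1}`. -/
def IsTangentFrame {q : ℕ} (b : Sph q → Fin q → EuclideanSpace ℝ (Fin (q + 1))) : Prop :=
  ∀ x : Sph q, Orthonormal ℝ
    (Fin.cons (x : EuclideanSpace ℝ (Fin (q + 1))) (b x) :
      Fin (q + 1) → EuclideanSpace ℝ (Fin (q + 1)))

/-- The design matrix for `p = 0`: one column of ones. -/
def designZero (n : ℕ) : Matrix (Fin n) (Fin 1) ℝ :=
  Matrix.of fun _ _ => 1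

/-- The design matrix for `p = 1`: its `i`-th row is `(1, (X_i - x)ᵀ B_x)`. -/
def designOne {q n : ℕ} (b : Sph q → Fin q → EuclideanSpace ℝ (Fin (q + 1)))
    (x : Sph q) (xs : Fin n → Sph q) : Matrix (Fin n) (Fin (q + 1)) ℝ :=
  Matrix.of fun i => Fin.cons 1 fun j =>
    inner ℝ ((xs i : EuclideanSpace ℝ (Fin (q + 1))) - (x : EuclideanSpace ℝ (Fin (q + 1)))) (b x j)

/-- The first coefficient `e₁ᵀ (Dᵀ W D)⁻¹ Dᵀ W y` of the weighted least squares fit with design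
matrix `D`, weight matrix `W = diag w` and responses `y`. -/
def wlsIntercept {n d : ℕ} (D : Matrix (Fin n) (Fin (d + 1)) ℝ) (w y : Fin n → ℝ) : ℝ :=
  ((D.transpose * Matrix.diagonal w * D)⁻¹.mulVec
    ((D.transpose * Matrix.diagonal w).mulVec y)) 0

/-- The projected local estimator `m̂_{h,p}(x)`, `p = 0` (local constant) or `p = 1` (local linear),
computed from the sample `(xs i, ys i)`, `i < n`. -/
def projLocalEst {q n : ℕ} (L : ℝ → ℝ) (b : Sph q → Fin q → EuclideanSpace ℝ (Fin (q + 1)))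
    (h : ℝ) (p : Fin 2) (x : Sph q) (xs : Fin n → Sph q) (ys : Fin n → ℝ) : ℝ :=
  match p with
  | 0 => wlsIntercept (designZero n) (fun i => kernelH L h x (xs i)) ys
  | 1 => wlsIntercept (designOne b x xs) (fun i => kernelH L h x (xs i)) ys

/-- `B_p(x)`: `2 ∇f(x)ᵀ∇m(x) / f(x) + tr H_m(x)` for `p = 0`, and `tr H_m(x)` for `p = 1`. -/
def biasTerm {q : ℕ} (f m : Sph q → ℝ) (p : Fin 2) (x : Sph q) : ℝ :=
  match p with
  | 0 => 2 * inner ℝ (sphGrad f x) (sphGrad m x) / f x + (sphHessian m x).trace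
  | 1 => (sphHessian m x).trace

/-! ### The regression model -/

/-- `(X_i, Y_i)`, `i = 0, 1, …`, is an i.i.d. sample from the model `Y = m(X) + σ(X) ε`, where `X`
has density `f` with respect to the surface measure of the sphere, `E[ε | X] = 0`,
`E[ε² | X] = 1`, and `E[|ε|³ | X]`, `E[ε⁴ | X]` are bounded random variables. -/
structure IsRegressionSample {q : ℕ} {Ω : Type*} [MeasurableSpace Ω] (μ : Measure Ω)
    (f m σ : Sph q → ℝ) (X : ℕ → Ω → Sph q) (Y ε : ℕ → Ω → ℝ) : Prop where
  measurable_X : ∀ i, Measurable (X i)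
  measurable_Y : ∀ i, Measurable (Y i)
  measurable_ε : ∀ i, Measurable (ε i)
  measurable_σ : Measurable σ
  indep : iIndepFun (fun i ω => (X i ω, Y i ω)) μ
  identDistrib : ∀ i, IdentDistrib (fun ω => (X i ω, Y i ω)) (fun ω => (X 0 ω, Y 0 ω)) μ μ
  density : μ.map (X 0) =
    (volume : Measure (EuclideanSpace ℝ (Fin (q + 1)))).toSphere.withDensity
      fun x => ENNReal.ofReal (f x)
  model : ∀ i ω, Y i ω = m (X i ω) + σ (X i ω) * ε i ω
  memLp_ε : ∀ i, MemLp (ε i) 4 μ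
  mean_ε : ∀ i, μ[ε i | MeasurableSpace.comap (X i) inferInstance] =ᵐ[μ] fun _ => 0
  var_ε : ∀ i, μ[fun ω => ε i ω ^ 2 | MeasurableSpace.comap (X i) inferInstance] =ᵐ[μ] fun _ => 1
  third_ε : ∃ C : ℝ, ∀ i, ∀ᵐ ω ∂μ,
    (μ[fun ω' => |ε i ω'| ^ 3 | MeasurableSpace.comap (X i) inferInstance]) ω ≤ C
  fourth_ε : ∃ C : ℝ, ∀ i, ∀ᵐ ω ∂μ,
    (μ[fun ω' => ε i ω' ^ 4 | MeasurableSpace.comap (X i) inferInstance]) ω ≤ C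

/-! ### Conditional mean, conditional variance, stochastic orders -/

/-- `E[Z | V]`, as the mean of the regular conditional distribution of `Z` given `V`. If `Z` is
integrable, this is almost surely the usual conditional expectation; it is also meaningful when `Z`
has a finite mean conditionally on `V` but not unconditionally. -/
def condMean {Ω β : Type*} [MeasurableSpace Ω] [MeasurableSpace β] (μ : Measure Ω)
    [IsFiniteMeasure μ] (Z : Ω → ℝ) (V : Ω → β) (ω : Ω) : ℝ :=
  ∫ z, z ∂(condDistrib Z V μ (V ω))

/-- `Var[Z | V]`, as the variance of the regular conditional distribution of `Z` given `V`. -/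
def condVariance {Ω β : Type*} [MeasurableSpace Ω] [MeasurableSpace β] (μ : Measure Ω)
    [IsFiniteMeasure μ] (Z : Ω → ℝ) (V : Ω → β) (ω : Ω) : ℝ :=
  variance (fun z : ℝ => z) (condDistrib Z V μ (V ω))

/-- `R_n(x) = o_P(r_n)` uniformly in `x`: `sup_x P(|R_n(x)| > δ r_n) → 0` for every `δ > 0`. -/
def UnifLittleOP {Ω S : Type*} [MeasurableSpace Ω] (μ : Measure Ω)
    (R : ℕ → S → Ω → ℝ) (r : ℕ → ℝ) : Prop :=
  ∀ δ : ℝ, 0 < δ → Tendsto (fun n => ⨆ x : S, μ {ω | δ * r n < |R n x ω|}) atTop (𝓝 0)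

/-- `R_n(x) = O_P(r_n)` uniformly in `x`: for every `δ > 0` there is `C` with
`sup_x P(|R_n(x)| > C r_n) ≤ δ` for all large `n`. -/
def UnifBigOP {Ω S : Type*} [MeasurableSpace Ω] (μ : Measure Ω)
    (R : ℕ → S → Ω → ℝ) (r : ℕ → ℝ) : Prop :=
  ∀ δ : ℝ, 0 < δ → ∃ C : ℝ, ∀ᶠ n in atTop,
    ⨆ x : S, μ {ω | C * r n < |R n x ω|} ≤ ENNReal.ofReal δ

end ProjLocal

end

open ProjLocal

/-!
The pairs of a point and an orthonormal frame at it form a compact space. By compactness, a bound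
uniform in `x` follows, even for a discontinuous choice of frames, once it is known along every
filter on which the bandwidth tends to zero and the pair `(x, B_x)` converges.

In the gnomonic chart `u ↦ (x + B u) / ‖x + B u‖` at the scale `u = h v`, kernel integrals on the
sphere become integrals over `ℝ^q` with a limit weight `L (‖v‖² / 2)`. Kernel averages over the
sample converge in probability to the same limits, as their variance is of order `1 / (n h^q)`.
After rescaling the regressors by `h`, the Gram matrix of the weighted least squares problem
converges to an invertible diagonal matrix.

Given the design, the responses are independent, so that the conditional mean and variance of the
estimator are weighted sums of `m (X_j)` and `σ² (X_j)`. For the mean, expand `m` at `x` to second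
order. The quadratic part yields the trace of the Hessian. The local linear fit removes the linear
part exactly; in the local constant fit it is odd in the chart, so that its expectation comes from
the first order variation of `f`, and its fluctuation is the term of order `h / √(n h^q)`.
-/

noncomputable section

namespace ProjLocal

/-! ### Convergence in probability as convergence along a filter -/

/-- The filter of the sets of pairs `(i, ω)` whose `i`-th section has probability tending to one
along `l`. Convergence along this filter to a constant is convergence in probability. -/
def probFilter {ι Ω : Type*} [MeasurableSpace Ω] (μ : Measure Ω) (l : Filter ι) :
    Filter (ι × Ω) where
  sets := {S | Tendsto (fun i => μ {ω | (i, ω) ∉ S}) l (𝓝 0)}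
  univ_sets := by simpa using tendsto_const_nhds
  sets_of_superset hS hST :=
    tendsto_of_tendsto_of_tendsto_of_le_of_le tendsto_const_nhds hS (fun _ => zero_le)
      fun _ => measure_mono fun _ hω h => hω (hST h)
  inter_sets {S T} hS hT := by
    have hsum : Tendsto (fun i => μ {ω | (i, ω) ∉ S} + μ {ω | (i, ω) ∉ T}) l (𝓝 0) := by
      simpa using Tendsto.add hS hT
    refine tendsto_of_tendsto_of_tendsto_of_le_of_le tendsto_const_nhds hsum (fun _ => zero_le)
      fun i => (measure_mono fun ω hω => ?_).trans (measure_union_le _ _)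
    simpa only [mem_inter_iff, not_and_or, mem_union, mem_ofPred_eq] using hω

section probFilter

variable {ι Ω : Type*} [MeasurableSpace Ω] {μ : Measure Ω} {l : Filter ι}

theorem eventually_probFilter {P : ι → Ω → Prop} :
    (∀ᶠ z in probFilter μ l, P z.1 z.2) ↔ Tendsto (fun i => μ {ω | ¬ P i ω}) l (𝓝 0) := Iff.rfl

theorem tendsto_fst_probFilter : Tendsto Prod.fst (probFilter μ l) l := by
  intro S hS
  refine eventually_probFilter (P := fun i _ => i ∈ S).2 (tendsto_const_nhds.congr' ?_)
  filter_upwards [hS] with i hi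
  simp [hi]

theorem eventually_probFilter_of_ae {P : ι → Ω → Prop} (h : ∀ i, ∀ᵐ ω ∂μ, P i ω) :
    ∀ᶠ z in probFilter μ l, P z.1 z.2 :=
  eventually_probFilter.2 (tendsto_const_nhds.congr fun i => (ae_iff.1 (h i)).symm)

theorem tendsto_probFilter_of_variance [IsProbabilityMeasure μ] {A : ι → Ω → ℝ} {a : ℝ}
    (hA : ∀ᶠ i in l, MemLp (A i) 2 μ) (hmean : Tendsto (fun i => ∫ ω, A i ω ∂μ) l (𝓝 a))
    (hvar : Tendsto (fun i => variance (A i) μ) l (𝓝 0)) :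
    Tendsto (fun z : ι × Ω => A z.1 z.2) (probFilter μ l) (𝓝 a) := by
  have hcentred :
      Tendsto (fun z : ι × Ω => A z.1 z.2 - ∫ ω, A z.1 ω ∂μ) (probFilter μ l) (𝓝 0) := by
    refine Metric.tendsto_nhds.2 fun δ hδ => ?_
    rw [eventually_probFilter (P := fun i ω => dist (A i ω - ∫ ω, A i ω ∂μ) 0 < δ)]
    have hchebyshev : Tendsto (fun i => ENNReal.ofReal (variance (A i) μ / δ ^ 2)) l (𝓝 0) := by
      simpa using ENNReal.tendsto_ofReal (hvar.div_const (δ ^ 2))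
    refine tendsto_of_tendsto_of_tendsto_of_le_of_le' tendsto_const_nhds hchebyshev
      (Eventually.of_forall fun _ => zero_le) ?_
    filter_upwards [hA] with i hi
    refine le_trans (measure_mono fun ω hω => ?_) (meas_ge_le_variance_div_sq hi hδ)
    simpa [Real.dist_eq] using hω
  simpa using hcentred.add (hmean.comp (tendsto_fst_probFilter (μ := μ)))

end probFilter

/-- Boundedness in probability along `l`, that is `A = O_P(1)`. -/
def BddInProb {ι Ω : Type*} [MeasurableSpace Ω] (μ : Measure Ω) (l : Filter ι) (A : ι → Ω → ℝ) :
    Prop :=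
  ∀ δ : ℝ, 0 < δ → ∃ C : ℝ, ∀ᶠ i in l, μ {ω | C < |A i ω|} ≤ ENNReal.ofReal δ

section BddInProb

variable {ι Ω : Type*} [MeasurableSpace Ω] {μ : Measure Ω} {l : Filter ι} {A B : ι → Ω → ℝ}

theorem bddInProb_sub_integral [IsFiniteMeasure μ] (hA : ∀ᶠ i in l, MemLp (A i) 2 μ) {V : ℝ}
    (hV : ∀ᶠ i in l, variance (A i) μ ≤ V) :
    BddInProb μ l fun i ω => A i ω - ∫ ω, A i ω ∂μ := by
  intro δ hδ
  have hC : 0 < √((|V| + 1) / δ) := by positivity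
  refine ⟨√((|V| + 1) / δ), ?_⟩
  filter_upwards [hA, hV] with i hi hVi
  calc μ {ω | √((|V| + 1) / δ) < |A i ω - ∫ ω, A i ω ∂μ|}
      ≤ μ {ω | √((|V| + 1) / δ) ≤ |A i ω - ∫ ω, A i ω ∂μ|} :=
        measure_mono (ofPred_subset_ofPred.2 fun _ => le_of_lt)
    _ ≤ ENNReal.ofReal (variance (A i) μ / √((|V| + 1) / δ) ^ 2) :=
        meas_ge_le_variance_div_sq hi hC
    _ ≤ ENNReal.ofReal δ := by
        rw [Real.sq_sqrt (by positivity)]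
        gcongr
        rw [div_le_iff₀ (by positivity), mul_div_cancel₀ _ hδ.ne']
        linarith [le_abs_self V]

theorem BddInProb.congr (hA : BddInProb μ l A) (hAB : ∀ᶠ i in l, A i = B i) : BddInProb μ l B := by
  intro δ hδ
  obtain ⟨C, hC⟩ := hA δ hδ
  refine ⟨C, ?_⟩
  filter_upwards [hC, hAB] with i hi hABi
  rwa [← hABi]

theorem BddInProb.mul_tendsto (hA : BddInProb μ l A) {b : ℝ}
    (hB : Tendsto (fun z : ι × Ω => B z.1 z.2) (probFilter μ l) (𝓝 b)) :
    BddInProb μ l fun i ω => A i ω * B i ω := by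
  intro δ hδ
  obtain ⟨C, hC⟩ := hA (δ / 2) (half_pos hδ)
  have hB_large : Tendsto (fun i => μ {ω | ¬ |B i ω| ≤ |b| + 1}) l (𝓝 0) :=
    (eventually_probFilter (P := fun i ω => |B i ω| ≤ |b| + 1)).1
      (hB.abs.eventually_le_const (lt_add_one |b|))
  refine ⟨C * (|b| + 1), ?_⟩
  filter_upwards [hC, hB_large.eventually_le_const
    (ENNReal.ofReal_pos.2 (half_pos hδ))] with i hAi hBi
  have hsubset : {ω | C * (|b| + 1) < |A i ω * B i ω|} ⊆
      {ω | C < |A i ω|} ∪ {ω | ¬ |B i ω| ≤ |b| + 1} := by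
    intro ω hω
    by_contra hcontra
    simp only [mem_union, mem_ofPred_eq, not_or, not_lt, not_not] at hcontra hω
    rw [abs_mul] at hω
    exact hω.not_ge (mul_le_mul hcontra.1 hcontra.2 (abs_nonneg _)
      ((abs_nonneg _).trans hcontra.1))
  calc μ {ω | C * (|b| + 1) < |A i ω * B i ω|}
      ≤ μ {ω | C < |A i ω|} + μ {ω | ¬ |B i ω| ≤ |b| + 1} :=
        (measure_mono hsubset).trans (measure_union_le _ _)
    _ ≤ ENNReal.ofReal (δ / 2) + ENNReal.ofReal (δ / 2) := add_le_add hAi hBi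
    _ = ENNReal.ofReal δ := by
        rw [← ENNReal.ofReal_add (half_pos hδ).le (half_pos hδ).le, add_halves]

end BddInProb

/-! ### Uniformity by localization in a compact space -/

section Compactness

variable {ι K : Type*} [TopologicalSpace K] [CompactSpace K] {l : Filter ι}

theorem exists_eventually_of_inf_comap {α : Type*} [Preorder α] [IsDirectedOrder α] [Nonempty α]
    {P : α → ι → Prop} (hP : Monotone P) (g : ι → K)
    (h : ∀ p, ∃ C, ∀ᶠ i in l ⊓ comap g (𝓝 p), P C i) : ∃ C, ∀ᶠ i in l, P C i := by
  choose C hC using h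
  have hlocal : ∀ p, ∃ U ∈ 𝓝 p, ∀ᶠ i in l, g i ∈ U → P (C p) i := by
    intro p
    obtain ⟨s, hs, t, ht, hst⟩ := mem_inf_iff_superset.1 (hC p)
    obtain ⟨U, hU, hUt⟩ := mem_comap.1 ht
    exact ⟨U, hU, mem_of_superset hs fun i hi hgi => hst ⟨hi, hUt hgi⟩⟩
  choose U hU hUP using hlocal
  obtain ⟨t, ht⟩ := CompactSpace.elim_nhds_subcover U hU
  obtain ⟨M, hM⟩ := (t.finite_toSet.image C).bddAbove
  refine ⟨M, ?_⟩
  filter_upwards [(Filter.eventually_all_finset t).2 fun p _ => hUP p] with i hi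
  obtain ⟨p, hp, hgp⟩ : ∃ p ∈ t, g i ∈ U p := by simpa using ht.ge (mem_univ (g i))
  exact hP (hM (mem_image_of_mem C hp)) i (hi p hp hgp)

theorem eventually_of_inf_comap {P : ι → Prop} (g : ι → K)
    (h : ∀ p, ∀ᶠ i in l ⊓ comap g (𝓝 p), P i) : ∀ᶠ i in l, P i :=
  (exists_eventually_of_inf_comap (P := fun _ : Unit => P) monotone_const g
    fun p => ⟨(), h p⟩).choose_spec

end Compactness

section Uniform

variable {Ω S K : Type*} [MeasurableSpace Ω] {μ : Measure Ω} [TopologicalSpace K] [CompactSpace K]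
  {R : ℕ → S → Ω → ℝ} {r : ℕ → ℝ}

theorem eventually_iSup_le_iff {α : Type*} {l : Filter α} {G : α → S → ENNReal} {a : ENNReal} :
    (∀ᶠ n in l, ⨆ x, G n x ≤ a) ↔ ∀ᶠ i : α × S in l ×ˢ ⊤, G i.1 i.2 ≤ a := by
  simp only [prod_top, eventually_comap, iSup_le_iff, Prod.forall]
  exact eventually_congr (Eventually.of_forall fun n => by aesop)

theorem unifLittleOP_of_inf_comap (hr : ∀ᶠ n in atTop, 0 < r n) (g : ℕ × S → K)
    (h : ∀ p, Tendsto (fun z : (ℕ × S) × Ω => R z.1.1 z.1.2 z.2 / r z.1.1)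
      (probFilter μ ((atTop ×ˢ ⊤) ⊓ comap g (𝓝 p))) (𝓝 0)) : UnifLittleOP μ R r := by
  refine fun δ hδ => ENNReal.tendsto_nhds_zero.2 fun e he =>
    eventually_iSup_le_iff.2 (eventually_of_inf_comap g fun p => ?_)
  have hr' : ∀ᶠ i : ℕ × S in (atTop ×ˢ ⊤) ⊓ comap g (𝓝 p), 0 < r i.1 :=
    (tendsto_fst.mono_left inf_le_left).eventually hr
  have hsmall : ∀ᶠ z in probFilter μ ((atTop ×ˢ ⊤) ⊓ comap g (𝓝 p)),
      ¬ δ * r z.1.1 < |R z.1.1 z.1.2 z.2| := by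
    filter_upwards [(h p).abs.eventually_lt_const (u := δ) (by simpa using hδ),
      (tendsto_fst_probFilter (μ := μ)).eventually hr'] with z hz hz'
    rw [abs_div, abs_of_pos hz', div_lt_iff₀ hz'] at hz
    exact not_lt.2 hz.le
  have hmeasure := (eventually_probFilter
    (P := fun (i : ℕ × S) ω => ¬ δ * r i.1 < |R i.1 i.2 ω|)).1 hsmall
  simp only [not_not] at hmeasure
  exact ENNReal.tendsto_nhds_zero.1 hmeasure e he

theorem unifBigOP_of_inf_comap (hr : ∀ᶠ n in atTop, 0 < r n) (g : ℕ × S → K)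
    (h : ∀ p, BddInProb μ ((atTop ×ˢ ⊤) ⊓ comap g (𝓝 p)) fun i ω => R i.1 i.2 ω / r i.1) :
    UnifBigOP μ R r := by
  intro δ hδ
  have hmono : Monotone fun (C : ℝ) (i : ℕ × S) =>
      μ {ω | C < |R i.1 i.2 ω / r i.1|} ≤ ENNReal.ofReal δ := fun C C' hC i hi =>
    (measure_mono fun _ hω => hC.trans_lt hω).trans hi
  obtain ⟨C, hC⟩ := exists_eventually_of_inf_comap hmono g fun p => h p δ hδ
  refine ⟨C, eventually_iSup_le_iff.2 ?_⟩
  filter_upwards [hC, tendsto_fst.eventually hr] with i hi hri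
  simpa only [abs_div, abs_of_pos hri, lt_div_iff₀ hri] using hi

end Uniform

/-! ### Orthonormal frames and the gnomonic chart of the sphere -/

/-- The ambient space `ℝ^{q+1}`. -/
abbrev Amb (q : ℕ) : Type := EuclideanSpace ℝ (Fin (q + 1))

/-- The model `ℝ^q` of the tangent spaces. -/
abbrev Tan (q : ℕ) : Type := EuclideanSpace ℝ (Fin q)

/-- The surface measure of the sphere. -/
abbrev surf (q : ℕ) : Measure (Sph q) := (volume : Measure (Amb q)).toSphere

/-- The linear map `B : u ↦ ∑ j, u j • β j` whose matrix has the columns `β j`. -/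
def frameMap {q : ℕ} (β : Fin q → Amb q) : Tan q →L[ℝ] Amb q :=
  ∑ j, (EuclideanSpace.proj j : Tan q →L[ℝ] ℝ).smulRight (β j)

/-- `β` completes the unit vector `x` to an orthonormal basis. -/
abbrev IsFrameAt {q : ℕ} (x : Sph q) (β : Fin q → Amb q) : Prop :=
  Orthonormal ℝ (Fin.cons (x : Amb q) β : Fin (q + 1) → Amb q)

section Frame

variable {q : ℕ} {x : Sph q} {β : Fin q → Amb q}

theorem frameMap_apply (β : Fin q → Amb q) (u : Tan q) : frameMap β u = ∑ j, u j • β j := by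
  simp [frameMap]

/-- The orthonormal basis `(x, β)` of the ambient space. -/
def IsFrameAt.basis (h : IsFrameAt x β) : OrthonormalBasis (Fin (q + 1)) ℝ (Amb q) :=
  (basisOfOrthonormalOfCardEqFinrank h (by simp)).toOrthonormalBasis
    (by rw [coe_basisOfOrthonormalOfCardEqFinrank]; exact h)

theorem IsFrameAt.coe_basis (h : IsFrameAt x β) :
    ⇑h.basis = (Fin.cons (x : Amb q) β : Fin (q + 1) → Amb q) := by
  simp [IsFrameAt.basis]

theorem IsFrameAt.inner_base (h : IsFrameAt x β) (j : Fin q) : inner ℝ (x : Amb q) (β j) = 0 := by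
  simpa using h.2 (i := 0) (j := j.succ) (Fin.succ_ne_zero j).symm

theorem IsFrameAt.inner_frame (h : IsFrameAt x β) (i j : Fin q) :
    inner ℝ (β i) (β j) = if i = j then 1 else 0 := by
  simpa using orthonormal_iff_ite.1 h i.succ j.succ

theorem IsFrameAt.inner_frameMap (h : IsFrameAt x β) (u : Tan q) :
    inner ℝ (x : Amb q) (frameMap β u) = 0 := by
  simp [frameMap_apply, inner_sum, inner_smul_right, h.inner_base]

theorem IsFrameAt.inner_frameMap_frame (h : IsFrameAt x β) (u : Tan q) (j : Fin q) :
    inner ℝ (frameMap β u) (β j) = u j := by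
  simp [frameMap_apply, sum_inner, inner_smul_left, h.inner_frame]

theorem IsFrameAt.norm_frameMap (h : IsFrameAt x β) (u : Tan q) : ‖frameMap β u‖ = ‖u‖ := by
  rw [← sq_eq_sq₀ (norm_nonneg _) (norm_nonneg _), ← real_inner_self_eq_norm_sq,
    EuclideanSpace.real_norm_sq_eq]
  conv_lhs => rw [frameMap_apply β u, inner_sum]
  refine Finset.sum_congr rfl fun j _ => ?_
  rw [inner_smul_right, ← frameMap_apply, h.inner_frameMap_frame, sq]

theorem IsFrameAt.norm_add_sq (h : IsFrameAt x β) (u : Tan q) :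
    ‖(x : Amb q) + frameMap β u‖ ^ 2 = 1 + ‖u‖ ^ 2 := by
  rw [norm_add_sq_real, h.inner_frameMap, norm_eq_of_mem_sphere, h.norm_frameMap]
  ring

theorem IsFrameAt.norm_add (h : IsFrameAt x β) (u : Tan q) :
    ‖(x : Amb q) + frameMap β u‖ = √(1 + ‖u‖ ^ 2) := by
  rw [← h.norm_add_sq, Real.sqrt_sq (norm_nonneg _)]

theorem IsFrameAt.add_ne_zero (h : IsFrameAt x β) (u : Tan q) :
    (x : Amb q) + frameMap β u ≠ 0 := by
  rw [← norm_pos_iff, h.norm_add]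
  positivity

theorem IsFrameAt.measurePreserving_smul_add (h : IsFrameAt x β) :
    MeasurePreserving (fun z : ℝ × Tan q => z.1 • (x : Amb q) + frameMap β z.2) := by
  have hcoord : MeasurePreserving (Prod.map id (WithLp.ofLp : Tan q → Fin q → ℝ))
      (volume : Measure (ℝ × Tan q)) (volume : Measure (ℝ × (Fin q → ℝ))) :=
    (MeasurePreserving.id volume).prod (PiLp.volume_preserving_ofLp (Fin q))
  have hcons := (volume_preserving_piFinSuccAbove (fun _ : Fin (q + 1) => ℝ) 0).symm
  have htoLp := PiLp.volume_preserving_toLp (Fin (q + 1))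
  have heq : (fun z : ℝ × Tan q => z.1 • (x : Amb q) + frameMap β z.2) =
      h.basis.repr.symm ∘ WithLp.toLp 2 ∘ (MeasurableEquiv.piFinSuccAbove (fun _ => ℝ) 0).symm ∘
        Prod.map id WithLp.ofLp := by
    ext1 z
    rw [Function.comp_apply, ← OrthonormalBasis.sum_repr_symm, h.coe_basis, Fin.sum_univ_succ,
      frameMap_apply]
    simp [MeasurableEquiv.piFinSuccAbove]
  rw [heq]
  exact h.basis.measurePreserving_repr_symm.comp (htoLp.comp (hcons.comp hcoord))

/-- The pairs of a point of the sphere and a frame at it: the compact space over which the limits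
are localized, since a frame field `x ↦ b x` need not be continuous. -/
abbrev FrameSpace (q : ℕ) : Type :=
  {p : Sph q × (Fin q → Sph q) // IsFrameAt p.1 fun j => (p.2 j : Amb q)}

instance compactSpace_frameSpace (q : ℕ) : CompactSpace (FrameSpace q) := by
  let vec (p : Sph q × (Fin q → Sph q)) : Fin (q + 1) → Amb q :=
    Fin.cons (p.1 : Amb q) fun j => (p.2 j : Amb q)
  have hvec : ∀ a, Continuous fun p => vec p a := Fin.cases
    (continuous_subtype_val.comp continuous_fst)
    fun k => continuous_subtype_val.comp ((continuous_apply k).comp continuous_snd)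
  have hsetOf : {p : Sph q × (Fin q → Sph q) | IsFrameAt p.1 fun j => (p.2 j : Amb q)} =
      ⋂ a, ⋂ c, {p | inner ℝ (vec p a) (vec p c) = if a = c then 1 else 0} := by
    ext p
    simp only [mem_iInter, mem_ofPred_eq]
    exact orthonormal_iff_ite
  have hclosed : IsClosed
      {p : Sph q × (Fin q → Sph q) | IsFrameAt p.1 fun j => (p.2 j : Amb q)} := by
    rw [hsetOf]
    exact isClosed_iInter fun a => isClosed_iInter fun c =>
      isClosed_eq ((hvec a).inner (hvec c)) continuous_const
  exact isCompact_iff_compactSpace.1 hclosed.isCompact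

/-- The point `x` together with the frame `b x`. -/
def IsTangentFrame.frameSpace {b : Sph q → Fin q → Amb q} (hb : IsTangentFrame b)
    (x : Sph q) : FrameSpace q :=
  ⟨(x, fun j => ⟨b x j, by simpa using (hb x).1 j.succ⟩), hb x⟩

/-- The radial projection `z / ‖z‖` of `z` to the sphere, with the value `x` at `z = 0`. -/
def toSph (x : Sph q) (z : Amb q) : Sph q :=
  open Classical in
  if hz : z ≠ 0 then ⟨‖z‖⁻¹ • z, by simp [norm_smul, norm_ne_zero_iff.mpr hz]⟩ else x

theorem coe_toSph (x : Sph q) {z : Amb q} (hz : z ≠ 0) : (toSph x z : Amb q) = ‖z‖⁻¹ • z := by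
  simp [toSph, hz]

theorem radialExt_eq (g : Sph q → ℝ) (x : Sph q) {z : Amb q} (hz : z ≠ 0) :
    radialExt g z = g (toSph x z) := by
  simp [radialExt, toSph, hz]

theorem toSph_coe (x y : Sph q) : toSph x (y : Amb q) = y := by
  ext1
  simp [coe_toSph x (ne_zero_of_mem_unit_sphere y)]

theorem toSph_smul (x : Sph q) {c : ℝ} (hc : 0 < c) (z : Amb q) : toSph x (c • z) = toSph x z := by
  by_cases hz : z = 0
  · simp [hz]
  · ext1
    rw [coe_toSph x (smul_ne_zero hc.ne' hz), coe_toSph x hz, norm_smul, Real.norm_of_nonneg hc.le,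
      smul_smul]
    congr 1
    field_simp

theorem measurable_toSph (x : Sph q) : Measurable (toSph x) := by
  classical
  have hcoe : (Subtype.val ∘ toSph x : Amb q → Amb q) =
      fun z => if z ≠ 0 then ‖z‖⁻¹ • z else (x : Amb q) := by
    ext1 z
    by_cases hz : z = 0 <;> simp [toSph, hz]
  refine (MeasurableEmbedding.subtype_coe
    Metric.isClosed_sphere.measurableSet).measurable_comp_iff.1 ?_
  rw [hcoe]
  exact Measurable.ite (measurableSet_singleton (0 : Amb q)).compl (by fun_prop) measurable_const

/-- The gnomonic chart `u ↦ (x + B u) / ‖x + B u‖` of the open half-sphere around `x`. -/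
def gnomonic (x : Sph q) (β : Fin q → Amb q) (u : Tan q) : Sph q :=
  toSph x ((x : Amb q) + frameMap β u)

theorem IsFrameAt.coe_gnomonic (h : IsFrameAt x β) (u : Tan q) :
    (gnomonic x β u : Amb q) = (√(1 + ‖u‖ ^ 2))⁻¹ • ((x : Amb q) + frameMap β u) := by
  rw [gnomonic, coe_toSph x (h.add_ne_zero u), h.norm_add]

theorem IsFrameAt.radialExt_add (h : IsFrameAt x β) (g : Sph q → ℝ) (u : Tan q) :
    radialExt g ((x : Amb q) + frameMap β u) = g (gnomonic x β u) :=
  radialExt_eq g x (h.add_ne_zero u)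

theorem IsFrameAt.continuous_gnomonic (h : IsFrameAt x β) : Continuous (gnomonic x β) := by
  refine Topology.IsInducing.subtypeVal.continuous_iff.2 ?_
  have hcoe : (Subtype.val ∘ gnomonic x β : Tan q → Amb q) =
      fun u => (√(1 + ‖u‖ ^ 2))⁻¹ • ((x : Amb q) + frameMap β u) := funext h.coe_gnomonic
  rw [hcoe]
  have hinv : Continuous fun u : Tan q => (√(1 + ‖u‖ ^ 2))⁻¹ :=
    Continuous.inv₀ (by fun_prop) fun u => by positivity
  exact hinv.smul (by fun_prop)

theorem IsFrameAt.inner_gnomonic (h : IsFrameAt x β) (u : Tan q) :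
    inner ℝ (x : Amb q) (gnomonic x β u : Amb q) = (√(1 + ‖u‖ ^ 2))⁻¹ := by
  rw [h.coe_gnomonic, inner_smul_right, inner_add_right, h.inner_frameMap,
    real_inner_self_eq_norm_sq, norm_eq_of_mem_sphere]
  simp

theorem IsFrameAt.inner_gnomonic_sub_frame (h : IsFrameAt x β) (u : Tan q) (j : Fin q) :
    inner ℝ ((gnomonic x β u : Amb q) - x) (β j) = (√(1 + ‖u‖ ^ 2))⁻¹ * u j := by
  rw [h.coe_gnomonic, inner_sub_left, inner_smul_left, inner_add_left, h.inner_frameMap_frame,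
    h.inner_base]
  simp

end Frame

/-! ### The surface measure in the gnomonic chart -/

section Chart

variable {q : ℕ} {x : Sph q} {β : Fin q → Amb q} {s : Set (Sph q)}

theorem lintegral_Ioo_pow (n : ℕ) {a : ℝ} (ha : 0 ≤ a) :
    ∫⁻ t in Ioo 0 a, ENNReal.ofReal (t ^ n) = ENNReal.ofReal (a ^ (n + 1) / (n + 1)) := by
  rw [← ofReal_integral_eq_lintegral_ofReal]
  · rw [← integral_Ioc_eq_integral_Ioo, ← intervalIntegral.integral_of_le ha, integral_pow]
    simp
  · exact ((continuous_pow n).integrableOn_Icc).mono_set Ioo_subset_Icc_self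
  · filter_upwards [ae_restrict_mem measurableSet_Ioo] with t ht
    exact pow_nonneg ht.1.le _

/-- The open half-sphere around `x`. -/
def halfSphere (x : Sph q) : Set (Sph q) := {y | 0 < inner ℝ (x : Amb q) (y : Amb q)}

/-- The part of the open unit ball in the cone over `s ∩ halfSphere x`, whose volume defines the
surface measure of `s ∩ halfSphere x`. -/
def halfCone (x : Sph q) (s : Set (Sph q)) : Set (Amb q) :=
  {z | 0 < inner ℝ (x : Amb q) z ∧ ‖z‖ < 1 ∧ toSph x z ∈ s}

theorem measurableSet_halfSphere (x : Sph q) : MeasurableSet (halfSphere x) :=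
  measurableSet_lt measurable_const (by fun_prop)

theorem measurableSet_halfCone (x : Sph q) (hs : MeasurableSet s) :
    MeasurableSet (halfCone x s) :=
  (measurableSet_lt (f := fun _ => (0 : ℝ)) (g := fun z => inner ℝ (x : Amb q) z)
    measurable_const (by fun_prop)).inter
    ((measurableSet_lt measurable_norm measurable_const).inter (measurable_toSph x hs))

open scoped Pointwise in
theorem Ioo_smul_image_inter_halfSphere (x : Sph q) (s : Set (Sph q)) :
    Ioo (0 : ℝ) 1 • (Subtype.val '' (s ∩ halfSphere x) : Set (Amb q)) = halfCone x s := by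
  ext z
  simp only [Set.mem_smul, mem_image, mem_inter_iff]
  constructor
  · rintro ⟨r, hr, -, ⟨y, ⟨hys, hy⟩, rfl⟩, rfl⟩
    refine ⟨?_, ?_, ?_⟩
    · rw [inner_smul_right]
      exact mul_pos hr.1 hy
    · rw [norm_smul, norm_eq_of_mem_sphere, mul_one, Real.norm_of_nonneg hr.1.le]
      exact hr.2
    · rwa [toSph_smul x hr.1, toSph_coe]
  · rintro ⟨hzx, hz1, hzs⟩
    have hz : z ≠ 0 := by
      rintro rfl
      simp at hzx
    have hz' : 0 < ‖z‖ := norm_pos_iff.2 hz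
    refine ⟨‖z‖, ⟨hz', hz1⟩, _, ⟨toSph x z, ⟨hzs, ?_⟩, rfl⟩, ?_⟩
    · rw [halfSphere, mem_ofPred_eq, coe_toSph x hz, inner_smul_right]
      positivity
    · rw [coe_toSph x hz, smul_smul, mul_inv_cancel₀ hz'.ne', one_smul]

theorem IsFrameAt.smul_add_mem_halfCone_iff (h : IsFrameAt x β) {t : ℝ} (ht : 0 < t) (w : Tan q) :
    t • (x : Amb q) + frameMap β w ∈ halfCone x s ↔
      t < (√(1 + ‖t⁻¹ • w‖ ^ 2))⁻¹ ∧ gnomonic x β (t⁻¹ • w) ∈ s := by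
  have hfactor : t • (x : Amb q) + frameMap β w = t • ((x : Amb q) + frameMap β (t⁻¹ • w)) := by
    rw [smul_add, map_smul, smul_smul, mul_inv_cancel₀ ht.ne', one_smul]
  have hlt : ∀ r : ℝ, 0 < r → (t * r < 1 ↔ t < r⁻¹) := fun r hr => by
    rw [← one_div, lt_div_iff₀ hr]
  rw [hfactor, ← hlt _ (by positivity), gnomonic]
  simp only [halfCone, mem_ofPred_eq, inner_smul_right, inner_add_right, h.inner_frameMap,
    toSph_smul x ht, real_inner_self_eq_norm_sq, norm_eq_of_mem_sphere, norm_smul, h.norm_add,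
    Real.norm_of_nonneg ht.le]
  simp [ht]

theorem IsFrameAt.pos_of_smul_add_mem_halfCone (h : IsFrameAt x β) {t : ℝ} {w : Tan q}
    (hw : t • (x : Amb q) + frameMap β w ∈ halfCone x s) : 0 < t := by
  simpa [inner_add_right, inner_smul_right, h.inner_frameMap] using hw.1

theorem IsFrameAt.volume_slice_halfCone (h : IsFrameAt x β) (t : ℝ) :
    volume {w : Tan q | t • (x : Amb q) + frameMap β w ∈ halfCone x s} =
      ∫⁻ u in gnomonic x β ⁻¹' s,
        (Ioo 0 (√(1 + ‖u‖ ^ 2))⁻¹).indicator (fun t => ENNReal.ofReal (t ^ q)) t := by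
  rcases le_or_gt t 0 with ht | ht
  · have hempty : {w : Tan q | t • (x : Amb q) + frameMap β w ∈ halfCone x s} = ∅ :=
      eq_empty_of_forall_notMem fun w hw => ht.not_gt (h.pos_of_smul_add_mem_halfCone hw)
    simp [hempty, ht.not_gt]
  · set T : Set (Tan q) := {u | t < (√(1 + ‖u‖ ^ 2))⁻¹} with hT
    have hTm : MeasurableSet T := measurableSet_lt measurable_const (by fun_prop)
    have hscale : {w : Tan q | t • (x : Amb q) + frameMap β w ∈ halfCone x s} =
        (fun w : Tan q => t⁻¹ • w) ⁻¹' (T ∩ gnomonic x β ⁻¹' s) :=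
      Set.ext fun w => h.smul_add_mem_halfCone_iff ht w
    have hind : ∀ u : Tan q,
        (Ioo 0 (√(1 + ‖u‖ ^ 2))⁻¹).indicator (fun t => ENNReal.ofReal (t ^ q)) t =
          T.indicator (fun _ => ENNReal.ofReal (t ^ q)) u := fun u => by
      simp [indicator, ht, hT]
    simp_rw [hind]
    rw [hscale, Measure.addHaar_preimage_smul _ (inv_ne_zero ht.ne'), lintegral_indicator_const hTm,
      Measure.restrict_apply hTm]
    simp [abs_of_pos ht]

theorem IsFrameAt.volume_halfCone (h : IsFrameAt x β) (hs : MeasurableSet s) :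
    volume (halfCone x s) = ∫⁻ u in gnomonic x β ⁻¹' s,
      ENNReal.ofReal ((√(1 + ‖u‖ ^ 2))⁻¹ ^ (q + 1) / (q + 1)) := by
  have hm := measurableSet_halfCone x hs
  rw [← h.measurePreserving_smul_add.measure_preimage hm.nullMeasurableSet,
    Measure.volume_eq_prod, Measure.prod_apply (h.measurePreserving_smul_add.measurable hm)]
  refine (lintegral_congr fun t => h.volume_slice_halfCone (s := s) t).trans ?_
  rw [lintegral_lintegral_swap]
  · refine lintegral_congr fun u => ?_
    rw [lintegral_indicator measurableSet_Ioo, lintegral_Ioo_pow q (by positivity)]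
  · refine Measurable.aemeasurable ?_
    have hset : MeasurableSet {z : ℝ × Tan q | z.1 ∈ Ioo 0 (√(1 + ‖z.2‖ ^ 2))⁻¹} :=
      (measurableSet_lt measurable_const measurable_fst).inter
        (measurableSet_lt measurable_fst (by fun_prop))
    exact Measurable.indicator (f := fun z : ℝ × Tan q => ENNReal.ofReal (z.1 ^ q))
      (by fun_prop) hset

theorem IsFrameAt.surf_restrict_halfSphere (h : IsFrameAt x β) :
    (surf q).restrict (halfSphere x) =
      (volume.withDensity fun u : Tan q =>
        ENNReal.ofReal ((√(1 + ‖u‖ ^ 2) ^ (q + 1))⁻¹)).map (gnomonic x β) := by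
  have hg : Measurable (gnomonic x β) := h.continuous_gnomonic.measurable
  ext s hs
  rw [Measure.restrict_apply hs, Measure.map_apply hg hs, withDensity_apply _ (hg hs),
    Measure.toSphere_apply' _ (hs.inter (measurableSet_halfSphere x)),
    Ioo_smul_image_inter_halfSphere, h.volume_halfCone hs, ← lintegral_const_mul _ (by fun_prop)]
  refine lintegral_congr fun u => ?_
  rw [finrank_euclideanSpace_fin, ← ENNReal.ofReal_natCast, ← ENNReal.ofReal_mul (by positivity)]
  congr 1
  have : 0 < √(1 + ‖u‖ ^ 2) := by positivity
  rw [inv_pow]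
  push_cast
  field_simp

end Chart

/-! ### Asymptotics of kernel integrals on the sphere -/

/-- The unnormalized kernel `L ((1 - xᵀ y) / h²)`. -/
def rawKernel {q : ℕ} (L : ℝ → ℝ) (h : ℝ) (x y : Sph q) : ℝ :=
  L ((1 - inner ℝ (x : Amb q) (y : Amb q)) / h ^ 2)

/-- The functions `φ i` on the sphere grow at most polynomially in `(h i)⁻¹`; such a growth is
negligible against the exponential decay of the kernel away from its centre. -/
def PolyBounded {q : ℕ} {ι : Type*} (l : Filter ι) (h : ι → ℝ) (φ : ι → Sph q → ℝ) : Prop :=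
  ∃ C : ℝ, ∃ k : ℕ, 0 ≤ C ∧ ∀ᶠ i in l, ∀ y, |φ i y| ≤ C * (h i)⁻¹ ^ k

/-- The functions `φ i` on the sphere, read in the gnomonic chart at `x i` rescaled by `h i`,
converge to `Φ` with polynomial growth, and they are polynomially bounded on the whole sphere. -/
structure LocalLimit {q : ℕ} {ι : Type*} (l : Filter ι) (h : ι → ℝ) (x : ι → Sph q)
    (β : ι → Fin q → Amb q) (φ : ι → Sph q → ℝ) (Φ : Tan q → ℝ) : Prop where
  measurable : ∀ i, Measurable (φ i)
  far : PolyBounded l h φ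
  near : ∃ C : ℝ, ∃ k : ℕ, 0 ≤ C ∧ ∀ᶠ i in l, ∀ v : Tan q, ‖h i • v‖ ≤ 1 →
    |φ i (gnomonic (x i) (β i) (h i • v))| ≤ C * (1 + ‖v‖) ^ k
  tendsto : ∀ v, Tendsto (fun i => φ i (gnomonic (x i) (β i) (h i • v))) l (𝓝 (Φ v))

section LocalLimit

variable {q : ℕ} {ι : Type*} {l : Filter ι} {h : ι → ℝ} {x : ι → Sph q}
  {β : ι → Fin q → Amb q} {φ ψ : ι → Sph q → ℝ} {Φ Ψ : Tan q → ℝ}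

theorem PolyBounded.mul (hφ : PolyBounded l h φ) (hψ : PolyBounded l h ψ) :
    PolyBounded l h fun i y => φ i y * ψ i y := by
  obtain ⟨C, k, hC, hφ⟩ := hφ
  obtain ⟨D, n, hD, hψ⟩ := hψ
  refine ⟨C * D, k + n, mul_nonneg hC hD, ?_⟩
  filter_upwards [hφ, hψ] with i hi hi' y
  rw [abs_mul, pow_add, mul_mul_mul_comm]
  exact mul_le_mul (hi y) (hi' y) (abs_nonneg _) ((abs_nonneg _).trans (hi y))

theorem LocalLimit.mul (hφ : LocalLimit l h x β φ Φ) (hψ : LocalLimit l h x β ψ Ψ) :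
    LocalLimit l h x β (fun i y => φ i y * ψ i y) (fun v => Φ v * Ψ v) where
  measurable i := (hφ.measurable i).mul (hψ.measurable i)
  far := hφ.far.mul hψ.far
  near := by
    obtain ⟨C, k, hC, hφ⟩ := hφ.near
    obtain ⟨D, n, hD, hψ⟩ := hψ.near
    refine ⟨C * D, k + n, mul_nonneg hC hD, ?_⟩
    filter_upwards [hφ, hψ] with i hi hi' v hv
    rw [abs_mul, pow_add, mul_mul_mul_comm]
    exact mul_le_mul (hi v hv) (hi' v hv) (abs_nonneg _) ((abs_nonneg _).trans (hi v hv))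
  tendsto v := (hφ.tendsto v).mul (hψ.tendsto v)

end LocalLimit

section Kernel

variable {q : ℕ} {L : ℝ → ℝ}

theorem inner_sph_le_one (x y : Sph q) : inner ℝ (x : Amb q) (y : Amb q) ≤ 1 := by
  simpa using real_inner_le_norm (x : Amb q) (y : Amb q)

theorem rawKernel_arg_nonneg (h : ℝ) (x y : Sph q) :
    0 ≤ (1 - inner ℝ (x : Amb q) (y : Amb q)) / h ^ 2 :=
  div_nonneg (sub_nonneg.2 (inner_sph_le_one x y)) (sq_nonneg _)

theorem continuous_rawKernel (hL : IsDirectionalKernel L) (h : ℝ) (x : Sph q) :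
    Continuous (rawKernel L h x) :=
  hL.continuousOn.comp_continuous (by fun_prop) fun y => rawKernel_arg_nonneg h x y

theorem rawKernel_nonneg (hL : IsDirectionalKernel L) (h : ℝ) (x y : Sph q) :
    0 ≤ rawKernel L h x y :=
  hL.nonneg _ (rawKernel_arg_nonneg h x y)

theorem rawKernel_le {M α : ℝ} (hLM : ∀ r, 0 ≤ r → L r ≤ M * Real.exp (-α * r))
    (h : ℝ) (x y : Sph q) : rawKernel L h x y ≤
      M * Real.exp (-α * ((1 - inner ℝ (x : Amb q) (y : Amb q)) / h ^ 2)) :=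
  hLM _ (rawKernel_arg_nonneg h x y)

theorem IsDirectionalKernel.sq (hL : IsDirectionalKernel L) :
    IsDirectionalKernel fun r => L r ^ 2 where
  continuousOn := hL.continuousOn.pow 2
  nonneg r _ := sq_nonneg _
  nonzero := by
    obtain ⟨r, hr, h⟩ := hL.nonzero
    exact ⟨r, hr, pow_ne_zero 2 h⟩
  decay := by
    obtain ⟨M, α, hM, hα, h⟩ := hL.decay
    refine ⟨M ^ 2, 2 * α, by positivity, by positivity, fun r hr => ?_⟩
    calc L r ^ 2 ≤ (M * Real.exp (-α * r)) ^ 2 := pow_le_pow_left₀ (hL.nonneg r hr) (h r hr) 2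
      _ = M ^ 2 * Real.exp (-(2 * α) * r) := by
        rw [mul_pow, ← Real.exp_nat_mul]
        congr 2
        push_cast
        ring

theorem exp_neg_mul_sq_le {a t : ℝ} (ha : 0 < a) (ht : 0 ≤ t) (n : ℕ) :
    Real.exp (-a * t ^ 2) ≤
      Real.exp a * (n.factorial / (a / 2) ^ n) * ((1 + t) ^ (2 * n))⁻¹ := by
  have hshift : Real.exp (-a * t ^ 2) ≤ Real.exp a * Real.exp (-(a / 2 * (1 + t) ^ 2)) := by
    rw [← Real.exp_add, Real.exp_le_exp]
    nlinarith [mul_nonneg ha.le (sq_nonneg (1 - t))]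
  have hpow : Real.exp (-(a / 2 * (1 + t) ^ 2)) ≤
      n.factorial / (a / 2) ^ n * ((1 + t) ^ (2 * n))⁻¹ := by
    rw [Real.exp_neg]
    refine (inv_anti₀ (by positivity) (Real.pow_div_factorial_le_exp (a / 2 * (1 + t) ^ 2)
      (by positivity) n)).trans (le_of_eq ?_)
    rw [mul_pow, ← pow_mul]
    field_simp
  rw [mul_assoc]
  exact hshift.trans (by gcongr)

theorem integrable_one_add_norm_pow_mul_exp {a : ℝ} (ha : 0 < a) (k : ℕ) :
    Integrable fun v : Tan q => (1 + ‖v‖) ^ k * Real.exp (-a * ‖v‖ ^ 2) := by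
  set n := k + q + 1
  set B : ℝ := Real.exp a * (n.factorial / (a / 2) ^ n)
  have hint := (integrable_one_add_norm (E := Tan q) (μ := volume) (r := (q : ℝ) + 1)
    (by simp)).const_mul B
  refine hint.mono' (by fun_prop) (Eventually.of_forall fun v => ?_)
  have hrpow : (1 + ‖v‖) ^ (-((q : ℝ) + 1)) = ((1 + ‖v‖) ^ (q + 1))⁻¹ := by
    rw [Real.rpow_neg (by positivity)]
    exact_mod_cast congrArg _ (Real.rpow_natCast (1 + ‖v‖) (q + 1))
  have hcancel : (1 + ‖v‖) ^ k * ((1 + ‖v‖) ^ (2 * n))⁻¹ ≤ ((1 + ‖v‖) ^ (q + 1))⁻¹ := by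
    rw [← div_eq_mul_inv, div_le_iff₀ (by positivity), inv_mul_eq_div, le_div_iff₀ (by positivity),
      ← pow_add]
    exact pow_le_pow_right₀ (by simp) (by omega)
  rw [Real.norm_of_nonneg (by positivity), hrpow]
  calc (1 + ‖v‖) ^ k * Real.exp (-a * ‖v‖ ^ 2)
      ≤ (1 + ‖v‖) ^ k * (B * ((1 + ‖v‖) ^ (2 * n))⁻¹) := by
        gcongr
        exact exp_neg_mul_sq_le ha (norm_nonneg v) n
    _ = B * ((1 + ‖v‖) ^ k * ((1 + ‖v‖) ^ (2 * n))⁻¹) := by ring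
    _ ≤ B * ((1 + ‖v‖) ^ (q + 1))⁻¹ := by gcongr

theorem tendsto_inv_pow_mul_exp {ι : Type*} {l : Filter ι} {h : ι → ℝ} (h_pos : ∀ i, 0 < h i)
    (h_zero : Tendsto h l (𝓝 0)) {a : ℝ} (ha : 0 < a) (n : ℕ) :
    Tendsto (fun i => (h i)⁻¹ ^ n * Real.exp (-a / h i ^ 2)) l (𝓝 0) := by
  have hinv : Tendsto (fun i => (h i)⁻¹) l atTop :=
    tendsto_inv_nhdsGT_zero.comp (tendsto_nhdsWithin_iff.2 ⟨h_zero, Eventually.of_forall h_pos⟩)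
  refine ((tendsto_rpow_mul_exp_neg_mul_atTop_nhds_zero ((n : ℝ) / 2) a ha).comp
    ((tendsto_pow_atTop two_ne_zero).comp hinv)).congr fun i => ?_
  have hi := inv_pos.2 (h_pos i)
  simp only [Function.comp_apply]
  congr 1
  · rw [← Real.rpow_natCast ((h i)⁻¹) 2, ← Real.rpow_mul hi.le, ← Real.rpow_natCast]
    congr 1
    push_cast
    ring
  · rw [inv_pow, div_eq_mul_inv]

end Kernel

/-- The spherical cap around `x` which is the image of the unit ball in the gnomonic chart. -/
def nearCap {q : ℕ} (x : Sph q) : Set (Sph q) :=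
  {y | (√2)⁻¹ ≤ inner ℝ (x : Amb q) (y : Amb q)}

/-- The integrand of the kernel integral of `φ` over `nearCap x`, in the gnomonic chart rescaled
by `h`. -/
def chartIntegrand {q : ℕ} (L : ℝ → ℝ) (h : ℝ) (x : Sph q) (β : Fin q → Amb q) (φ : Sph q → ℝ)
    (v : Tan q) : ℝ :=
  if ‖h • v‖ ≤ 1 then (√(1 + ‖h • v‖ ^ 2) ^ (q + 1))⁻¹ *
    (rawKernel L h x (gnomonic x β (h • v)) * φ (gnomonic x β (h • v))) else 0

section Near

variable {q : ℕ} {x : Sph q} {β : Fin q → Amb q} {L : ℝ → ℝ}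

theorem measurableSet_nearCap (x : Sph q) : MeasurableSet (nearCap x) :=
  measurableSet_le measurable_const (by fun_prop)

theorem IsFrameAt.gnomonic_mem_nearCap (hf : IsFrameAt x β) (u : Tan q) :
    gnomonic x β u ∈ nearCap x ↔ ‖u‖ ≤ 1 := by
  change (√2)⁻¹ ≤ _ ↔ _
  rw [hf.inner_gnomonic, inv_le_inv₀ (by positivity) (by positivity),
    Real.sqrt_le_sqrt_iff (by norm_num), ← sq_le_one_iff₀ (norm_nonneg u)]
  constructor <;> intro hu <;> linarith

theorem IsFrameAt.setIntegral_nearCap (hf : IsFrameAt x β) {G : Sph q → ℝ} (hG : Measurable G) :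
    ∫ y in nearCap x, G y ∂surf q =
      ∫ u : Tan q, if ‖u‖ ≤ 1 then (√(1 + ‖u‖ ^ 2) ^ (q + 1))⁻¹ * G (gnomonic x β u) else 0 := by
  have hsub : nearCap x ⊆ halfSphere x := fun y hy =>
    lt_of_lt_of_le (show (0 : ℝ) < (√2)⁻¹ by positivity) hy
  rw [← Measure.restrict_restrict_of_subset hsub, hf.surf_restrict_halfSphere,
    ← integral_indicator (measurableSet_nearCap x),
    integral_map hf.continuous_gnomonic.measurable.aemeasurable
      (hG.indicator (measurableSet_nearCap x)).aestronglyMeasurable,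
    integral_withDensity_eq_integral_toReal_smul (by fun_prop) (by simp)]
  refine integral_congr_ae (Eventually.of_forall fun u => ?_)
  have hnonneg : 0 ≤ (√(1 + ‖u‖ ^ 2) ^ (q + 1))⁻¹ := by positivity
  simp only [smul_eq_mul, ENNReal.toReal_ofReal hnonneg, indicator, hf.gnomonic_mem_nearCap,
    mul_ite, mul_zero]

theorem IsFrameAt.rawKernel_gnomonic (hf : IsFrameAt x β) {h : ℝ} (hh : 0 < h) (v : Tan q) :
    rawKernel L h x (gnomonic x β (h • v)) =
      L (‖v‖ ^ 2 / (√(1 + ‖h • v‖ ^ 2) * (√(1 + ‖h • v‖ ^ 2) + 1))) := by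
  rw [rawKernel, hf.inner_gnomonic]
  congr 1
  have hsq : √(1 + ‖h • v‖ ^ 2) ^ 2 = 1 + h ^ 2 * ‖v‖ ^ 2 := by
    rw [Real.sq_sqrt (by positivity), norm_smul, mul_pow, Real.norm_eq_abs, sq_abs]
  have hpos : 0 < √(1 + ‖h • v‖ ^ 2) := by positivity
  generalize √(1 + ‖h • v‖ ^ 2) = s at *
  field_simp
  linear_combination hsq

theorem IsFrameAt.rawKernel_gnomonic_le (hf : IsFrameAt x β) {M α : ℝ} (hM : 0 ≤ M) (hα : 0 ≤ α)
    (hLM : ∀ r, 0 ≤ r → L r ≤ M * Real.exp (-α * r)) {h : ℝ} (hh : 0 < h) {v : Tan q}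
    (hv : ‖h • v‖ ≤ 1) :
    rawKernel L h x (gnomonic x β (h • v)) ≤ M * Real.exp (-(α / 4) * ‖v‖ ^ 2) := by
  have hs : √(1 + ‖h • v‖ ^ 2) ≤ 3 / 2 :=
    Real.sqrt_le_iff.2 ⟨by norm_num, by nlinarith [norm_nonneg (h • v)]⟩
  have hpos : 0 < √(1 + ‖h • v‖ ^ 2) := by positivity
  rw [hf.rawKernel_gnomonic hh]
  refine (hLM _ (by positivity)).trans ?_
  have hquarter : ‖v‖ ^ 2 / 4 ≤
      ‖v‖ ^ 2 / (√(1 + ‖h • v‖ ^ 2) * (√(1 + ‖h • v‖ ^ 2) + 1)) := by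
    gcongr
    nlinarith
  refine mul_le_mul_of_nonneg_left (Real.exp_le_exp.2 ?_) hM
  linarith [mul_le_mul_of_nonneg_left hquarter hα]

theorem IsFrameAt.inv_pow_mul_setIntegral_nearCap (hf : IsFrameAt x β)
    (hL : IsDirectionalKernel L) {h : ℝ} (hh : 0 < h) {φ : Sph q → ℝ} (hφ : Measurable φ) :
    (h ^ q)⁻¹ * ∫ y in nearCap x, rawKernel L h x y * φ y ∂surf q =
      ∫ v, chartIntegrand L h x β φ v := by
  have hscale := Measure.integral_comp_smul (volume : Measure (Tan q)) (fun u : Tan q =>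
    if ‖u‖ ≤ 1 then (√(1 + ‖u‖ ^ 2) ^ (q + 1))⁻¹ *
      (rawKernel L h x (gnomonic x β u) * φ (gnomonic x β u)) else 0) h
  rw [finrank_euclideanSpace_fin, abs_of_pos (by positivity), smul_eq_mul] at hscale
  rw [hf.setIntegral_nearCap (G := fun y => rawKernel L h x y * φ y)
    ((continuous_rawKernel hL h x).measurable.mul hφ)]
  exact hscale.symm

theorem IsFrameAt.measurable_chartIntegrand (hf : IsFrameAt x β) (hL : IsDirectionalKernel L)
    (h : ℝ) {φ : Sph q → ℝ} (hφ : Measurable φ) : Measurable (chartIntegrand L h x β φ) := by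
  have hg : Measurable fun v : Tan q => gnomonic x β (h • v) :=
    (hf.continuous_gnomonic.comp (continuous_const_smul h)).measurable
  refine Measurable.ite (measurableSet_le (by fun_prop) measurable_const) ?_ measurable_const
  exact Measurable.mul (by fun_prop)
    (((continuous_rawKernel hL h x).measurable.comp hg).mul (hφ.comp hg))

theorem IsFrameAt.norm_chartIntegrand_le (hf : IsFrameAt x β) (hL : IsDirectionalKernel L)
    {M α : ℝ} (hM : 0 ≤ M) (hα : 0 ≤ α) (hLM : ∀ r, 0 ≤ r → L r ≤ M * Real.exp (-α * r))
    {h : ℝ} (hh : 0 < h) {φ : Sph q → ℝ} {b : ℝ} (hb : 0 ≤ b) {v : Tan q}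
    (hφ : ‖h • v‖ ≤ 1 → |φ (gnomonic x β (h • v))| ≤ b) :
    ‖chartIntegrand L h x β φ v‖ ≤ M * Real.exp (-(α / 4) * ‖v‖ ^ 2) * b := by
  rw [chartIntegrand]
  split_ifs with hv
  · have hone : (√(1 + ‖h • v‖ ^ 2) ^ (q + 1))⁻¹ ≤ 1 :=
      inv_le_one_of_one_le₀ (one_le_pow₀ (Real.one_le_sqrt.2 (by simp)))
    rw [norm_mul, norm_mul, Real.norm_of_nonneg (rawKernel_nonneg hL _ _ _),
      Real.norm_of_nonneg (by positivity)]
    refine (mul_le_of_le_one_left ?_ hone).trans ?_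
    · exact mul_nonneg (rawKernel_nonneg hL _ _ _) (norm_nonneg _)
    · exact mul_le_mul (hf.rawKernel_gnomonic_le hM hα hLM hh hv) (hφ hv) (norm_nonneg _)
        (by positivity)
  · rw [norm_zero]
    positivity

theorem IsFrameAt.chartIntegrand_neg (hf : IsFrameAt x β) {h : ℝ} (hh : 0 < h) {φ : Sph q → ℝ}
    (hodd : ∀ u, φ (gnomonic x β (-u)) = -φ (gnomonic x β u)) (v : Tan q) :
    chartIntegrand L h x β φ (-v) = -chartIntegrand L h x β φ v := by
  have heven : rawKernel L h x (gnomonic x β (h • -v)) =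
      rawKernel L h x (gnomonic x β (h • v)) := by
    rw [hf.rawKernel_gnomonic hh, hf.rawKernel_gnomonic hh, smul_neg, norm_neg, norm_neg]
  simp only [chartIntegrand, heven]
  simp only [smul_neg, norm_neg, hodd]
  split_ifs <;> ring

end Near

section Asymptotics

variable {q : ℕ} {ι : Type*} {l : Filter ι} {h : ι → ℝ} {x : ι → Sph q}
  {β : ι → Fin q → Amb q} {φ : ι → Sph q → ℝ} {Φ : Tan q → ℝ} {L : ℝ → ℝ}

theorem integrable_surf_of_bound {φ : Sph q → ℝ} (hφ : Measurable φ) {C : ℝ}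
    (hC : ∀ y, |φ y| ≤ C) : Integrable φ (surf q) :=
  Integrable.of_bound hφ.aestronglyMeasurable C (Eventually.of_forall hC)

theorem eventually_integrable_rawKernel_mul (hL : IsDirectionalKernel L)
    (hm : ∀ i, Measurable (φ i)) (hfar : PolyBounded l h φ) :
    ∀ᶠ i in l, Integrable (fun y => rawKernel L (h i) (x i) y * φ i y) (surf q) := by
  obtain ⟨C, k, -, hC⟩ := hfar
  filter_upwards [hC] with i hi
  refine (integrable_surf_of_bound (hm i) hi).bdd_mul
    (c := sSup (range fun y => ‖rawKernel L (h i) (x i) y‖))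
    (continuous_rawKernel hL (h i) (x i)).aestronglyMeasurable (Eventually.of_forall fun y => ?_)
  exact le_csSup (isCompact_range (continuous_rawKernel hL (h i) (x i)).norm).bddAbove
    (mem_range_self y)

theorem norm_setIntegral_compl_nearCap_le (hL : IsDirectionalKernel L) {M α : ℝ} (hM : 0 ≤ M)
    (hα : 0 ≤ α) (hLM : ∀ r, 0 ≤ r → L r ≤ M * Real.exp (-α * r)) (h : ℝ) (x : Sph q)
    {φ : Sph q → ℝ} {b : ℝ} (hb : 0 ≤ b) (hφ : ∀ y, |φ y| ≤ b) :
    ‖∫ y in (nearCap x)ᶜ, rawKernel L h x y * φ y ∂surf q‖ ≤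
      M * Real.exp (-(α * (1 - (√2)⁻¹)) / h ^ 2) * b * (surf q).real univ := by
  have hset : ‖∫ y in (nearCap x)ᶜ, rawKernel L h x y * φ y ∂surf q‖ ≤
      M * Real.exp (-(α * (1 - (√2)⁻¹)) / h ^ 2) * b * (surf q).real (nearCap x)ᶜ := by
    refine norm_setIntegral_le_of_norm_le_const (measure_lt_top _ _) fun y hy => ?_
    have hy' : inner ℝ (x : Amb q) (y : Amb q) < (√2)⁻¹ := not_le.1 hy
    rw [norm_mul, Real.norm_of_nonneg (rawKernel_nonneg hL _ _ _)]
    refine mul_le_mul ((rawKernel_le hLM _ _ _).trans ?_) (hφ y) (norm_nonneg _) (by positivity)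
    rw [neg_mul, neg_div, mul_div_assoc]
    gcongr
  refine hset.trans ?_
  gcongr
  · exact measure_ne_top _ _
  · exact subset_univ _

theorem tendsto_setIntegral_compl_nearCap (hL : IsDirectionalKernel L) (h_pos : ∀ i, 0 < h i)
    (h_zero : Tendsto h l (𝓝 0)) (hfar : PolyBounded l h φ) :
    Tendsto (fun i => (h i ^ q)⁻¹ * ∫ y in (nearCap (x i))ᶜ,
      rawKernel L (h i) (x i) y * φ i y ∂surf q) l (𝓝 0) := by
  obtain ⟨C, k, hC0, hC⟩ := hfar
  obtain ⟨M, α, hM, hα, hLM⟩ := hL.decay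
  have hgap : 0 < 1 - (√2)⁻¹ :=
    sub_pos.2 (inv_lt_one_of_one_lt₀ (by rw [Real.lt_sqrt] <;> norm_num))
  have hlim := (tendsto_inv_pow_mul_exp h_pos h_zero (a := α * (1 - (√2)⁻¹)) (by positivity)
    (q + k)).const_mul (M * C * (surf q).real univ)
  rw [mul_zero] at hlim
  refine squeeze_zero_norm' ?_ hlim
  filter_upwards [hC] with i hi
  have hh := h_pos i
  rw [norm_mul, Real.norm_of_nonneg (by positivity)]
  refine (mul_le_mul_of_nonneg_left (norm_setIntegral_compl_nearCap_le hL hM.le hα.le hLM (h i)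
    (x i) (by positivity) hi) (by positivity)).trans (le_of_eq ?_)
  rw [pow_add, inv_pow, inv_pow]
  ring

theorem tendsto_norm_smul (h_zero : Tendsto h l (𝓝 0)) (v : Tan q) :
    Tendsto (fun i => ‖h i • v‖) l (𝓝 0) := by
  simpa using (h_zero.smul_const v).norm

theorem tendsto_sqrt_one_add_norm_smul_sq (h_zero : Tendsto h l (𝓝 0)) (v : Tan q) :
    Tendsto (fun i => √(1 + ‖h i • v‖ ^ 2)) l (𝓝 1) := by
  simpa using (((tendsto_norm_smul h_zero v).pow 2).const_add 1).sqrt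

theorem tendsto_rawKernel_gnomonic (hL : IsDirectionalKernel L) (h_pos : ∀ i, 0 < h i)
    (h_zero : Tendsto h l (𝓝 0)) (hβ : ∀ i, IsFrameAt (x i) (β i)) (v : Tan q) :
    Tendsto (fun i => rawKernel L (h i) (x i) (gnomonic (x i) (β i) (h i • v))) l
      (𝓝 (L (‖v‖ ^ 2 / 2))) := by
  have hs := tendsto_sqrt_one_add_norm_smul_sq h_zero v
  have harg := (tendsto_const_nhds (x := ‖v‖ ^ 2)).div (hs.mul (hs.add_const 1)) (by norm_num)
  rw [one_mul, one_add_one_eq_two] at harg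
  simp_rw [fun i => (hβ i).rawKernel_gnomonic (L := L) (h_pos i) v]
  exact (hL.continuousOn _ (mem_Ici.2 (by positivity))).tendsto.comp
    (tendsto_nhdsWithin_iff.2 ⟨harg, Eventually.of_forall fun i => mem_Ici.2 (by positivity)⟩)

theorem LocalLimit.tendsto_chartIntegrand (hL : IsDirectionalKernel L) (h_pos : ∀ i, 0 < h i)
    (h_zero : Tendsto h l (𝓝 0)) (hβ : ∀ i, IsFrameAt (x i) (β i))
    (hφ : LocalLimit l h x β φ Φ) (v : Tan q) :
    Tendsto (fun i => chartIntegrand L (h i) (x i) (β i) (φ i) v) l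
      (𝓝 (L (‖v‖ ^ 2 / 2) * Φ v)) := by
  have hjacobian : Tendsto (fun i => (√(1 + ‖h i • v‖ ^ 2) ^ (q + 1))⁻¹) l (𝓝 1) := by
    simpa using ((tendsto_sqrt_one_add_norm_smul_sq h_zero v).pow (q + 1)).inv₀ (by simp)
  have hprod := hjacobian.mul
    ((tendsto_rawKernel_gnomonic hL h_pos h_zero hβ v).mul (hφ.tendsto v))
  rw [one_mul] at hprod
  refine hprod.congr' ?_
  filter_upwards [(tendsto_norm_smul h_zero v).eventually_le_const zero_lt_one] with i hi
  rw [chartIntegrand, if_pos hi]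

theorem LocalLimit.tendsto_setIntegral_nearCap [l.IsCountablyGenerated]
    (hL : IsDirectionalKernel L) (h_pos : ∀ i, 0 < h i) (h_zero : Tendsto h l (𝓝 0))
    (hβ : ∀ i, IsFrameAt (x i) (β i)) (hφ : LocalLimit l h x β φ Φ) :
    Tendsto (fun i => (h i ^ q)⁻¹ * ∫ y in nearCap (x i),
      rawKernel L (h i) (x i) y * φ i y ∂surf q) l
      (𝓝 (∫ v : Tan q, L (‖v‖ ^ 2 / 2) * Φ v)) := by
  obtain ⟨C, k, hC0, hC⟩ := hφ.near
  obtain ⟨M, α, hM, hα, hLM⟩ := hL.decay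
  simp_rw [fun i => (hβ i).inv_pow_mul_setIntegral_nearCap hL (h_pos i) (hφ.measurable i)]
  refine tendsto_integral_filter_of_dominated_convergence
    (fun v => M * C * ((1 + ‖v‖) ^ k * Real.exp (-(α / 4) * ‖v‖ ^ 2)))
    (Eventually.of_forall fun i =>
      ((hβ i).measurable_chartIntegrand hL (h i) (hφ.measurable i)).aestronglyMeasurable) ?_
    ((integrable_one_add_norm_pow_mul_exp (by positivity) k).const_mul _)
    (Eventually.of_forall (hφ.tendsto_chartIntegrand hL h_pos h_zero hβ))
  filter_upwards [hC] with i hi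
  refine Eventually.of_forall fun v => ((hβ i).norm_chartIntegrand_le hL hM.le hα.le hLM (h_pos i)
    (by positivity) (hi v)).trans (le_of_eq ?_)
  ring

theorem LocalLimit.tendsto_integral [l.IsCountablyGenerated] (hL : IsDirectionalKernel L)
    (h_pos : ∀ i, 0 < h i) (h_zero : Tendsto h l (𝓝 0)) (hβ : ∀ i, IsFrameAt (x i) (β i))
    (hφ : LocalLimit l h x β φ Φ) :
    Tendsto (fun i => (h i ^ q)⁻¹ * ∫ y, rawKernel L (h i) (x i) y * φ i y ∂surf q) l
      (𝓝 (∫ v : Tan q, L (‖v‖ ^ 2 / 2) * Φ v)) := by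
  have hsplit := (hφ.tendsto_setIntegral_nearCap hL h_pos h_zero hβ).add
    (tendsto_setIntegral_compl_nearCap (x := x) hL h_pos h_zero hφ.far)
  rw [add_zero] at hsplit
  refine hsplit.congr' ?_
  filter_upwards [eventually_integrable_rawKernel_mul hL hφ.measurable hφ.far] with i hi
  rw [← mul_add, integral_add_compl (measurableSet_nearCap (x i)) hi]

theorem tendsto_integral_of_odd (hL : IsDirectionalKernel L)
    (h_pos : ∀ i, 0 < h i) (h_zero : Tendsto h l (𝓝 0)) (hβ : ∀ i, IsFrameAt (x i) (β i))
    (hm : ∀ i, Measurable (φ i)) (hfar : PolyBounded l h φ)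
    (hodd : ∀ i u, φ i (gnomonic (x i) (β i) (-u)) = -φ i (gnomonic (x i) (β i) u)) :
    Tendsto (fun i => (h i ^ q)⁻¹ * ∫ y, rawKernel L (h i) (x i) y * φ i y ∂surf q) l (𝓝 0) := by
  refine (tendsto_setIntegral_compl_nearCap (x := x) hL h_pos h_zero hfar).congr' ?_
  filter_upwards [eventually_integrable_rawKernel_mul hL hm hfar] with i hi
  have hreflect := integral_neg_eq_self (chartIntegrand L (h i) (x i) (β i) (φ i)) volume
  simp_rw [(hβ i).chartIntegrand_neg (h_pos i) (hodd i), integral_neg] at hreflect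
  rw [← integral_add_compl (measurableSet_nearCap (x i)) hi, mul_add,
    (hβ i).inv_pow_mul_setIntegral_nearCap hL (h_pos i) (hm i), right_eq_add]
  linarith

end Asymptotics

section Constants

variable {q : ℕ} {L : ℝ → ℝ}

theorem continuous_kernel_norm (hL : IsDirectionalKernel L) :
    Continuous fun v : Tan q => L (‖v‖ ^ 2 / 2) :=
  hL.continuousOn.comp_continuous (by fun_prop) fun v => mem_Ici.2 (by positivity)

theorem exists_kernel_pos (hL : IsDirectionalKernel L) : ∃ r, 0 < r ∧ 0 < L r := by
  obtain ⟨r₁, hr₁, hLr₁⟩ := hL.nonzero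
  have hright : ∀ᶠ r in 𝓝[>] r₁, 0 < L r :=
    ((hL.continuousOn r₁ hr₁).eventually_const_lt
      ((hL.nonneg r₁ hr₁).lt_of_ne hLr₁.symm)).filter_mono
      (nhdsWithin_mono _ fun r hr => hr₁.trans (le_of_lt hr))
  obtain ⟨r, hLr, hr⟩ := (hright.and self_mem_nhdsWithin).exists
  exact ⟨r, lt_of_le_of_lt hr₁ hr, hLr⟩

theorem integrable_kernel_norm_mul (hL : IsDirectionalKernel L) {g : Tan q → ℝ}
    (hg : AEStronglyMeasurable g) {C : ℝ} {k : ℕ} (hC : ∀ v, |g v| ≤ C * (1 + ‖v‖) ^ k) :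
    Integrable fun v : Tan q => L (‖v‖ ^ 2 / 2) * g v := by
  obtain ⟨M, α, hM, hα, hLM⟩ := hL.decay
  refine ((integrable_one_add_norm_pow_mul_exp (q := q) (a := α / 2) (by positivity) k).const_mul
    (M * C)).mono' ((continuous_kernel_norm hL).aestronglyMeasurable.mul hg)
    (Eventually.of_forall fun v => ?_)
  have harg : 0 ≤ ‖v‖ ^ 2 / 2 := by positivity
  rw [norm_mul, Real.norm_of_nonneg (hL.nonneg _ harg)]
  calc L (‖v‖ ^ 2 / 2) * ‖g v‖ ≤ M * Real.exp (-α * (‖v‖ ^ 2 / 2)) * (C * (1 + ‖v‖) ^ k) :=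
        mul_le_mul (hLM _ harg) (hC v) (norm_nonneg _) (by positivity)
    _ = M * C * ((1 + ‖v‖) ^ k * Real.exp (-(α / 2) * ‖v‖ ^ 2)) := by
      rw [show -α * (‖v‖ ^ 2 / 2) = -(α / 2) * ‖v‖ ^ 2 by ring]
      ring

theorem integral_Ioi_rpow_mul_comp_sq_div_two (L : ℝ → ℝ) (a : ℝ) :
    ∫ y in Ioi (0 : ℝ), y ^ (2 * a + 1) * L (y ^ 2 / 2) =
      2 ^ a * ∫ r in Ioi (0 : ℝ), L r * r ^ a := by
  have hsquare : ∫ y in Ioi (0 : ℝ), (|(2 : ℝ)| * y ^ ((2 : ℝ) - 1)) • ((y ^ (2 : ℝ)) ^ a *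
      L (y ^ (2 : ℝ) / 2)) = 2 * ∫ y in Ioi (0 : ℝ), y ^ (2 * a + 1) * L (y ^ 2 / 2) := by
    rw [← integral_const_mul]
    refine setIntegral_congr_fun measurableSet_Ioi fun y (hy : 0 < y) => ?_
    simp only [smul_eq_mul, abs_two]
    rw [← Real.rpow_mul hy.le, Real.rpow_add hy, Real.rpow_two,
      show (2 : ℝ) - 1 = 1 by norm_num]
    ring
  have hdouble : ∫ r in Ioi (0 : ℝ), (2 * r) ^ a * L (2 * r / 2) =
      2 ^ a * ∫ r in Ioi (0 : ℝ), L r * r ^ a := by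
    rw [← integral_const_mul]
    refine setIntegral_congr_fun measurableSet_Ioi fun r (hr : 0 < r) => ?_
    rw [Real.mul_rpow zero_le_two hr.le, mul_div_cancel_left₀ _ two_ne_zero]
    ring
  have hchange := integral_comp_mul_left_Ioi (fun s => s ^ a * L (s / 2)) 0 (b := 2) two_pos
  rw [mul_zero, ← integral_comp_rpow_Ioi (fun s => s ^ a * L (s / 2)) (p := 2) two_ne_zero,
    smul_eq_mul, hsquare, hdouble] at hchange
  linarith

theorem sphereArea_eq (hq : 1 ≤ q) :
    sphereArea (q - 1) = q * (volume : Measure (Tan q)).real (Metric.ball 0 1) := by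
  have : Nonempty (Fin q) := ⟨⟨0, hq⟩⟩
  have : (0 : ℝ) < q := by exact_mod_cast hq
  have hGamma : Real.Gamma ((q : ℝ) / 2 + 1) = q / 2 * Real.Gamma ((q : ℝ) / 2) :=
    Real.Gamma_add_one (by positivity)
  have : 0 < Real.Gamma ((q : ℝ) / 2) := Real.Gamma_pos_of_pos (by positivity)
  have hcast : ((q - 1 : ℕ) : ℝ) + 1 = q := by
    rw [Nat.cast_sub hq]
    simp
  have hpi : √Real.pi ^ q = Real.pi ^ ((q : ℝ) / 2) := by
    rw [Real.sqrt_eq_rpow, ← Real.rpow_mul_natCast Real.pi_pos.le]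
    congr 1
    ring
  rw [measureReal_def, EuclideanSpace.volume_ball, Fintype.card_fin, hGamma, hpi, sphereArea,
    hcast, ENNReal.ofReal_one, one_pow, one_mul, ENNReal.toReal_ofReal (by positivity)]
  field_simp

theorem sphereArea_pos (d : ℕ) : 0 < sphereArea d := by
  have := Real.Gamma_pos_of_pos (s := ((d : ℝ) + 1) / 2) (by positivity)
  rw [sphereArea]
  positivity

theorem integral_kernel_mul_norm_pow (hq : 1 ≤ q) (L : ℝ → ℝ) (k : ℕ) :
    ∫ v : Tan q, L (‖v‖ ^ 2 / 2) * ‖v‖ ^ (2 * k) =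
      2 ^ ((q : ℝ) / 2 - 1 + k) * sphereArea (q - 1) *
        ∫ r in Ioi (0 : ℝ), L r * r ^ ((q : ℝ) / 2 - 1 + k) := by
  have : Nonempty (Fin q) := ⟨⟨0, hq⟩⟩
  have hexp : 2 * ((q : ℝ) / 2 - 1 + k) + 1 = ((q - 1 + 2 * k : ℕ) : ℝ) := by
    push_cast [Nat.cast_sub hq]
    ring
  have hradial : ∫ y in Ioi (0 : ℝ), y ^ (q - 1) • (L (y ^ 2 / 2) * y ^ (2 * k)) =
      ∫ y in Ioi (0 : ℝ), y ^ (2 * ((q : ℝ) / 2 - 1 + k) + 1) * L (y ^ 2 / 2) := by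
    refine setIntegral_congr_fun measurableSet_Ioi fun y _ => ?_
    simp only [smul_eq_mul]
    rw [hexp, Real.rpow_natCast, pow_add]
    ring
  rw [integral_fun_norm_addHaar volume (fun y => L (y ^ 2 / 2) * y ^ (2 * k)),
    finrank_euclideanSpace_fin, sphereArea_eq hq, nsmul_eq_mul, smul_eq_mul, hradial,
    integral_Ioi_rpow_mul_comp_sq_div_two]
  ring

theorem integral_kernel_norm (hq : 1 ≤ q) (L : ℝ → ℝ) :
    ∫ v : Tan q, L (‖v‖ ^ 2 / 2) = lambdaLim q L := by
  simpa [lambdaLim] using integral_kernel_mul_norm_pow hq L 0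

theorem lambdaLim_pos (hq : 1 ≤ q) (hL : IsDirectionalKernel L) : 0 < lambdaLim q L := by
  have hint : Integrable fun v : Tan q => L (‖v‖ ^ 2 / 2) := by
    simpa using integrable_kernel_norm_mul (q := q) hL (g := fun _ => 1) (C := 1) (k := 0)
      aestronglyMeasurable_const (by simp)
  rw [← integral_kernel_norm hq,
    integral_pos_iff_support_of_nonneg (fun v => hL.nonneg _ (by positivity)) hint]
  refine (continuous_kernel_norm hL).isOpen_support.measure_pos _ ?_
  obtain ⟨r, hr, hLr⟩ := hL.nonzero
  refine ⟨EuclideanSpace.single ⟨0, hq⟩ (√(2 * r)), ?_⟩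
  rwa [Function.mem_support, PiLp.norm_single, Real.norm_of_nonneg (Real.sqrt_nonneg _),
    Real.sq_sqrt (by positivity), mul_div_cancel_left₀ _ two_ne_zero]

theorem integral_kernel_norm_sq (hq : 1 ≤ q) (hL : IsDirectionalKernel L) :
    ∫ v : Tan q, L (‖v‖ ^ 2 / 2) * ‖v‖ ^ 2 = 2 * bConst q L * lambdaLim q L := by
  have hmoment := integral_kernel_mul_norm_pow hq L 1
  have hpos := lambdaLim_pos hq hL
  have hne : ∫ r in Ioi (0 : ℝ), L r * r ^ ((q : ℝ) / 2 - 1) ≠ 0 := by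
    intro hzero
    rw [lambdaLim, hzero, mul_zero] at hpos
    exact lt_irrefl _ hpos
  rw [Nat.cast_one, sub_add_cancel, mul_one] at hmoment
  rw [hmoment, bConst, lambdaLim, Real.rpow_sub_one two_ne_zero]
  generalize ∫ r in Ioi (0 : ℝ), L r * r ^ ((q : ℝ) / 2 - 1) = I at hne
  field_simp

theorem integral_kernel_norm_comp (L : ℝ → ℝ) (e : Tan q ≃ₗᵢ[ℝ] Tan q) (g : Tan q → ℝ) :
    ∫ v : Tan q, L (‖v‖ ^ 2 / 2) * g (e v) = ∫ v : Tan q, L (‖v‖ ^ 2 / 2) * g v := by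
  simpa using e.measurePreserving.integral_comp e.toHomeomorph.measurableEmbedding
    (fun w => L (‖w‖ ^ 2 / 2) * g w)

theorem integrable_kernel_coord_mul (hL : IsDirectionalKernel L) (i j : Fin q) :
    Integrable fun v : Tan q => L (‖v‖ ^ 2 / 2) * (v i * v j) := by
  refine integrable_kernel_norm_mul hL (by fun_prop) (C := 1) (k := 2) fun v => ?_
  have hcoord : ∀ i, |v i| ≤ 1 + ‖v‖ := fun i => (PiLp.norm_apply_le v i).trans (by simp)
  rw [abs_mul, one_mul, sq]
  exact mul_le_mul (hcoord i) (hcoord j) (abs_nonneg _) (by positivity)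

theorem integral_kernel_coord_mul_of_ne (L : ℝ → ℝ) {i j : Fin q} (hij : i ≠ j) :
    ∫ v : Tan q, L (‖v‖ ^ 2 / 2) * (v i * v j) = 0 := by
  have hreflect := integral_kernel_norm_comp L
    (LinearIsometryEquiv.piLpCongrRight 2 fun k : Fin q =>
      if k = i then LinearIsometryEquiv.neg ℝ else LinearIsometryEquiv.refl ℝ ℝ)
    (fun v => v i * v j)
  simp only [LinearIsometryEquiv.piLpCongrRight_apply, if_true, if_neg hij.symm,
    LinearIsometryEquiv.coe_neg, LinearIsometryEquiv.coe_refl, id, neg_mul, mul_neg,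
    integral_neg] at hreflect
  linarith

theorem integral_kernel_coord_sq (hL : IsDirectionalKernel L) (i : Fin q) :
    ∫ v : Tan q, L (‖v‖ ^ 2 / 2) * (v i * v i) =
      (∫ v : Tan q, L (‖v‖ ^ 2 / 2) * ‖v‖ ^ 2) / q := by
  have hswap : ∀ k : Fin q, ∫ v : Tan q, L (‖v‖ ^ 2 / 2) * (v k * v k) =
      ∫ v : Tan q, L (‖v‖ ^ 2 / 2) * (v i * v i) := by
    intro k
    rw [← integral_kernel_norm_comp L (LinearIsometryEquiv.piLpCongrLeft 2 ℝ ℝ (Equiv.swap i k))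
      (fun v => v i * v i)]
    simp
  have hnorm : ∀ v : Tan q, L (‖v‖ ^ 2 / 2) * ‖v‖ ^ 2 = ∑ k, L (‖v‖ ^ 2 / 2) * (v k * v k) := by
    intro v
    rw [← Finset.mul_sum, EuclideanSpace.real_norm_sq_eq]
    simp_rw [sq]
  have hq : (q : ℝ) ≠ 0 := by exact_mod_cast i.pos.ne'
  simp_rw [hnorm]
  rw [integral_finsetSum _ fun k _ => integrable_kernel_coord_mul hL k k,
    Finset.sum_congr rfl fun k _ => hswap k]
  simp [hq]

theorem integral_kernel_bilin (hq : 1 ≤ q) (hL : IsDirectionalKernel L)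
    (A : Fin q → Fin q → ℝ) :
    ∫ v : Tan q, L (‖v‖ ^ 2 / 2) * ∑ i, ∑ j, A i j * (v i * v j) =
      2 * bConst q L * lambdaLim q L / q * ∑ i, A i i := by
  have hint : ∀ i j : Fin q,
      Integrable fun v : Tan q => A i j * (L (‖v‖ ^ 2 / 2) * (v i * v j)) :=
    fun i j => (integrable_kernel_coord_mul hL i j).const_mul _
  have hmoment : ∀ i j : Fin q, ∫ v : Tan q, L (‖v‖ ^ 2 / 2) * (v i * v j) =
      if i = j then 2 * bConst q L * lambdaLim q L / q else 0 := by
    intro i j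
    split_ifs with hij
    · rw [← hij, integral_kernel_coord_sq hL, integral_kernel_norm_sq hq hL]
    · exact integral_kernel_coord_mul_of_ne L hij
  simp_rw [Finset.mul_sum, mul_left_comm _ (A _ _)]
  rw [integral_finsetSum _ fun i _ => integrable_finsetSum _ fun j _ => hint i j]
  simp_rw [fun i => integral_finsetSum (μ := (volume : Measure (Tan q))) Finset.univ
    fun j _ => hint i j, integral_const_mul, hmoment]
  simp [mul_comm]

theorem intervalIntegrable_rpow_mul_rpow {s h : ℝ} (hs : -1 < s) (hh : 0 < h) :
    IntervalIntegrable (fun r : ℝ => r ^ s * (2 - r * h ^ 2) ^ s) volume 0 (2 / h ^ 2) := by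
  have hh2 : 0 < h ^ 2 := by positivity
  refine IntervalIntegrable.trans (b := 1 / h ^ 2) ?_ ?_
  · refine (intervalIntegral.intervalIntegrable_rpow' hs).mul_continuousOn ?_
    refine ContinuousOn.rpow_const (by fun_prop) fun r hr => Or.inl ?_
    rw [uIcc_of_le (by positivity), mem_Icc, le_div_iff₀ hh2] at hr
    linarith [hr.2]
  · refine IntervalIntegrable.continuousOn_mul ?_ ?_
    · have hrpow : IntervalIntegrable (fun r : ℝ => r ^ s) volume 1 0 :=
        intervalIntegral.intervalIntegrable_rpow' hs
      convert (hrpow.comp_sub_left 2).comp_mul_left (c := h ^ 2) using 2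
      · ring_nf
      · norm_num
      · norm_num
    · refine ContinuousOn.rpow_const (by fun_prop) fun r hr => Or.inl ?_
      rw [uIcc_of_le (by gcongr; norm_num), mem_Icc] at hr
      exact ((by positivity : 0 < 1 / h ^ 2).trans_le hr.1).ne'

theorem integrableOn_lambdaH (hL : IsDirectionalKernel L) {s h : ℝ} (hs : -1 < s) (hh : 0 < h) :
    IntegrableOn (fun r : ℝ => L r * (r ^ s * (2 - r * h ^ 2) ^ s)) (Ioo 0 (2 / h ^ 2)) := by
  obtain ⟨M, α, hM, hα, hLM⟩ := hL.decay
  refine ((intervalIntegrable_iff_integrableOn_Ioo_of_le (by positivity)).1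
    (intervalIntegrable_rpow_mul_rpow hs hh)).bdd_mul (c := M) ?_ ?_
  · exact (hL.continuousOn.mono fun r hr => le_of_lt hr.1).aestronglyMeasurable measurableSet_Ioo
  · filter_upwards [ae_restrict_mem measurableSet_Ioo] with r hr
    rw [Real.norm_of_nonneg (hL.nonneg r hr.1.le)]
    refine (hLM r hr.1.le).trans (mul_le_of_le_one_right hM.le ?_)
    rw [Real.exp_le_one_iff]
    nlinarith [hr.1]

theorem lambdaH_pos (hq : 1 ≤ q) (hL : IsDirectionalKernel L) {r₀ h : ℝ} (hr₀ : 0 < r₀)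
    (hLr₀ : 0 < L r₀) (hh : 0 < h) (hlt : r₀ < 2 / h ^ 2) : 0 < lambdaH q h L := by
  have hs : -1 < (q : ℝ) / 2 - 1 := by
    have : (0 : ℝ) < q := by exact_mod_cast hq
    linarith
  have hfactor : ∀ r ∈ Ioo 0 (2 / h ^ 2),
      0 < r ^ ((q : ℝ) / 2 - 1) * (2 - r * h ^ 2) ^ ((q : ℝ) / 2 - 1) := by
    rintro r ⟨hr, hr'⟩
    rw [lt_div_iff₀ (by positivity)] at hr'
    exact mul_pos (Real.rpow_pos_of_pos hr _) (Real.rpow_pos_of_pos (by linarith) _)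
  refine mul_pos (sphereArea_pos _) ?_
  simp_rw [mul_assoc]
  rw [intervalIntegral.integral_of_le (by positivity), integral_Ioc_eq_integral_Ioo,
    setIntegral_pos_iff_support_of_nonneg_ae _ (integrableOn_lambdaH hL hs hh)]
  · have hopen : IsOpen (Ioo 0 (2 / h ^ 2) ∩ L ⁻¹' Ioi 0) :=
      (hL.continuousOn.mono fun r hr => le_of_lt hr.1).isOpen_inter_preimage isOpen_Ioo isOpen_Ioi
    refine (hopen.measure_pos volume ⟨r₀, ⟨hr₀, hlt⟩, hLr₀⟩).trans_le (measure_mono ?_)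
    exact fun r ⟨hr, hLr⟩ => ⟨(mul_pos hLr (hfactor r hr)).ne', hr⟩
  · filter_upwards [ae_restrict_mem measurableSet_Ioo] with r hr
    exact mul_nonneg (hL.nonneg r hr.1.le) (hfactor r hr).le

theorem eventually_lambdaH_pos (hq : 1 ≤ q) (hL : IsDirectionalKernel L) :
    ∀ᶠ h in 𝓝[>] 0, 0 < lambdaH q h L := by
  obtain ⟨r₀, hr₀, hLr₀⟩ := exists_kernel_pos hL
  have hsq : Tendsto (fun h : ℝ => r₀ * h ^ 2) (𝓝[>] 0) (𝓝 0) := by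
    have hcont : Continuous fun h : ℝ => r₀ * h ^ 2 := by fun_prop
    simpa using (hcont.tendsto 0).mono_left nhdsWithin_le_nhds
  filter_upwards [hsq.eventually_lt_const two_pos, self_mem_nhdsWithin] with h hlt hh
  exact lambdaH_pos hq hL hr₀ hLr₀ hh ((lt_div_iff₀ (pow_pos hh 2)).2 hlt)

end Constants

/-! ### Calculus of radial extensions -/

theorem exists_eq_add_deriv_add_half_second_deriv {φ φ' φ'' : ℝ → ℝ}
    (hφ : ∀ t ∈ Icc (0 : ℝ) 1, HasDerivAt φ (φ' t) t)
    (hφ' : ∀ t ∈ Icc (0 : ℝ) 1, HasDerivAt φ' (φ'' t) t) :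
    ∃ ξ ∈ Ioo (0 : ℝ) 1, φ 1 = φ 0 + φ' 0 + φ'' ξ / 2 := by
  set K := φ 1 - φ 0 - φ' 0 with hK
  have remainder : ∀ t ∈ Icc (0 : ℝ) 1, HasDerivAt (fun t => φ t - φ' 0 * t - K * t ^ 2)
      (φ' t - φ' 0 - K * (2 * t)) t := fun t ht => by
    have linear : HasDerivAt (fun t : ℝ => φ' 0 * t) (φ' 0) t := by
      simpa using (hasDerivAt_id t).const_mul (φ' 0)
    have quadratic : HasDerivAt (fun t : ℝ => K * t ^ 2) (K * (2 * t)) t := by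
      simpa using ((hasDerivAt_id t).pow 2).const_mul K
    exact ((hφ t ht).sub linear).sub quadratic
  have remainder' : ∀ t ∈ Icc (0 : ℝ) 1, HasDerivAt (fun t => φ' t - φ' 0 - K * (2 * t))
      (φ'' t - K * 2) t := fun t ht => by
    have linear : HasDerivAt (fun t : ℝ => K * (2 * t)) (K * 2) t := by
      simpa using ((hasDerivAt_id t).const_mul 2).const_mul K
    exact ((hφ' t ht).sub_const (φ' 0)).sub linear
  obtain ⟨c, hc, hc_zero⟩ := exists_hasDerivAt_eq_zero zero_lt_one
    (fun t ht => (remainder t ht).continuousAt.continuousWithinAt) (by simp [hK])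
    (fun t ht => remainder t (Ioo_subset_Icc_self ht))
  obtain ⟨ξ, hξ, hξ_zero⟩ := exists_hasDerivAt_eq_zero hc.1
    (fun t ht => (remainder' t ⟨ht.1, ht.2.trans hc.2.le⟩).continuousAt.continuousWithinAt)
    (by rw [hc_zero]; simp) (fun t ht => remainder' t ⟨ht.1.le, (ht.2.trans hc.2).le⟩)
  exact ⟨ξ, ⟨hξ.1, hξ.2.trans hc.2⟩, by linarith⟩

section Segment

variable {E F : Type*} [NormedAddCommGroup E] [NormedSpace ℝ E] [NormedAddCommGroup F]
  [NormedSpace ℝ F] {x w : E}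

theorem hasDerivAt_comp_add_smul {G : E → F} {t : ℝ} (hG : DifferentiableAt ℝ G (x + t • w)) :
    HasDerivAt (fun t : ℝ => G (x + t • w)) (fderiv ℝ G (x + t • w) w) t := by
  have segment : HasDerivAt (fun t : ℝ => x + t • w) w t := by
    simpa using ((hasDerivAt_id t).smul_const w).const_add x
  exact hG.hasFDerivAt.comp_hasDerivAt t segment

theorem exists_eq_add_fderiv {G : E → ℝ}
    (hG : ∀ t ∈ Icc (0 : ℝ) 1, DifferentiableAt ℝ G (x + t • w)) :
    ∃ ξ ∈ Ioo (0 : ℝ) 1, G (x + w) = G x + fderiv ℝ G (x + ξ • w) w := by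
  have along_segment : ∀ t ∈ Icc (0 : ℝ) 1, HasDerivAt (fun t : ℝ => G (x + t • w))
      (fderiv ℝ G (x + t • w) w) t := fun t ht => hasDerivAt_comp_add_smul (hG t ht)
  obtain ⟨ξ, hξ, slope⟩ := exists_hasDerivAt_eq_slope _ _ zero_lt_one
    (fun t ht => (along_segment t ht).continuousAt.continuousWithinAt)
    (fun t ht => along_segment t (Ioo_subset_Icc_self ht))
  refine ⟨ξ, hξ, ?_⟩
  rw [slope]
  simp

theorem exists_eq_add_fderiv_add_half_fderiv_fderiv {G : E → ℝ}
    (hG : ∀ t ∈ Icc (0 : ℝ) 1, ContDiffAt ℝ 2 G (x + t • w)) :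
    ∃ ξ ∈ Ioo (0 : ℝ) 1, G (x + w) = G x + fderiv ℝ G x w +
      fderiv ℝ (fderiv ℝ G) (x + ξ • w) w w / 2 := by
  have first : ∀ t ∈ Icc (0 : ℝ) 1, HasDerivAt (fun t : ℝ => G (x + t • w))
      (fderiv ℝ G (x + t • w) w) t := fun t ht =>
    hasDerivAt_comp_add_smul ((hG t ht).differentiableAt two_ne_zero)
  have second : ∀ t ∈ Icc (0 : ℝ) 1, HasDerivAt (fun t : ℝ => fderiv ℝ G (x + t • w) w)
      (fderiv ℝ (fderiv ℝ G) (x + t • w) w w) t := fun t ht => by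
    have differentiable : DifferentiableAt ℝ (fderiv ℝ G) (x + t • w) :=
      ((hG t ht).fderiv_right (m := 1) (by norm_num)).differentiableAt one_ne_zero
    have := (hasDerivAt_comp_add_smul differentiable).clm_apply (hasDerivAt_const t w)
    rwa [map_zero, add_zero] at this
  obtain ⟨ξ, hξ, expansion⟩ := exists_eq_add_deriv_add_half_second_deriv first second
  refine ⟨ξ, hξ, ?_⟩
  rwa [one_smul, zero_smul, add_zero] at expansion

end Segment

theorem sum_bilin_orthonormalBasis {E ι κ : Type*} [NormedAddCommGroup E] [InnerProductSpace ℝ E]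
    [Fintype ι] [Fintype κ] (A : E →L[ℝ] E →L[ℝ] ℝ) (a : OrthonormalBasis ι ℝ E)
    (b : OrthonormalBasis κ ℝ E) : ∑ i, A (a i) (a i) = ∑ j, A (b j) (b j) := by
  have : FiniteDimensional ℝ E := a.toBasis.finiteDimensional_of_finite
  let T : E →ₗ[ℝ] E :=
    { toFun := fun v => (InnerProductSpace.toDual ℝ E).symm (A v)
      map_add' := fun v w => by simp only [map_add]
      map_smul' := fun c v => by simp }
  have apply_eq_inner (v : E) : A v v = inner ℝ v (T v) := by
    rw [real_inner_comm]
    exact InnerProductSpace.toDual_symm_apply.symm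
  simp only [apply_eq_inner]
  rw [← T.trace_eq_sum_inner a, ← T.trace_eq_sum_inner b]

section Radial

variable {q : ℕ} {g : Sph q → ℝ}

theorem radialExt_coe (g : Sph q → ℝ) (x : Sph q) : radialExt g (x : Amb q) = g x := by
  rw [radialExt_eq g x (ne_zero_of_mem_unit_sphere x), toSph_coe]

theorem continuous_of_contDiffOn_radialExt {n : WithTop ℕ∞}
    (hg : ContDiffOn ℝ n (radialExt g) {0}ᶜ) : Continuous g :=
  (hg.continuousOn.comp_continuous continuous_subtype_val ne_zero_of_mem_unit_sphere).congr
    (radialExt_coe g)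

theorem contDiffAt_radialExt {n : WithTop ℕ∞} (hg : ContDiffOn ℝ n (radialExt g) {0}ᶜ)
    {z : Amb q} (hz : z ≠ 0) : ContDiffAt ℝ n (radialExt g) z :=
  hg.contDiffAt (isOpen_compl_singleton.mem_nhds hz)

theorem continuousAt_fderiv_radialExt (hg : ContDiffOn ℝ 1 (radialExt g) {0}ᶜ) {z : Amb q}
    (hz : z ≠ 0) : ContinuousAt (fderiv ℝ (radialExt g)) z :=
  ((contDiffAt_radialExt hg hz).fderiv_right (m := 0) (by norm_num)).continuousAt

theorem contDiffAt_fderiv_radialExt (hg : ContDiffOn ℝ 2 (radialExt g) {0}ᶜ) {z : Amb q}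
    (hz : z ≠ 0) : ContDiffAt ℝ 1 (fderiv ℝ (radialExt g)) z :=
  (contDiffAt_radialExt hg hz).fderiv_right (by norm_num)

theorem continuousAt_fderiv_fderiv_radialExt (hg : ContDiffOn ℝ 2 (radialExt g) {0}ᶜ) {z : Amb q}
    (hz : z ≠ 0) : ContinuousAt (fderiv ℝ (fderiv ℝ (radialExt g))) z :=
  ((contDiffAt_fderiv_radialExt hg hz).fderiv_right (m := 0) (by norm_num)).continuousAt

theorem fderiv_radialExt_self (hg : ContDiffOn ℝ 1 (radialExt g) {0}ᶜ) {z : Amb q}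
    (hz : z ≠ 0) : fderiv ℝ (radialExt g) z z = 0 := by
  have differentiable : HasFDerivAt (radialExt g) (fderiv ℝ (radialExt g) z) ((1 : ℝ) • z) := by
    rw [one_smul]
    exact ((contDiffAt_radialExt hg hz).differentiableAt (by norm_num)).hasFDerivAt
  have ray : HasDerivAt (fun t : ℝ => t • z) z 1 := by
    simpa using (hasDerivAt_id (1 : ℝ)).smul_const z
  have constant_on_ray :
      (radialExt g ∘ fun t : ℝ => t • z) =ᶠ[𝓝 1] fun _ => radialExt g z := by
    filter_upwards [lt_mem_nhds (zero_lt_one' ℝ)] with t ht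
    obtain ⟨y⟩ : Nonempty (Sph q) := ⟨⟨‖z‖⁻¹ • z, by simp [norm_smul, norm_ne_zero_iff.mpr hz]⟩⟩
    rw [Function.comp_apply, radialExt_eq g y (smul_ne_zero ht.ne' hz), radialExt_eq g y hz,
      toSph_smul y ht]
  exact (differentiable.comp_hasDerivAt (1 : ℝ) ray).unique
    ((hasDerivAt_const (1 : ℝ) (radialExt g z)).congr_of_eventuallyEq constant_on_ray)

theorem fderiv_fderiv_radialExt_self (hg : ContDiffOn ℝ 2 (radialExt g) {0}ᶜ) {z : Amb q}
    (hz : z ≠ 0) : fderiv ℝ (fderiv ℝ (radialExt g)) z z z = 0 := by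
  have hg_one : ContDiffOn ℝ 1 (radialExt g) {0}ᶜ := hg.of_le one_le_two
  have euler_deriv := (((contDiffAt_fderiv_radialExt hg hz).differentiableAt
    one_ne_zero).hasFDerivAt.clm_apply (hasFDerivAt_id z))
  have euler : (fun y => fderiv ℝ (radialExt g) y (id y)) =ᶠ[𝓝 z] fun _ => 0 := by
    filter_upwards [isOpen_compl_singleton.mem_nhds hz] with y hy
    exact fderiv_radialExt_self hg_one hy
  have deriv_eq_zero :=
    euler_deriv.unique ((hasFDerivAt_const (0 : ℝ) z).congr_of_eventuallyEq euler)
  simpa [fderiv_radialExt_self hg_one hz] using DFunLike.congr_fun deriv_eq_zero z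

theorem sphHessian_apply (hg : ContDiffOn ℝ 2 (radialExt g) {0}ᶜ) (x : Sph q)
    (i j : Fin (q + 1)) : sphHessian g x i j =
      fderiv ℝ (fderiv ℝ (radialExt g)) (x : Amb q) (EuclideanSpace.single i 1)
        (EuclideanSpace.single j 1) := by
  have differentiable : DifferentiableAt ℝ (fderiv ℝ (radialExt g)) (x : Amb q) :=
    (contDiffAt_fderiv_radialExt hg (ne_zero_of_mem_unit_sphere x)).differentiableAt one_ne_zero
  rw [sphHessian, Matrix.of_apply, (differentiable.hasFDerivAt.clm_apply (hasFDerivAt_const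
    (EuclideanSpace.single j (1 : ℝ) : Amb q) (x : Amb q))).fderiv]
  simp

theorem trace_sphHessian (hg : ContDiffOn ℝ 2 (radialExt g) {0}ᶜ) {x : Sph q}
    {β : Fin q → Amb q} (h : IsFrameAt x β) : (sphHessian g x).trace =
      ∑ j, fderiv ℝ (fderiv ℝ (radialExt g)) (x : Amb q) (β j) (β j) := by
  have invariance := sum_bilin_orthonormalBasis (fderiv ℝ (fderiv ℝ (radialExt g)) (x : Amb q))
    (EuclideanSpace.basisFun (Fin (q + 1)) ℝ) h.basis
  rw [Fin.sum_univ_succ (fun j => fderiv ℝ (fderiv ℝ (radialExt g)) (x : Amb q) (h.basis j)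
    (h.basis j))] at invariance
  simp only [h.coe_basis, Fin.cons_zero, Fin.cons_succ,
    fderiv_fderiv_radialExt_self hg (ne_zero_of_mem_unit_sphere x), zero_add] at invariance
  rw [← invariance, Matrix.trace]
  simp [sphHessian_apply hg]

theorem inner_sphGrad (g : Sph q → ℝ) (x : Sph q) (w : Amb q) :
    inner ℝ (sphGrad g x) w = fderiv ℝ (radialExt g) (x : Amb q) w := by
  rw [sphGrad, gradient, InnerProductSpace.toDual_symm_apply]

theorem inner_sphGrad_sphGrad {f m : Sph q → ℝ} (hf : ContDiffOn ℝ 1 (radialExt f) {0}ᶜ)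
    {x : Sph q} {β : Fin q → Amb q} (h : IsFrameAt x β) :
    inner ℝ (sphGrad f x) (sphGrad m x) =
      ∑ j, fderiv ℝ (radialExt f) (x : Amb q) (β j) * fderiv ℝ (radialExt m) (x : Amb q) (β j) := by
  rw [← h.basis.sum_inner_mul_inner, Fin.sum_univ_succ, h.coe_basis]
  simp only [Fin.cons_zero, Fin.cons_succ, real_inner_comm (sphGrad m x), inner_sphGrad,
    fderiv_radialExt_self hf (ne_zero_of_mem_unit_sphere x), zero_mul, zero_add]

theorem exists_bound_annulus {E : Type*} [NormedAddCommGroup E] {Φ : Amb q → E}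
    (hΦ : ∀ z, z ≠ 0 → ContinuousAt Φ z) :
    ∃ C : ℝ, 0 ≤ C ∧ ∀ z : Amb q, ‖z‖ ∈ Icc (1 : ℝ) 2 → ‖Φ z‖ ≤ C := by
  have annulus_compact : IsCompact (Metric.closedBall (0 : Amb q) 2 ∩ {z | 1 ≤ ‖z‖}) :=
    (isCompact_closedBall _ _).inter_right (isClosed_le continuous_const continuous_norm)
  have norm_continuousOn : ContinuousOn (fun z => ‖Φ z‖)
      (Metric.closedBall (0 : Amb q) 2 ∩ {z | 1 ≤ ‖z‖}) := fun z hz =>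
    (hΦ z (norm_pos_iff.1 (zero_lt_one.trans_le hz.2))).norm.continuousWithinAt
  obtain ⟨C, hC⟩ := annulus_compact.bddAbove_image norm_continuousOn
  exact ⟨max C 0, le_max_right _ _, fun z hz =>
    (hC (mem_image_of_mem _ ⟨by simpa using hz.2, hz.1⟩)).trans (le_max_left _ _)⟩

theorem exists_bound_of_continuous (hg : Continuous g) : ∃ C : ℝ, 0 ≤ C ∧ ∀ y, |g y| ≤ C := by
  obtain ⟨C, hC⟩ := (isCompact_range hg.norm).bddAbove
  exact ⟨max C 0, le_max_right _ _, fun y => (hC (mem_range_self y)).trans (le_max_left _ _)⟩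

/-- The remainder of the first order expansion of `g` at `x`. The increment `y - x` is a chord of
the sphere; its radial component does not matter since the radial extension is constant along
rays. -/
def remainder (g : Sph q → ℝ) (x y : Sph q) : ℝ :=
  g y - g x - fderiv ℝ (radialExt g) (x : Amb q) ((y : Amb q) - x)

namespace IsFrameAt

variable {x : Sph q} {β : Fin q → Amb q}

theorem norm_add_smul_mem_Icc (h : IsFrameAt x β) {u : Tan q} (hu : ‖u‖ ≤ 1) {ξ : ℝ}
    (hξ : ξ ∈ Ioo (0 : ℝ) 1) : ‖(x : Amb q) + frameMap β (ξ • u)‖ ∈ Icc (1 : ℝ) 2 := by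
  have pythagoras := h.norm_add_sq (ξ • u)
  have displacement_le : ‖ξ • u‖ ≤ 1 := by
    rw [norm_smul, Real.norm_of_nonneg hξ.1.le]
    exact mul_le_one₀ hξ.2.le (norm_nonneg _) hu
  have := norm_nonneg (ξ • u)
  have := norm_nonneg ((x : Amb q) + frameMap β (ξ • u))
  constructor <;> nlinarith

theorem exists_increment_gnomonic (h : IsFrameAt x β) (hg : ContDiffOn ℝ 1 (radialExt g) {0}ᶜ)
    (u : Tan q) : ∃ ξ ∈ Ioo (0 : ℝ) 1, g (gnomonic x β u) - g x =
      fderiv ℝ (radialExt g) ((x : Amb q) + frameMap β (ξ • u)) (frameMap β u) := by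
  obtain ⟨ξ, hξ, expansion⟩ := exists_eq_add_fderiv (G := radialExt g) (x := (x : Amb q))
    (w := frameMap β u) fun t _ => by
      rw [← map_smul]
      exact (contDiffAt_radialExt hg (h.add_ne_zero _)).differentiableAt one_ne_zero
  rw [h.radialExt_add, radialExt_coe, ← map_smul] at expansion
  exact ⟨ξ, hξ, sub_eq_of_eq_add' expansion⟩

theorem exists_remainder_gnomonic (h : IsFrameAt x β) (hg : ContDiffOn ℝ 2 (radialExt g) {0}ᶜ)
    (u : Tan q) : ∃ ξ ∈ Ioo (0 : ℝ) 1, remainder g x (gnomonic x β u) =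
      fderiv ℝ (fderiv ℝ (radialExt g)) ((x : Amb q) + frameMap β (ξ • u)) (frameMap β u)
        (frameMap β u) / 2 +
      ‖u‖ ^ 2 / (√(1 + ‖u‖ ^ 2) * (√(1 + ‖u‖ ^ 2) + 1)) *
        fderiv ℝ (radialExt g) (x : Amb q) (frameMap β u) := by
  obtain ⟨ξ, hξ, expansion⟩ := exists_eq_add_fderiv_add_half_fderiv_fderiv (G := radialExt g)
    (x := (x : Amb q)) (w := frameMap β u) fun t _ => by
      rw [← map_smul]
      exact contDiffAt_radialExt hg (h.add_ne_zero _)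
  rw [h.radialExt_add, radialExt_coe, ← map_smul] at expansion
  refine ⟨ξ, hξ, ?_⟩
  rw [remainder, expansion, h.coe_gnomonic]
  simp only [map_sub, map_smul, map_add, smul_eq_mul,
    fderiv_radialExt_self (hg.of_le one_le_two) (ne_zero_of_mem_unit_sphere x)]
  have sqrt_pos : 0 < √(1 + ‖u‖ ^ 2) := by positivity
  have norm_sq : ‖u‖ ^ 2 = √(1 + ‖u‖ ^ 2) ^ 2 - 1 := by
    rw [Real.sq_sqrt (by positivity)]
    ring
  generalize √(1 + ‖u‖ ^ 2) = s at *
  rw [norm_sq]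
  field_simp
  ring

theorem abs_increment_gnomonic_le (h : IsFrameAt x β) (hg : ContDiffOn ℝ 1 (radialExt g) {0}ᶜ)
    {C : ℝ} (hC : ∀ z : Amb q, ‖z‖ ∈ Icc (1 : ℝ) 2 → ‖fderiv ℝ (radialExt g) z‖ ≤ C) {u : Tan q}
    (hu : ‖u‖ ≤ 1) : |g (gnomonic x β u) - g x| ≤ C * ‖u‖ := by
  obtain ⟨ξ, hξ, increment⟩ := h.exists_increment_gnomonic hg u
  rw [increment, ← Real.norm_eq_abs, ← h.norm_frameMap u]
  exact ContinuousLinearMap.le_of_opNorm_le _ (hC _ (h.norm_add_smul_mem_Icc hu hξ)) _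

theorem abs_remainder_gnomonic_le (h : IsFrameAt x β) (hg : ContDiffOn ℝ 2 (radialExt g) {0}ᶜ)
    {C₁ C₂ : ℝ} (hC₁ : ∀ z : Amb q, ‖z‖ ∈ Icc (1 : ℝ) 2 → ‖fderiv ℝ (radialExt g) z‖ ≤ C₁)
    (hC₂ : ∀ z : Amb q, ‖z‖ ∈ Icc (1 : ℝ) 2 → ‖fderiv ℝ (fderiv ℝ (radialExt g)) z‖ ≤ C₂)
    {u : Tan q} (hu : ‖u‖ ≤ 1) :
    |remainder g x (gnomonic x β u)| ≤ (C₁ + C₂) * ‖u‖ ^ 2 := by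
  obtain ⟨ξ, hξ, expansion⟩ := h.exists_remainder_gnomonic hg u
  have gradient_le : |fderiv ℝ (radialExt g) (x : Amb q) (frameMap β u)| ≤ C₁ * ‖u‖ := by
    rw [← Real.norm_eq_abs, ← h.norm_frameMap u]
    exact ContinuousLinearMap.le_of_opNorm_le _ (hC₁ _ (by simp [norm_eq_of_mem_sphere])) _
  have hessian_le : |fderiv ℝ (fderiv ℝ (radialExt g)) ((x : Amb q) + frameMap β (ξ • u))
      (frameMap β u) (frameMap β u)| ≤ C₂ * ‖u‖ ^ 2 := by
    rw [← Real.norm_eq_abs, sq, ← mul_assoc, ← h.norm_frameMap u]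
    exact ContinuousLinearMap.le_of_opNorm₂_le_of_le _ (hC₂ _ (h.norm_add_smul_mem_Icc hu hξ))
      le_rfl le_rfl
  have sqrt_ge : 1 ≤ √(1 + ‖u‖ ^ 2) := Real.one_le_sqrt.2 (le_add_of_nonneg_right (sq_nonneg _))
  have ratio_le : ‖u‖ ^ 2 / (√(1 + ‖u‖ ^ 2) * (√(1 + ‖u‖ ^ 2) + 1)) ≤ ‖u‖ ^ 2 :=
    div_le_self (sq_nonneg _) (by nlinarith)
  have C₁_nonneg : 0 ≤ C₁ := (norm_nonneg _).trans (hC₁ x (by simp [norm_eq_of_mem_sphere]))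
  rw [expansion]
  calc _ ≤ C₂ * ‖u‖ ^ 2 / 2 + ‖u‖ ^ 2 * (C₁ * ‖u‖) := by
        refine (abs_add_le _ _).trans ?_
        rw [abs_div, abs_two, abs_mul, abs_of_nonneg (a := _ / _) (by positivity)]
        gcongr
    _ ≤ C₂ * ‖u‖ ^ 2 + ‖u‖ ^ 2 * (C₁ * 1) := by
        gcongr
        exact half_le_self ((abs_nonneg _).trans hessian_le)
    _ = (C₁ + C₂) * ‖u‖ ^ 2 := by ring

end IsFrameAt

end Radial

/-! ### Local limits of the functions entering the estimator -/

theorem tendsto_clm_apply {ι E F : Type*} [NormedAddCommGroup E] [NormedSpace ℝ E]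
    [NormedAddCommGroup F] [NormedSpace ℝ F] {l : Filter ι} {A : ι → E →L[ℝ] F} {A₀ : E →L[ℝ] F}
    {w : ι → E} {w₀ : E} (hA : Tendsto A l (𝓝 A₀)) (hw : Tendsto w l (𝓝 w₀)) :
    Tendsto (fun i => A i (w i)) l (𝓝 (A₀ w₀)) :=
  (isBoundedBilinearMap_apply.continuous.tendsto (A₀, w₀)).comp (hA.prodMk_nhds hw)

/-- Bandwidths tending to zero, and points of the sphere with frames converging to `x₀`, `β₀`. By
compactness of the space of frames, uniformity over the sphere reduces to this situation. -/
structure Localized {q : ℕ} {ι : Type*} (l : Filter ι) (h : ι → ℝ) (x : ι → Sph q)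
    (β : ι → Fin q → Amb q) (x₀ : Sph q) (β₀ : Fin q → Amb q) : Prop where
  h_pos : ∀ i, 0 < h i
  h_zero : Tendsto h l (𝓝 0)
  frame : ∀ i, IsFrameAt (x i) (β i)
  frame₀ : IsFrameAt x₀ β₀
  tendsto_x : Tendsto x l (𝓝 x₀)
  tendsto_β : ∀ j, Tendsto (fun i => β i j) l (𝓝 (β₀ j))

namespace Localized

variable {q : ℕ} {ι : Type*} {l : Filter ι} {h : ι → ℝ} {x : ι → Sph q}
  {β : ι → Fin q → Amb q} {x₀ : Sph q} {β₀ : Fin q → Amb q} {g : Sph q → ℝ}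

theorem tendsto_coe (H : Localized l h x β x₀ β₀) :
    Tendsto (fun i => (x i : Amb q)) l (𝓝 (x₀ : Amb q)) :=
  (continuous_subtype_val.tendsto x₀).comp H.tendsto_x

theorem tendsto_frameMap (H : Localized l h x β x₀ β₀) (v : Tan q) :
    Tendsto (fun i => frameMap (β i) v) l (𝓝 (frameMap β₀ v)) := by
  simp_rw [frameMap_apply]
  exact tendsto_finsetSum _ fun j _ => (H.tendsto_β j).const_smul (v j)

theorem tendsto_add_frameMap_smul (H : Localized l h x β x₀ β₀) (v : Tan q) {ξ : ι → ℝ}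
    (hξ : ∀ i, ξ i ∈ Ioo (0 : ℝ) 1) :
    Tendsto (fun i => (x i : Amb q) + frameMap (β i) (ξ i • h i • v)) l (𝓝 (x₀ : Amb q)) := by
  have displacement : Tendsto (fun i => frameMap (β i) (ξ i • h i • v)) l (𝓝 0) := by
    refine squeeze_zero_norm (fun i => ?_) (tendsto_norm_smul H.h_zero v)
    rw [(H.frame i).norm_frameMap, norm_smul, Real.norm_of_nonneg (hξ i).1.le]
    exact mul_le_of_le_one_left (norm_nonneg _) (hξ i).2.le
  simpa using H.tendsto_coe.add displacement

theorem tendsto_gnomonic (H : Localized l h x β x₀ β₀) (v : Tan q) :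
    Tendsto (fun i => gnomonic (x i) (β i) (h i • v)) l (𝓝 x₀) := by
  rw [tendsto_subtype_rng]
  simp_rw [fun i => (H.frame i).coe_gnomonic (h i • v), map_smul]
  simpa using ((tendsto_sqrt_one_add_norm_smul_sq H.h_zero v).inv₀ one_ne_zero).smul
    (H.tendsto_coe.add (H.h_zero.smul (H.tendsto_frameMap v)))

theorem tendsto_fderiv (H : Localized l h x β x₀ β₀) (hg : ContDiffOn ℝ 1 (radialExt g) {0}ᶜ)
    {z : ι → Amb q} (hz : Tendsto z l (𝓝 (x₀ : Amb q))) (v : Tan q) :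
    Tendsto (fun i => fderiv ℝ (radialExt g) (z i) (frameMap (β i) v)) l
      (𝓝 (fderiv ℝ (radialExt g) (x₀ : Amb q) (frameMap β₀ v))) :=
  tendsto_clm_apply ((continuousAt_fderiv_radialExt hg
    (ne_zero_of_mem_unit_sphere x₀)).tendsto.comp hz) (H.tendsto_frameMap v)

theorem tendsto_fderiv_fderiv (H : Localized l h x β x₀ β₀)
    (hg : ContDiffOn ℝ 2 (radialExt g) {0}ᶜ) {z : ι → Amb q}
    (hz : Tendsto z l (𝓝 (x₀ : Amb q))) (v : Tan q) :
    Tendsto (fun i => fderiv ℝ (fderiv ℝ (radialExt g)) (z i) (frameMap (β i) v)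
      (frameMap (β i) v)) l
      (𝓝 (fderiv ℝ (fderiv ℝ (radialExt g)) (x₀ : Amb q) (frameMap β₀ v) (frameMap β₀ v))) :=
  tendsto_clm_apply (tendsto_clm_apply ((continuousAt_fderiv_fderiv_radialExt hg
    (ne_zero_of_mem_unit_sphere x₀)).tendsto.comp hz) (H.tendsto_frameMap v))
    (H.tendsto_frameMap v)

theorem localLimit_continuous (H : Localized l h x β x₀ β₀) (hg : Continuous g) :
    LocalLimit l h x β (fun _ => g) (fun _ => g x₀) := by
  obtain ⟨C, hC_nonneg, hC⟩ := exists_bound_of_continuous hg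
  exact
    { measurable := fun _ => hg.measurable
      far := ⟨C, 0, hC_nonneg, Eventually.of_forall fun i y => by simpa using hC y⟩
      near := ⟨C, 0, hC_nonneg, Eventually.of_forall fun i v _ => by simpa using hC _⟩
      tendsto := fun v => (hg.tendsto x₀).comp (H.tendsto_gnomonic v) }

theorem inner_gnomonic_sub_frame_div (H : Localized l h x β x₀ β₀) (i : ι) (v : Tan q)
    (j : Fin q) : inner ℝ ((gnomonic (x i) (β i) (h i • v) : Amb q) - x i) (β i j) / h i =
      (√(1 + ‖h i • v‖ ^ 2))⁻¹ * v j := by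
  rw [(H.frame i).inner_gnomonic_sub_frame, PiLp.smul_apply, smul_eq_mul, mul_div_assoc,
    mul_div_cancel_left₀ _ (H.h_pos i).ne']

theorem localLimit_coord (H : Localized l h x β x₀ β₀) (j : Fin q) :
    LocalLimit l h x β (fun i y => inner ℝ ((y : Amb q) - x i) (β i j) / h i)
      (fun v => v j) where
  measurable i := by fun_prop
  far := by
    refine ⟨2, 1, zero_le_two, Eventually.of_forall fun i y => ?_⟩
    have frame_norm : ‖β i j‖ = 1 := by simpa using (H.frame i).1 j.succ
    rw [abs_div, abs_of_pos (H.h_pos i), pow_one, div_eq_mul_inv]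
    have := inv_pos.2 (H.h_pos i)
    gcongr
    calc |inner ℝ ((y : Amb q) - x i) (β i j)| ≤ ‖(y : Amb q) - x i‖ * ‖β i j‖ :=
          abs_real_inner_le_norm _ _
      _ ≤ (‖(y : Amb q)‖ + ‖(x i : Amb q)‖) * ‖β i j‖ := by gcongr; exact norm_sub_le _ _
      _ = 2 := by rw [frame_norm, norm_eq_of_mem_sphere, norm_eq_of_mem_sphere]; norm_num
  near := by
    refine ⟨1, 1, zero_le_one, Eventually.of_forall fun i v _ => ?_⟩
    have shrinking : (√(1 + ‖h i • v‖ ^ 2))⁻¹ ≤ 1 :=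
      inv_le_one_of_one_le₀ (Real.one_le_sqrt.2 (le_add_of_nonneg_right (sq_nonneg _)))
    rw [H.inner_gnomonic_sub_frame_div, abs_mul, abs_of_pos (by positivity), pow_one]
    gcongr
    exact (PiLp.norm_apply_le v j).trans (by simp)
  tendsto v := by
    simp_rw [H.inner_gnomonic_sub_frame_div]
    simpa using ((tendsto_sqrt_one_add_norm_smul_sq H.h_zero v).inv₀ one_ne_zero).mul_const (v j)

theorem localLimit_slope (H : Localized l h x β x₀ β₀) (hg : ContDiffOn ℝ 1 (radialExt g) {0}ᶜ) :
    LocalLimit l h x β (fun i y => (g y - g (x i)) / h i)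
      (fun v => fderiv ℝ (radialExt g) (x₀ : Amb q) (frameMap β₀ v)) where
  measurable _ := ((continuous_of_contDiffOn_radialExt hg).measurable.sub_const _).div_const _
  far := by
    obtain ⟨C, hC_nonneg, hC⟩ := exists_bound_of_continuous (continuous_of_contDiffOn_radialExt hg)
    refine ⟨2 * C, 1, by positivity, Eventually.of_forall fun i y => ?_⟩
    rw [abs_div, abs_of_pos (H.h_pos i), pow_one, div_eq_mul_inv]
    have := inv_pos.2 (H.h_pos i)
    gcongr
    linarith [abs_sub (g y) (g (x i)), hC y, hC (x i)]
  near := by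
    obtain ⟨C, hC_nonneg, hC⟩ :=
      exists_bound_annulus fun z hz => continuousAt_fderiv_radialExt hg hz
    refine ⟨C, 1, hC_nonneg, Eventually.of_forall fun i v hv => ?_⟩
    rw [abs_div, abs_of_pos (H.h_pos i), div_le_iff₀ (H.h_pos i), pow_one]
    calc _ ≤ C * ‖h i • v‖ := (H.frame i).abs_increment_gnomonic_le hg hC hv
      _ = C * ‖v‖ * h i := by rw [norm_smul, Real.norm_of_nonneg (H.h_pos i).le]; ring
      _ ≤ C * (1 + ‖v‖) * h i := by gcongr; exacts [(H.h_pos i).le, by simp]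
  tendsto v := by
    choose ξ hξ increment using fun i => (H.frame i).exists_increment_gnomonic hg (h i • v)
    refine (H.tendsto_fderiv hg (H.tendsto_add_frameMap_smul v hξ) v).congr fun i => ?_
    rw [increment, map_smul (frameMap (β i)) (h i) v, map_smul (fderiv ℝ _ _), smul_eq_mul,
      mul_div_cancel_left₀ _ (H.h_pos i).ne']

theorem polyBounded_remainder (H : Localized l h x β x₀ β₀)
    (hg : ContDiffOn ℝ 1 (radialExt g) {0}ᶜ) :
    PolyBounded l h fun i y => remainder g (x i) y / h i ^ 2 := by
  obtain ⟨C, hC_nonneg, hC⟩ := exists_bound_of_continuous (continuous_of_contDiffOn_radialExt hg)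
  obtain ⟨C₁, hC₁_nonneg, hC₁⟩ :=
    exists_bound_annulus fun z hz => continuousAt_fderiv_radialExt hg hz
  refine ⟨2 * C + 2 * C₁, 2, by positivity, Eventually.of_forall fun i y => ?_⟩
  have linear_le : |fderiv ℝ (radialExt g) (x i : Amb q) ((y : Amb q) - x i)| ≤ 2 * C₁ :=
    calc _ ≤ C₁ * ‖(y : Amb q) - x i‖ := ContinuousLinearMap.le_of_opNorm_le _
          (hC₁ _ (by simp [norm_eq_of_mem_sphere])) _
      _ ≤ C₁ * (‖(y : Amb q)‖ + ‖(x i : Amb q)‖) := by gcongr; exact norm_sub_le _ _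
      _ = 2 * C₁ := by rw [norm_eq_of_mem_sphere, norm_eq_of_mem_sphere]; ring
  rw [abs_div, abs_of_pos (pow_pos (H.h_pos i) 2), div_eq_mul_inv, inv_pow]
  have := inv_pos.2 (pow_pos (H.h_pos i) 2)
  gcongr
  calc |remainder g (x i) y|
      ≤ |g y| + |g (x i)| + |fderiv ℝ (radialExt g) (x i : Amb q) ((y : Amb q) - x i)| :=
        (abs_sub _ _).trans (add_le_add_left (abs_sub _ _) _)
    _ ≤ 2 * C + 2 * C₁ := by linarith [hC y, hC (x i)]

theorem tendsto_remainder_gnomonic (H : Localized l h x β x₀ β₀)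
    (hg : ContDiffOn ℝ 2 (radialExt g) {0}ᶜ) (v : Tan q) :
    Tendsto (fun i => remainder g (x i) (gnomonic (x i) (β i) (h i • v)) / h i ^ 2) l
      (𝓝 (fderiv ℝ (fderiv ℝ (radialExt g)) (x₀ : Amb q) (frameMap β₀ v) (frameMap β₀ v) / 2)) := by
  choose ξ hξ expansion using fun i => (H.frame i).exists_remainder_gnomonic hg (h i • v)
  have hsqrt := tendsto_sqrt_one_add_norm_smul_sq H.h_zero v
  have ratio : Tendsto (fun i => ‖v‖ ^ 2 / (√(1 + ‖h i • v‖ ^ 2) * (√(1 + ‖h i • v‖ ^ 2) + 1)))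
      l (𝓝 (‖v‖ ^ 2 / (1 * (1 + 1)))) :=
    tendsto_const_nhds.div (hsqrt.mul (hsqrt.add_const 1)) (by norm_num)
  have limit := ((H.tendsto_fderiv_fderiv hg (H.tendsto_add_frameMap_smul v hξ) v).div_const 2).add
    ((H.h_zero.mul ratio).mul (H.tendsto_fderiv (hg.of_le one_le_two) H.tendsto_coe v))
  rw [zero_mul, zero_mul, add_zero] at limit
  refine limit.congr fun i => ?_
  have := H.h_pos i
  rw [expansion]
  generalize √(1 + ‖h i • v‖ ^ 2) = s
  rw [norm_smul, Real.norm_of_nonneg this.le, map_smul (frameMap (β i)) (h i) v]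
  simp only [map_smul, _root_.smul_apply, smul_eq_mul]
  field_simp

theorem localLimit_remainder (H : Localized l h x β x₀ β₀)
    (hg : ContDiffOn ℝ 2 (radialExt g) {0}ᶜ) :
    LocalLimit l h x β (fun i y => remainder g (x i) y / h i ^ 2)
      (fun v => fderiv ℝ (fderiv ℝ (radialExt g)) (x₀ : Amb q) (frameMap β₀ v)
        (frameMap β₀ v) / 2) where
  measurable i := by
    have := (continuous_of_contDiffOn_radialExt hg).measurable
    unfold remainder
    fun_prop
  far := H.polyBounded_remainder (hg.of_le one_le_two)
  near := by
    obtain ⟨C₁, hC₁_nonneg, hC₁⟩ := exists_bound_annulus fun z hz =>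
      continuousAt_fderiv_radialExt (hg.of_le one_le_two) hz
    obtain ⟨C₂, hC₂_nonneg, hC₂⟩ := exists_bound_annulus (E := Amb q →L[ℝ] Amb q →L[ℝ] ℝ)
      fun z hz => continuousAt_fderiv_fderiv_radialExt hg hz
    refine ⟨C₁ + C₂, 2, by positivity, Eventually.of_forall fun i v hv => ?_⟩
    have h_sq_pos := pow_pos (H.h_pos i) 2
    rw [abs_div, abs_of_pos h_sq_pos, div_le_iff₀ h_sq_pos]
    calc _ ≤ (C₁ + C₂) * ‖h i • v‖ ^ 2 := (H.frame i).abs_remainder_gnomonic_le hg hC₁ hC₂ hv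
      _ = (C₁ + C₂) * ‖v‖ ^ 2 * h i ^ 2 := by
        rw [norm_smul, Real.norm_of_nonneg (H.h_pos i).le]
        ring
      _ ≤ (C₁ + C₂) * (1 + ‖v‖) ^ 2 * h i ^ 2 := by
        gcongr
        simp
  tendsto := H.tendsto_remainder_gnomonic hg

end Localized

/-! ### Conditional laws given the design -/

section CondDistrib

variable {Ω ι S E : Type*} [MeasurableSpace Ω] [MeasurableSpace S] [MeasurableSpace E]
  {μ : Measure Ω}

theorem condDistrib_uncurry_ae_eq_map [StandardBorelSpace E] [Nonempty E] [IsFiniteMeasure μ]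
    {V : Ω → S} {U : Ω → E} {G : S → E → ℝ} (hV : Measurable V) (hU : Measurable U)
    (hG : Measurable (Function.uncurry G)) :
    ∀ᵐ ω ∂μ, condDistrib (fun ω => G (V ω) (U ω)) V μ (V ω) =
      (condDistrib U V μ (V ω)).map (G (V ω)) := by
  have hκ : ∀ v, ((Kernel.id ×ₖ condDistrib U V μ).map (Function.uncurry G)) v =
      (condDistrib U V μ v).map (G v) := by
    intro v
    rw [Kernel.map_apply _ hG, Kernel.prod_apply, Kernel.id_apply, Measure.dirac_prod,
      Measure.map_map hG measurable_prodMk_left]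
    rfl
  have hcompProd : μ.map (fun ω => (V ω, G (V ω) (U ω))) =
      μ.map V ⊗ₘ (Kernel.id ×ₖ condDistrib U V μ).map (Function.uncurry G) := by
    have hfst : Measurable fun z : S × E => (z.1, G z.1 z.2) := measurable_fst.prodMk hG
    have hmap : μ.map (fun ω => (V ω, G (V ω) (U ω))) =
        (μ.map fun ω => (V ω, U ω)).map fun z => (z.1, G z.1 z.2) :=
      (Measure.map_map hfst (hV.prodMk hU)).symm
    rw [hmap, ← compProd_map_condDistrib hU.aemeasurable]
    ext s hs
    rw [Measure.map_apply hfst hs, Measure.compProd_apply (hfst hs), Measure.compProd_apply hs]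
    refine lintegral_congr fun v => ?_
    have hGv : Measurable (G v) := hG.comp measurable_prodMk_left
    rw [hκ, Measure.map_apply hGv (measurable_prodMk_left hs)]
    rfl
  have hZ : Measurable fun ω => G (V ω) (U ω) := hG.comp (hV.prodMk hU)
  filter_upwards [ae_of_ae_map hV.aemeasurable
    (condDistrib_ae_eq_of_measure_eq_compProd V hZ.aemeasurable hcompProd)] with ω hω
  rw [hω, hκ]

variable [Fintype ι]

/-- The product of Markov kernels, the `i`-th one being driven by the `i`-th coordinate. -/
def piKernel (κ : ι → Kernel S E) [∀ i, IsMarkovKernel (κ i)] : Kernel (ι → S) (ι → E) where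
  toFun v := Measure.pi fun i => κ i (v i)
  measurable' := by
    refine Measurable.measure_of_isPiSystem_of_isProbabilityMeasure generateFrom_pi.symm
      isPiSystem_pi ?_
    rintro _ ⟨B, hB, rfl⟩
    simp only [Measure.pi_pi]
    exact Finset.measurable_prod _ fun i _ =>
      ((κ i).measurable_coe (hB i (mem_univ i))).comp (measurable_pi_apply i)

theorem piKernel_apply (κ : ι → Kernel S E) [∀ i, IsMarkovKernel (κ i)] (v : ι → S) :
    piKernel κ v = Measure.pi fun i => κ i (v i) := rfl

instance (κ : ι → Kernel S E) [∀ i, IsMarkovKernel (κ i)] : IsMarkovKernel (piKernel κ) :=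
  ⟨fun v => by rw [piKernel_apply]; infer_instance⟩

variable [StandardBorelSpace E] [Nonempty E] [IsProbabilityMeasure μ]

theorem map_prodMk_eq_compProd_piKernel {V : ι → Ω → S} {U : ι → Ω → E}
    (hV : ∀ i, Measurable (V i)) (hU : ∀ i, Measurable (U i))
    (hind : iIndepFun (fun i ω => (V i ω, U i ω)) μ) :
    μ.map (fun ω => (fun i => V i ω, fun i => U i ω)) =
      μ.map (fun ω i => V i ω) ⊗ₘ piKernel fun i => condDistrib (U i) (V i) μ := by
  have hVU : ∀ i, Measurable fun ω => (V i ω, U i ω) := fun i => (hV i).prodMk (hU i)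
  have hVpi : Measurable fun ω i => V i ω := measurable_pi_lambda _ hV
  let φ := MeasurableEquiv.arrowProdEquivProdArrow S E ι
  refine φ.symm.map_measurableEquiv_injective ?_
  have hpairs : (μ.map fun ω => (fun i => V i ω, fun i => U i ω)).map φ.symm =
      Measure.pi fun i => μ.map fun ω => (V i ω, U i ω) := by
    rw [Measure.map_map φ.symm.measurable (hVpi.prodMk (measurable_pi_lambda _ hU))]
    exact hind.map_fun_eq_pi_map fun i => (hVU i).aemeasurable
  rw [hpairs]
  have : ∀ i, IsProbabilityMeasure (μ.map fun ω => (V i ω, U i ω)) := fun i =>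
    Measure.isProbabilityMeasure_map (hVU i).aemeasurable
  refine Measure.pi_eq fun s hs => ?_
  let g : ι → S → ENNReal := fun i x => condDistrib (U i) (V i) μ x (Prod.mk x ⁻¹' s i)
  have hg : ∀ i, Measurable (g i) := fun i => Kernel.measurable_kernel_prodMk_left (hs i)
  have hbox : ∀ v : ι → S, Prod.mk v ⁻¹' (φ.symm ⁻¹' univ.pi s) =
      univ.pi fun i => Prod.mk (v i) ⁻¹' s i := fun v => rfl
  rw [MeasurableEquiv.map_apply, Measure.compProd_apply
    (φ.symm.measurable (MeasurableSet.univ_pi hs))]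
  simp only [hbox, piKernel_apply, Measure.pi_pi]
  calc ∫⁻ v, ∏ i, g i (v i) ∂μ.map (fun ω i => V i ω)
      = ∫⁻ ω, ∏ i, g i (V i ω) ∂μ :=
        lintegral_map (Finset.measurable_prod _ fun i _ => (hg i).comp (measurable_pi_apply i)) hVpi
    _ = ∏ i, ∫⁻ ω, g i (V i ω) ∂μ :=
        lintegral_prod_eq_prod_lintegral_of_indepFun Finset.univ _
          (hind.comp (fun i z => g i z.1) fun i => (hg i).comp measurable_fst)
          fun i => (hg i).comp (hV i)
    _ = ∏ i, (μ.map fun ω => (V i ω, U i ω)) (s i) := by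
        refine Finset.prod_congr rfl fun i _ => ?_
        rw [← compProd_map_condDistrib (hU i).aemeasurable, Measure.compProd_apply (hs i),
          lintegral_map (hg i) (hV i)]

theorem condDistrib_pi_ae_eq {V : ι → Ω → S} {U : ι → Ω → E} (hV : ∀ i, Measurable (V i))
    (hU : ∀ i, Measurable (U i)) (hind : iIndepFun (fun i ω => (V i ω, U i ω)) μ) :
    ∀ᵐ ω ∂μ, condDistrib (fun ω i => U i ω) (fun ω i => V i ω) μ (fun i => V i ω) =
      Measure.pi fun i => condDistrib (U i) (V i) μ (V i ω) := by
  have hVpi : Measurable fun ω i => V i ω := measurable_pi_lambda _ hV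
  exact ae_of_ae_map hVpi.aemeasurable (condDistrib_ae_eq_of_measure_eq_compProd _
    (measurable_pi_lambda _ hU).aemeasurable (map_prodMk_eq_compProd_piKernel hV hU hind))

end CondDistrib

section Moments

/-- The conditional mean `m` and the conditional variance `v` are read off the residual
`Y - m (X)`, so that `Y` itself need not be integrable. -/
theorem ae_condDistrib_moments {Ω S : Type*} [MeasurableSpace Ω] [MeasurableSpace S]
    {μ : Measure Ω} [IsFiniteMeasure μ] {V : Ω → S} {U : Ω → ℝ} {m v : S → ℝ}
    (hV : Measurable V) (hU : Measurable U) (hm : Measurable m)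
    (hmem : MemLp (fun ω => U ω - m (V ω)) 2 μ)
    (hmean : μ[fun ω => U ω - m (V ω) | MeasurableSpace.comap V inferInstance] =ᵐ[μ] 0)
    (hvar : μ[fun ω => (U ω - m (V ω)) ^ 2 | MeasurableSpace.comap V inferInstance] =ᵐ[μ]
      fun ω => v (V ω)) :
    ∀ᵐ ω ∂μ, MemLp (fun y => y) 2 (condDistrib U V μ (V ω)) ∧
      ∫ y, y ∂(condDistrib U V μ (V ω)) = m (V ω) ∧
      variance (fun y => y) (condDistrib U V μ (V ω)) = v (V ω) := by
  have hres : Measurable fun z : S × ℝ => z.2 - m z.1 :=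
    measurable_snd.sub (hm.comp measurable_fst)
  have hint_sq := (integrable_map_measure (hres.pow_const 2).aestronglyMeasurable
    (hV.prodMk hU).aemeasurable).2 hmem.integrable_sq
  filter_upwards [hint_sq.condDistrib_ae hV.aemeasurable hU.aemeasurable, hmean, hvar,
    condExp_prod_ae_eq_integral_condDistrib hV hU.aemeasurable hres.stronglyMeasurable
      (hmem.integrable one_le_two),
    condExp_prod_ae_eq_integral_condDistrib hV hU.aemeasurable (hres.pow_const 2).stronglyMeasurable
      hmem.integrable_sq] with ω hsq hmean hvar hE hE_sq
  set κ := condDistrib U V μ (V ω)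
  have hmem_res : MemLp (fun y => y - m (V ω)) 2 κ :=
    (memLp_two_iff_integrable_sq (by fun_prop)).2 hsq
  have hmem_id : MemLp (fun y => y) 2 κ := by
    convert hmem_res.add (memLp_const (m (V ω))) using 1
    exact funext fun y => (sub_add_cancel y _).symm
  have hmean_κ : ∫ y, y ∂κ = m (V ω) := by
    have hzero : ∫ y, (y - m (V ω)) ∂κ = 0 := hE.symm.trans hmean
    rw [integral_sub (hmem_id.integrable one_le_two) (integrable_const _), integral_const,
      probReal_univ, one_smul] at hzero
    exact sub_eq_zero.1 hzero
  refine ⟨hmem_id, hmean_κ, ?_⟩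
  rw [variance_eq_integral aemeasurable_id', hmean_κ]
  exact hE_sq.symm.trans hvar

variable {ι : Type*} [Fintype ι] {ν : ι → Measure ℝ} [∀ i, IsProbabilityMeasure (ν i)]

theorem integral_pi_sum_mul_sub (hν : ∀ i, Integrable (fun y => y) (ν i)) (a : ι → ℝ) (c : ℝ) :
    ∫ y, ((∑ i, a i * y i) - c) ∂Measure.pi ν = (∑ i, a i * ∫ y, y ∂ν i) - c := by
  have hint : ∀ i ∈ Finset.univ, Integrable (fun y : ι → ℝ => a i * y i) (Measure.pi ν) :=
    fun i _ => (integrable_comp_eval (μ := ν) (i := i) (f := fun y : ℝ => y) (hν i)).const_mul (a i)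
  rw [integral_sub (integrable_finsetSum _ hint) (integrable_const _), integral_finsetSum _ hint,
    integral_const, probReal_univ, one_smul]
  simp only [integral_const_mul]
  congr 1
  refine Finset.sum_congr rfl fun i _ => ?_
  rw [integral_comp_eval (μ := ν) (i := i) (f := fun y : ℝ => y) (hν i).aestronglyMeasurable]

theorem variance_pi_sum_mul (hν : ∀ i, MemLp (fun y => y) 2 (ν i)) (a : ι → ℝ) :
    variance (fun y => ∑ i, a i * y i) (Measure.pi ν) =
      ∑ i, a i ^ 2 * variance (fun y => y) (ν i) := by
  rw [← Finset.sum_fn, variance_sum_pi fun i => (hν i).const_mul (a i)]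
  exact Finset.sum_congr rfl fun i _ => variance_const_mul (a i) _ _

end Moments

/-- A sample of independent pairs `(X i, Y i)` in which `X i` has density `f` with respect to the
surface measure, and `Y i` has conditional mean `m (X i)` and conditional variance `v (X i)`. -/
structure IsMeanVarianceSample {q : ℕ} {Ω : Type*} [MeasurableSpace Ω] (μ : Measure Ω)
    (f m v : Sph q → ℝ) (X : ℕ → Ω → Sph q) (Y : ℕ → Ω → ℝ) : Prop where
  measurable_X : ∀ i, Measurable (X i)
  measurable_Y : ∀ i, Measurable (Y i)
  indep : iIndepFun (fun i ω => (X i ω, Y i ω)) μ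
  density : ∀ i, μ.map (X i) = (surf q).withDensity fun x => ENNReal.ofReal (f x)
  memLp : ∀ i, MemLp (fun ω => Y i ω - m (X i ω)) 2 μ
  mean : ∀ i, μ[fun ω => Y i ω - m (X i ω) | MeasurableSpace.comap (X i) inferInstance] =ᵐ[μ] 0
  var : ∀ i, μ[fun ω => (Y i ω - m (X i ω)) ^ 2 | MeasurableSpace.comap (X i) inferInstance]
    =ᵐ[μ] fun ω => v (X i ω)

section Sample

variable {q : ℕ} {Ω : Type*} [MeasurableSpace Ω] {μ : Measure Ω} [IsProbabilityMeasure μ]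
  {f m v σ : Sph q → ℝ} {X : ℕ → Ω → Sph q} {Y ε : ℕ → Ω → ℝ}

theorem IsRegressionSample.isMeanVarianceSample (hs : IsRegressionSample μ f m σ X Y ε)
    (hσ : Continuous fun x => σ x ^ 2) :
    IsMeanVarianceSample μ f m (fun x => σ x ^ 2) X Y := by
  obtain ⟨C, -, hC⟩ := exists_bound_of_continuous hσ
  have hres : ∀ i ω, Y i ω - m (X i ω) = σ (X i ω) * ε i ω := fun i ω => by
    rw [hs.model, add_sub_cancel_left]
  have hbdd : ∀ i ω, ‖σ (X i ω)‖ ≤ √C := fun i ω =>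
    Real.abs_le_sqrt ((le_abs_self _).trans (hC (X i ω)))
  have hσX : ∀ i, StronglyMeasurable[MeasurableSpace.comap (X i) inferInstance]
      fun ω => σ (X i ω) := fun i =>
    (hs.measurable_σ.comp (comap_measurable (X i))).stronglyMeasurable
  have hmem : ∀ i, MemLp (fun ω => σ (X i ω) * ε i ω) 2 μ := fun i =>
    ((hs.memLp_ε i).mono_exponent (by norm_num)).of_le_mul (c := √C)
      (hs.measurable_σ.comp (hs.measurable_X i) |>.mul (hs.measurable_ε i)).aestronglyMeasurable
      (ae_of_all _ fun ω => by
        rw [norm_mul]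
        exact mul_le_mul_of_nonneg_right (hbdd i ω) (norm_nonneg _))
  have hε : ∀ i, MemLp (ε i) 2 μ := fun i => (hs.memLp_ε i).mono_exponent (by norm_num)
  refine ⟨hs.measurable_X, hs.measurable_Y, hs.indep, fun i => ?_, fun i => ?_, fun i => ?_,
    fun i => ?_⟩
  · rw [← hs.density]
    exact ((hs.identDistrib i).comp measurable_fst).map_eq
  · simpa only [hres] using hmem i
  · simp only [hres]
    filter_upwards [condExp_mul_of_stronglyMeasurable_left (hσX i)
      ((hmem i).integrable one_le_two) ((hε i).integrable one_le_two), hs.mean_ε i] with ω hω hmean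
    exact hω.trans (by simp [hmean])
  · simp only [hres, mul_pow]
    have hint := (hmem i).integrable_sq
    simp only [mul_pow] at hint
    filter_upwards [condExp_mul_of_stronglyMeasurable_left ((hσX i).pow 2) hint
      (hε i).integrable_sq, hs.var_ε i] with ω hω hvar
    exact hω.trans (by simp [hvar])

theorem IsMeanVarianceSample.ae_condMean_condVariance (hs : IsMeanVarianceSample μ f m v X Y)
    (hm : Measurable m) {n : ℕ} {a : (Fin n → Sph q) → Fin n → ℝ} (ha : Measurable a) (c : ℝ) :
    ∀ᵐ ω ∂μ,
      condMean μ (fun ω => (∑ i : Fin n, a (fun i => X i ω) i * Y i ω) - c)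
        (fun ω (i : Fin n) => X i ω) ω =
        (∑ i : Fin n, a (fun i => X i ω) i * m (X i ω)) - c ∧
      condVariance μ (fun ω => ∑ i : Fin n, a (fun i => X i ω) i * Y i ω)
        (fun ω (i : Fin n) => X i ω) ω =
        ∑ i : Fin n, a (fun i => X i ω) i ^ 2 * v (X i ω) := by
  have hV : Measurable fun ω (i : Fin n) => X i ω :=
    measurable_pi_lambda _ fun i => hs.measurable_X i
  have hU : Measurable fun ω (i : Fin n) => Y i ω :=
    measurable_pi_lambda _ fun i => hs.measurable_Y i
  have hG : Measurable fun z : (Fin n → Sph q) × (Fin n → ℝ) => ∑ i, a z.1 i * z.2 i :=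
    Finset.measurable_fun_sum _ fun i _ =>
      ((measurable_pi_apply i).comp (ha.comp measurable_fst)).mul (by fun_prop)
  have hindep : iIndepFun (fun (i : Fin n) ω => (X i ω, Y i ω)) μ :=
    hs.indep.precomp Fin.val_injective
  filter_upwards [condDistrib_uncurry_ae_eq_map (μ := μ) hV hU (G := fun x (y : Fin n → ℝ) =>
      (∑ i, a x i * y i) - c) (hG.sub_const c),
    condDistrib_uncurry_ae_eq_map (μ := μ) hV hU
      (G := fun x (y : Fin n → ℝ) => ∑ i, a x i * y i) hG,
    condDistrib_pi_ae_eq (fun i : Fin n => hs.measurable_X i) (fun i => hs.measurable_Y i) hindep,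
    ae_all_iff.2 fun i : Fin n => ae_condDistrib_moments (hs.measurable_X i) (hs.measurable_Y i)
      hm (hs.memLp i) (hs.mean i) (hs.var i)] with ω hmean hvar hpi hmoments
  have hmeas : Measurable fun y : Fin n → ℝ => ∑ i, a (fun i => X i ω) i * y i := by fun_prop
  constructor
  · rw [condMean, hmean, hpi,
      integral_map (hmeas.sub_const c).aemeasurable (f := fun z : ℝ => z) aestronglyMeasurable_id,
      integral_pi_sum_mul_sub fun i => (hmoments i).1.integrable one_le_two]
    simp only [(hmoments _).2.1]
  · rw [condVariance, hvar, hpi, variance_map aemeasurable_id' hmeas.aemeasurable]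
    exact (variance_pi_sum_mul (fun i => (hmoments i).1) _).trans
      (by simp only [(hmoments _).2.2])

end Sample

/-! ### Kernel averages over the sample -/

theorem integral_withDensity_ofReal {S : Type*} [MeasurableSpace S] {ν : Measure S} {f : S → ℝ}
    (hf : Measurable f) (hf_nonneg : ∀ y, 0 ≤ f y) (ψ : S → ℝ) :
    ∫ y, ψ y ∂ν.withDensity (fun y => ENNReal.ofReal (f y)) = ∫ y, ψ y * f y ∂ν := by
  rw [integral_withDensity_eq_integral_toReal_smul (by fun_prop) (by simp)]
  simp only [ENNReal.toReal_ofReal (hf_nonneg _), smul_eq_mul, mul_comm]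

section SampleSum

variable {ι Ω S : Type*} [Fintype ι] [MeasurableSpace Ω] [MeasurableSpace S] {μ : Measure Ω}
  {ν : Measure S} {Z : ι → Ω → S} {ψ : S → ℝ}

theorem memLp_sum_comp (hZ : ∀ i, MeasurePreserving (Z i) μ ν) (hψ : MemLp ψ 2 ν) :
    MemLp (fun ω => ∑ i, ψ (Z i ω)) 2 μ :=
  memLp_finsetSum _ fun i _ => hψ.comp_measurePreserving (hZ i)

theorem integral_sum_comp (hZ : ∀ i, MeasurePreserving (Z i) μ ν) (hψ : Integrable ψ ν) :
    ∫ ω, ∑ i, ψ (Z i ω) ∂μ = Fintype.card ι * ∫ y, ψ y ∂ν := by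
  have hint : ∀ i, Integrable (fun ω => ψ (Z i ω)) μ := fun i =>
    (hZ i).integrable_comp_of_integrable hψ
  rw [integral_finsetSum _ fun i _ => hint i]
  have hmean : ∀ i, ∫ ω, ψ (Z i ω) ∂μ = ∫ y, ψ y ∂ν := fun i => by
    rw [← (hZ i).map_eq, integral_map (hZ i).measurable.aemeasurable
      ((hZ i).map_eq ▸ hψ.aestronglyMeasurable)]
  simp [hmean]

theorem variance_sum_comp (hZ : ∀ i, MeasurePreserving (Z i) μ ν)
    (hindep : iIndepFun Z μ) (hψ : Measurable ψ) (hψ₂ : MemLp ψ 2 ν) :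
    variance (fun ω => ∑ i, ψ (Z i ω)) μ = Fintype.card ι * variance ψ ν := by
  have hsum := IndepFun.variance_sum (μ := μ) (s := Finset.univ) (X := fun i ω => ψ (Z i ω))
    (fun i _ => hψ₂.comp_measurePreserving (hZ i))
    fun i _ j _ hij => (hindep.indepFun hij).comp hψ hψ
  rw [Finset.sum_fn] at hsum
  rw [hsum]
  simp [fun i => (hZ i).variance_fun_comp hψ.aemeasurable]

end SampleSum

/-- Independent random points of the sphere with density `f` with respect to the surface measure. -/
structure IsRandomDesign {q : ℕ} {Ω : Type*} [MeasurableSpace Ω] (μ : Measure Ω)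
    (f : Sph q → ℝ) (X : ℕ → Ω → Sph q) : Prop where
  measurePreserving : ∀ i,
    MeasurePreserving (X i) μ ((surf q).withDensity fun x => ENNReal.ofReal (f x))
  indep : iIndepFun X μ

theorem IsMeanVarianceSample.isRandomDesign {q : ℕ} {Ω : Type*} [MeasurableSpace Ω] {μ : Measure Ω}
    {f m v : Sph q → ℝ} {X : ℕ → Ω → Sph q} {Y : ℕ → Ω → ℝ}
    (hs : IsMeanVarianceSample μ f m v X Y) : IsRandomDesign μ f X where
  measurePreserving i := ⟨hs.measurable_X i, hs.density i⟩
  indep := hs.indep.comp (fun _ => Prod.fst) fun _ => measurable_fst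

/-- The weighted sum `∑ j, L ((1 - xᵀ X_j) / h²) φ (X_j)` divided by `n h^q`. -/
def kernelAvg {q : ℕ} {Ω : Type*} (L : ℝ → ℝ) (X : ℕ → Ω → Sph q) (n : ℕ) (h : ℝ) (x : Sph q)
    (φ : Sph q → ℝ) (ω : Ω) : ℝ :=
  ((n : ℝ) * h ^ q)⁻¹ * ∑ j : Fin n, rawKernel L h x (X j ω) * φ (X j ω)

/-- The expectation `h^{-q} ∫ L ((1 - xᵀ y) / h²) φ(y) f(y) dy` of a kernel average over a sample
with density `f`. -/
def kernelMean {q : ℕ} (L : ℝ → ℝ) (f : Sph q → ℝ) (h : ℝ) (x : Sph q) (φ : Sph q → ℝ) : ℝ :=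
  (h ^ q)⁻¹ * ∫ y, rawKernel L h x y * (φ y * f y) ∂surf q

section Averages

variable {q : ℕ} {Ω : Type*} [MeasurableSpace Ω] {μ : Measure Ω} [IsProbabilityMeasure μ]
  {f : Sph q → ℝ} {X : ℕ → Ω → Sph q} {L : ℝ → ℝ} {φ : Sph q → ℝ} {C : ℝ}

namespace IsRandomDesign

theorem isProbabilityMeasure_withDensity (hX : IsRandomDesign μ f X) :
    IsProbabilityMeasure ((surf q).withDensity fun x => ENNReal.ofReal (f x)) :=
  (hX.measurePreserving 0).map_eq ▸
    Measure.isProbabilityMeasure_map (hX.measurePreserving 0).measurable.aemeasurable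

theorem memLp_rawKernel_mul (hX : IsRandomDesign μ f X) (hL : IsDirectionalKernel L) (h : ℝ)
    (x : Sph q) (hφ : Measurable φ) (hC : ∀ y, |φ y| ≤ C) :
    MemLp (fun y => rawKernel L h x y * φ y) 2
      ((surf q).withDensity fun x => ENNReal.ofReal (f x)) := by
  have := hX.isProbabilityMeasure_withDensity
  obtain ⟨D, hD_nonneg, hD⟩ := exists_bound_of_continuous (continuous_rawKernel hL h x)
  refine MemLp.of_bound ((continuous_rawKernel hL h x).measurable.mul hφ).aestronglyMeasurable
    (D * C) (ae_of_all _ fun y => ?_)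
  rw [Real.norm_eq_abs, abs_mul]
  exact mul_le_mul (hD y) (hC y) (abs_nonneg _) hD_nonneg

theorem memLp_kernelAvg (hX : IsRandomDesign μ f X) (hL : IsDirectionalKernel L) (n : ℕ) (h : ℝ)
    (x : Sph q) (hφ : Measurable φ) (hC : ∀ y, |φ y| ≤ C) :
    MemLp (kernelAvg L X n h x φ) 2 μ :=
  (memLp_sum_comp (Z := fun j : Fin n => X j) (fun j => hX.measurePreserving j)
    (hX.memLp_rawKernel_mul hL h x hφ hC)).const_mul _

theorem integral_kernelAvg (hX : IsRandomDesign μ f X) (hf : Measurable f)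
    (hf_nonneg : ∀ y, 0 ≤ f y) (hL : IsDirectionalKernel L) {n : ℕ} (hn : n ≠ 0) (h : ℝ)
    (x : Sph q) (hφ : Measurable φ) (hC : ∀ y, |φ y| ≤ C) :
    ∫ ω, kernelAvg L X n h x φ ω ∂μ = kernelMean L f h x φ := by
  have := hX.isProbabilityMeasure_withDensity
  have hsum := integral_sum_comp (Z := fun j : Fin n => X j) (fun j => hX.measurePreserving j)
    ((hX.memLp_rawKernel_mul hL h x hφ hC).integrable one_le_two)
  rw [integral_withDensity_ofReal hf hf_nonneg, Fintype.card_fin] at hsum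
  have hn' : (n : ℝ) ≠ 0 := Nat.cast_ne_zero.2 hn
  simp only [kernelAvg, kernelMean, integral_const_mul, hsum, mul_assoc]
  field_simp

theorem variance_kernelAvg_le (hX : IsRandomDesign μ f X) (hf : Measurable f)
    (hf_nonneg : ∀ y, 0 ≤ f y) (hL : IsDirectionalKernel L) {n : ℕ} (hn : n ≠ 0) {h : ℝ}
    (hh : h ≠ 0) (x : Sph q) (hφ : Measurable φ) (hC : ∀ y, |φ y| ≤ C) :
    variance (kernelAvg L X n h x φ) μ ≤
      ((n : ℝ) * h ^ q)⁻¹ * kernelMean (fun r => L r ^ 2) f h x (fun y => φ y * φ y) := by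
  have := hX.isProbabilityMeasure_withDensity
  have hmem := hX.memLp_rawKernel_mul hL h x hφ hC
  have hsq := variance_le_expectation_sq hmem.aestronglyMeasurable
  simp only [Pi.pow_apply, integral_withDensity_ofReal hf hf_nonneg, mul_pow, sq (φ _),
    mul_assoc] at hsq
  have hsum := variance_sum_comp (Z := fun j : Fin n => X j)
    (ψ := fun y => rawKernel L h x y * φ y) (fun j => hX.measurePreserving j)
    (hX.indep.precomp Fin.val_injective)
    ((continuous_rawKernel hL h x).measurable.mul hφ) hmem
  have hn' : (n : ℝ) ≠ 0 := Nat.cast_ne_zero.2 hn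
  calc variance (kernelAvg L X n h x φ) μ
      = ((n : ℝ) * h ^ q)⁻¹ ^ 2 * (n * variance (fun y => rawKernel L h x y * φ y)
          ((surf q).withDensity fun x => ENNReal.ofReal (f x))) := by
        unfold kernelAvg
        rw [variance_const_mul, hsum, Fintype.card_fin]
    _ ≤ ((n : ℝ) * h ^ q)⁻¹ ^ 2 *
          (n * ∫ y, rawKernel L h x y ^ 2 * (φ y * (φ y * f y)) ∂surf q) := by gcongr
    _ = ((n : ℝ) * h ^ q)⁻¹ *
          ((h ^ q)⁻¹ * ∫ y, rawKernel L h x y ^ 2 * (φ y * (φ y * f y)) ∂surf q) := by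
        field_simp
    _ = _ := by
        simp only [kernelMean, rawKernel, mul_assoc]

end IsRandomDesign

variable {ι : Type*} {l : Filter ι} {h : ι → ℝ} {x : ι → Sph q}
  {β : ι → Fin q → Amb q} {x₀ : Sph q} {β₀ : Fin q → Amb q} {N : ι → ℕ}
  {φ : ι → Sph q → ℝ} {Φ : Tan q → ℝ}

theorem PolyBounded.eventually_bound (hφ : PolyBounded l h φ) :
    ∀ᶠ i in l, ∃ C, ∀ y, |φ i y| ≤ C := by
  obtain ⟨C, k, -, hC⟩ := hφ
  filter_upwards [hC] with i hi using ⟨_, hi⟩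

theorem Localized.tendsto_kernelMean [l.IsCountablyGenerated] (H : Localized l h x β x₀ β₀)
    (hf : Continuous f) (hL : IsDirectionalKernel L) (hφ : LocalLimit l h x β φ Φ) :
    Tendsto (fun i => kernelMean L f (h i) (x i) (φ i)) l
      (𝓝 (f x₀ * ∫ v : Tan q, L (‖v‖ ^ 2 / 2) * Φ v)) := by
  have hlim := (hφ.mul (H.localLimit_continuous hf)).tendsto_integral hL H.h_pos H.h_zero H.frame
  simpa only [← mul_assoc, integral_mul_const, mul_comm (f x₀), kernelMean] using hlim

theorem eventually_ne_zero_of_tendsto_mul_atTop {a : ι → ℝ}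
    (hN : Tendsto (fun i => (N i : ℝ) * a i) l atTop) : ∀ᶠ i in l, N i ≠ 0 := by
  filter_upwards [hN.eventually_ne_atTop 0] with i hi
  exact_mod_cast left_ne_zero_of_mul hi

theorem Localized.tendsto_kernelAvg [l.IsCountablyGenerated] (H : Localized l h x β x₀ β₀)
    (hX : IsRandomDesign μ f X) (hf : Continuous f) (hf_nonneg : ∀ y, 0 ≤ f y)
    (hL : IsDirectionalKernel L) (hN : Tendsto (fun i => (N i : ℝ) * h i ^ q) l atTop)
    (hφ : LocalLimit l h x β φ Φ) :
    Tendsto (fun z : ι × Ω => kernelAvg L X (N z.1) (h z.1) (x z.1) (φ z.1) z.2) (probFilter μ l)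
      (𝓝 (f x₀ * ∫ v : Tan q, L (‖v‖ ^ 2 / 2) * Φ v)) := by
  have hbdd := hφ.far.eventually_bound
  have hN_ne := eventually_ne_zero_of_tendsto_mul_atTop hN
  have hvar := (tendsto_inv_atTop_zero.comp hN).mul (H.tendsto_kernelMean hf hL.sq (hφ.mul hφ))
  rw [zero_mul] at hvar
  refine tendsto_probFilter_of_variance
    (A := fun i => kernelAvg L X (N i) (h i) (x i) (φ i)) ?_ ?_ ?_
  · filter_upwards [hbdd] with i ⟨C, hC⟩
    exact hX.memLp_kernelAvg hL _ _ _ (hφ.measurable i) hC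
  · refine (H.tendsto_kernelMean hf hL hφ).congr' ?_
    filter_upwards [hbdd, hN_ne] with i ⟨C, hC⟩ hi
    exact (hX.integral_kernelAvg hf.measurable hf_nonneg hL hi _ _ (hφ.measurable i) hC).symm
  · refine tendsto_of_tendsto_of_tendsto_of_le_of_le' tendsto_const_nhds hvar
      (Eventually.of_forall fun i => variance_nonneg _ _) ?_
    filter_upwards [hbdd, hN_ne] with i ⟨C, hC⟩ hi
    exact hX.variance_kernelAvg_le hf.measurable hf_nonneg hL hi (H.h_pos i).ne' _
      (hφ.measurable i) hC

end Averages

/-! ### Weighted least squares -/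

section WLS

variable {n d : ℕ}

/-- The weight of the `j`-th response in the weighted least squares intercept `wlsIntercept`. -/
def wlsWeight (D : Matrix (Fin n) (Fin (d + 1)) ℝ) (w : Fin n → ℝ) (j : Fin n) : ℝ :=
  ((D.transpose * Matrix.diagonal w * D)⁻¹ * (D.transpose * Matrix.diagonal w)) 0 j

theorem wlsIntercept_eq_sum (D : Matrix (Fin n) (Fin (d + 1)) ℝ) (w y : Fin n → ℝ) :
    wlsIntercept D w y = ∑ j, wlsWeight D w j * y j := by
  rw [wlsIntercept, Matrix.mulVec_mulVec]
  rfl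

theorem inv_smul_matrix {ι : Type*} [Fintype ι] [DecidableEq ι] {c : ℝ} (hc : c ≠ 0)
    (A : Matrix ι ι ℝ) : (c • A)⁻¹ = c⁻¹ • A⁻¹ := by
  by_cases hA : IsUnit A.det
  · exact Matrix.inv_smul' A (Units.mk0 c hc) hA
  · have hcA : ¬ IsUnit (c • A).det := by
      simpa [Matrix.det_smul, hc] using hA
    rw [Matrix.nonsing_inv_apply_not_isUnit _ hA, Matrix.nonsing_inv_apply_not_isUnit _ hcA,
      smul_zero]

theorem wlsWeight_smul (D : Matrix (Fin n) (Fin (d + 1)) ℝ) {c : ℝ} (hc : c ≠ 0)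
    (w : Fin n → ℝ) : wlsWeight D (c • w) = wlsWeight D w := by
  ext j
  simp only [wlsWeight, Matrix.diagonal_smul, Matrix.mul_smul, Matrix.smul_mul,
    inv_smul_matrix hc, smul_smul, mul_inv_cancel₀ hc, one_smul]

theorem wlsWeight_mul_diagonal (D : Matrix (Fin n) (Fin (d + 1)) ℝ) {s : Fin (d + 1) → ℝ}
    (hs : ∀ a, s a ≠ 0) (hs_zero : s 0 = 1) (w : Fin n → ℝ) :
    wlsWeight (D * Matrix.diagonal s) w = wlsWeight D w := by
  have hs_unit : IsUnit (Matrix.diagonal s).det := by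
    simpa [Matrix.det_diagonal, Finset.prod_ne_zero_iff] using hs
  have hs_inv : (Matrix.diagonal s)⁻¹ = Matrix.diagonal fun a => (s a)⁻¹ :=
    Matrix.inv_eq_right_inv (by simp [Matrix.diagonal_mul_diagonal, hs])
  have hgram : (D * Matrix.diagonal s).transpose * Matrix.diagonal w * (D * Matrix.diagonal s) =
      Matrix.diagonal s * (D.transpose * Matrix.diagonal w * D) * Matrix.diagonal s := by
    simp only [Matrix.transpose_mul, Matrix.diagonal_transpose, Matrix.mul_assoc]
  have hweights : ((D * Matrix.diagonal s).transpose * Matrix.diagonal w *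
        (D * Matrix.diagonal s))⁻¹ * ((D * Matrix.diagonal s).transpose * Matrix.diagonal w) =
      Matrix.diagonal (fun a => (s a)⁻¹) *
        ((D.transpose * Matrix.diagonal w * D)⁻¹ * (D.transpose * Matrix.diagonal w)) := by
    rw [hgram, Matrix.mul_inv_rev, Matrix.mul_inv_rev, Matrix.transpose_mul,
      Matrix.diagonal_transpose, hs_inv.symm]
    simp only [Matrix.mul_assoc, Matrix.nonsing_inv_mul_cancel_left _ _ hs_unit]
  ext j
  rw [wlsWeight, hweights, Matrix.diagonal_mul, hs_zero, inv_one, one_mul, wlsWeight]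

theorem measurable_det {α ι : Type*} [MeasurableSpace α] [Fintype ι] [DecidableEq ι]
    {A : α → Matrix ι ι ℝ} (hA : ∀ i j, Measurable fun v => A v i j) :
    Measurable fun v => (A v).det := by
  simp_rw [Matrix.det_apply]
  exact Finset.measurable_fun_sum _ fun τ _ =>
    (Finset.measurable_fun_prod _ fun i _ => hA _ _).const_smul _

theorem measurable_matrix_inv {α ι : Type*} [MeasurableSpace α] [Fintype ι] [DecidableEq ι]
    {A : α → Matrix ι ι ℝ} (hA : ∀ i j, Measurable fun v => A v i j) (i j : ι) :
    Measurable fun v => (A v)⁻¹ i j := by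
  simp_rw [Matrix.inv_def, Matrix.smul_apply, Ring.inverse_eq_inv', Matrix.adjugate_apply]
  refine (measurable_det hA).inv.smul (measurable_det fun k l => ?_)
  simp_rw [Matrix.updateRow_apply]
  split_ifs
  · exact measurable_const
  · exact hA k l

theorem measurable_wlsWeight {α : Type*} [MeasurableSpace α]
    {D : α → Matrix (Fin n) (Fin (d + 1)) ℝ} {w : α → Fin n → ℝ}
    (hD : ∀ j a, Measurable fun v => D v j a) (hw : ∀ j, Measurable fun v => w v j) (j : Fin n) :
    Measurable fun v => wlsWeight (D v) (w v) j := by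
  have hDw : ∀ a k, Measurable fun v => ((D v).transpose * Matrix.diagonal (w v)) a k := by
    intro a k
    simp_rw [Matrix.mul_diagonal, Matrix.transpose_apply]
    exact (hD k a).mul (hw k)
  simp_rw [wlsWeight, Matrix.mul_apply]
  refine Finset.measurable_fun_sum _ fun a _ => (measurable_matrix_inv (fun b b' => ?_) 0 a).mul ?_
  · simp_rw [Matrix.mul_apply (N := D _)]
    exact Finset.measurable_fun_sum _ fun k _ => (hDw b k).mul (hD k b')
  · simpa [Matrix.mul_apply] using hDw a j

end WLS

section LocalWeights

variable {q d : ℕ} {Ω : Type*} {X : ℕ → Ω → Sph q} {L : ℝ → ℝ} {n : ℕ} {h : ℝ} {x : Sph q}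
  {ζ : Fin (d + 1) → Sph q → ℝ} {ω : Ω}

/-- The Gram matrix of the functions `ζ a` for the kernel average. -/
def gram (L : ℝ → ℝ) (X : ℕ → Ω → Sph q) (n : ℕ) (h : ℝ) (x : Sph q)
    (ζ : Fin (d + 1) → Sph q → ℝ) (ω : Ω) : Matrix (Fin (d + 1)) (Fin (d + 1)) ℝ :=
  Matrix.of fun a b => kernelAvg L X n h x (fun y => ζ a y * ζ b y) ω

/-- The weights of the responses in the intercept of the kernel regression on the functions `ζ a`.
The kernel weights are divided by `n h^q`, which does not change the intercept and makes `gram` the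
matrix of the normal equations. -/
def localWeight (L : ℝ → ℝ) (X : ℕ → Ω → Sph q) (n : ℕ) (h : ℝ) (x : Sph q)
    (ζ : Fin (d + 1) → Sph q → ℝ) (ω : Ω) : Fin n → ℝ :=
  wlsWeight (Matrix.of fun (j : Fin n) a => ζ a (X j ω))
    (((n : ℝ) * h ^ q)⁻¹ • fun j : Fin n => rawKernel L h x (X j ω))

theorem localWeight_eq (j : Fin n) :
    localWeight L X n h x ζ ω j = ((n : ℝ) * h ^ q)⁻¹ * rawKernel L h x (X j ω) *
      ∑ a, (gram L X n h x ζ ω)⁻¹ 0 a * ζ a (X j ω) := by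
  have hgram : (Matrix.of fun (j : Fin n) a => ζ a (X j ω)).transpose *
      Matrix.diagonal (((n : ℝ) * h ^ q)⁻¹ • fun j : Fin n => rawKernel L h x (X j ω)) *
      Matrix.of (fun (j : Fin n) a => ζ a (X j ω)) = gram L X n h x ζ ω := by
    ext a b
    rw [Matrix.mul_apply]
    simp only [Matrix.mul_diagonal, Matrix.transpose_apply, Matrix.of_apply, Pi.smul_apply,
      smul_eq_mul, gram, kernelAvg, Finset.mul_sum]
    exact Finset.sum_congr rfl fun j _ => by ring
  rw [localWeight, wlsWeight, hgram, Matrix.mul_apply, Finset.mul_sum]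
  refine Finset.sum_congr rfl fun a _ => ?_
  rw [Matrix.mul_diagonal, Matrix.transpose_apply, Matrix.of_apply, Pi.smul_apply, smul_eq_mul]
  ring

theorem sum_localWeight_mul (φ : Sph q → ℝ) :
    ∑ j, localWeight L X n h x ζ ω j * φ (X j ω) =
      ∑ a, (gram L X n h x ζ ω)⁻¹ 0 a * kernelAvg L X n h x (fun y => ζ a y * φ y) ω := by
  simp_rw [localWeight_eq, kernelAvg, Finset.mul_sum, Finset.sum_mul]
  rw [Finset.sum_comm]
  exact Finset.sum_congr rfl fun a _ => Finset.sum_congr rfl fun j _ => by ring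

theorem sum_localWeight_sq_mul (v : Sph q → ℝ) :
    (n : ℝ) * h ^ q * ∑ j, localWeight L X n h x ζ ω j ^ 2 * v (X j ω) =
      ∑ a, ∑ b, (gram L X n h x ζ ω)⁻¹ 0 a * (gram L X n h x ζ ω)⁻¹ 0 b *
        kernelAvg (fun r => L r ^ 2) X n h x (fun y => ζ a y * ζ b y * v y) ω := by
  have hterm : ∀ j : Fin n, (n : ℝ) * h ^ q * (localWeight L X n h x ζ ω j ^ 2 * v (X j ω)) =
      ∑ a, ∑ b, (gram L X n h x ζ ω)⁻¹ 0 a * (gram L X n h x ζ ω)⁻¹ 0 b *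
        (((n : ℝ) * h ^ q)⁻¹ * (rawKernel (fun r => L r ^ 2) h x (X j ω) *
          (ζ a (X j ω) * ζ b (X j ω) * v (X j ω)))) := by
    intro j
    have hsq : (n : ℝ) * h ^ q * (localWeight L X n h x ζ ω j ^ 2 * v (X j ω)) =
        ((∑ a, (gram L X n h x ζ ω)⁻¹ 0 a * ζ a (X j ω)) *
          ∑ b, (gram L X n h x ζ ω)⁻¹ 0 b * ζ b (X j ω)) *
          (((n : ℝ) * h ^ q)⁻¹ * (rawKernel (fun r => L r ^ 2) h x (X j ω) * v (X j ω))) := by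
      rw [localWeight_eq, show rawKernel (fun r => L r ^ 2) h x (X j ω) =
        rawKernel L h x (X j ω) ^ 2 from rfl]
      field_simp
    simp_rw [hsq, Finset.sum_mul_sum, Finset.sum_mul]
    exact Finset.sum_congr rfl fun a _ => Finset.sum_congr rfl fun b _ => by ring
  simp_rw [kernelAvg, Finset.mul_sum, hterm]
  rw [Finset.sum_comm]
  refine Finset.sum_congr rfl fun a _ => ?_
  rw [Finset.sum_comm]

theorem sum_localWeight_mul_self (hdet : (gram L X n h x ζ ω).det ≠ 0) (b : Fin (d + 1)) :
    ∑ j, localWeight L X n h x ζ ω j * ζ b (X j ω) = if b = 0 then 1 else 0 := by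
  rw [sum_localWeight_mul]
  have hinv := congrFun₂ (Matrix.nonsing_inv_mul _ (isUnit_iff_ne_zero.2 hdet)) 0 b
  rw [Matrix.mul_apply, Matrix.one_apply] at hinv
  simp_rw [eq_comm (a := b)]
  exact hinv

end LocalWeights

/-! ### Asymptotics of the local regression weights -/

section LocalDesign

variable {q d : ℕ} {Ω : Type*} [MeasurableSpace Ω] {μ : Measure Ω}
  {f : Sph q → ℝ} {X : ℕ → Ω → Sph q} {ι : Type*} {l : Filter ι} {h : ι → ℝ} {x : ι → Sph q}
  {β : ι → Fin q → Amb q} {x₀ : Sph q} {β₀ : Fin q → Amb q} {L : ℝ → ℝ} {N : ι → ℕ}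
  {ζ : ι → Fin (d + 1) → Sph q → ℝ} {Z : Fin (d + 1) → Tan q → ℝ} {D : Fin (d + 1) → ℝ}

/-- Regression functions with local limits that are orthogonal for the kernel, the first of them
the constant one. -/
structure LocalDesign (L : ℝ → ℝ) (l : Filter ι) (h : ι → ℝ) (x : ι → Sph q)
    (β : ι → Fin q → Amb q) (ζ : ι → Fin (d + 1) → Sph q → ℝ) (Z : Fin (d + 1) → Tan q → ℝ)
    (D : Fin (d + 1) → ℝ) : Prop where
  limit_zero : ∀ v, Z 0 v = 1
  limit : ∀ a, LocalLimit l h x β (fun i => ζ i a) (Z a)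
  orthogonal : ∀ a b, ∫ v : Tan q, L (‖v‖ ^ 2 / 2) * (Z a v * Z b v) = if a = b then D a else 0
  ne_zero : ∀ a, D a ≠ 0

namespace LocalDesign

theorem diag_zero (hD : LocalDesign L l h x β ζ Z D) (hq : 1 ≤ q) : D 0 = lambdaLim q L := by
  simpa [hD.limit_zero, integral_kernel_norm hq] using (hD.orthogonal 0 0).symm

variable [IsProbabilityMeasure μ] [l.IsCountablyGenerated]

theorem tendsto_gram (hD : LocalDesign L l h x β ζ Z D) (H : Localized l h x β x₀ β₀)
    (hX : IsRandomDesign μ f X) (hf : Continuous f) (hf_nonneg : ∀ y, 0 ≤ f y)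
    (hL : IsDirectionalKernel L) (hN : Tendsto (fun i => (N i : ℝ) * h i ^ q) l atTop) :
    Tendsto (fun z : ι × Ω => gram L X (N z.1) (h z.1) (x z.1) (ζ z.1) z.2) (probFilter μ l)
      (𝓝 (Matrix.diagonal fun a => f x₀ * D a)) := by
  refine tendsto_pi_nhds.2 fun a => tendsto_pi_nhds.2 fun b => ?_
  have hab := H.tendsto_kernelAvg hX hf hf_nonneg hL hN ((hD.limit a).mul (hD.limit b))
  rw [hD.orthogonal, mul_ite, mul_zero] at hab
  rw [Matrix.diagonal_apply]
  exact hab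

theorem eventually_det_gram_ne_zero (hD : LocalDesign L l h x β ζ Z D)
    (H : Localized l h x β x₀ β₀) (hX : IsRandomDesign μ f X) (hf : Continuous f)
    (hf_pos : ∀ y, 0 < f y) (hL : IsDirectionalKernel L)
    (hN : Tendsto (fun i => (N i : ℝ) * h i ^ q) l atTop) :
    ∀ᶠ z : ι × Ω in probFilter μ l,
      (gram L X (N z.1) (h z.1) (x z.1) (ζ z.1) z.2).det ≠ 0 := by
  have hdet := (continuous_id.matrix_det.tendsto _).comp
    (hD.tendsto_gram H hX hf (fun y => (hf_pos y).le) hL hN)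
  refine hdet.eventually_ne ?_
  simpa [Matrix.det_diagonal, Finset.prod_ne_zero_iff, (hf_pos x₀).ne'] using hD.ne_zero

theorem tendsto_gram_inv (hD : LocalDesign L l h x β ζ Z D) (H : Localized l h x β x₀ β₀)
    (hq : 1 ≤ q) (hX : IsRandomDesign μ f X) (hf : Continuous f) (hf_pos : ∀ y, 0 < f y)
    (hL : IsDirectionalKernel L) (hN : Tendsto (fun i => (N i : ℝ) * h i ^ q) l atTop)
    (a : Fin (d + 1)) :
    Tendsto (fun z : ι × Ω => (gram L X (N z.1) (h z.1) (x z.1) (ζ z.1) z.2)⁻¹ 0 a)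
      (probFilter μ l) (𝓝 (if 0 = a then (f x₀ * lambdaLim q L)⁻¹ else 0)) := by
  have hdiag : ∀ a, f x₀ * D a ≠ 0 := fun a => mul_ne_zero (hf_pos x₀).ne' (hD.ne_zero a)
  have hinv : (Matrix.diagonal fun a => f x₀ * D a)⁻¹ =
      Matrix.diagonal fun a => (f x₀ * D a)⁻¹ :=
    Matrix.inv_eq_right_inv (by
      simp only [Matrix.diagonal_mul_diagonal, mul_inv_cancel₀ (hdiag _), Matrix.diagonal_one])
  have hcont : ContinuousAt Inv.inv (Matrix.diagonal fun a => f x₀ * D a) :=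
    continuousAt_matrix_inv _ (by
      rw [Ring.inverse_eq_inv', Matrix.det_diagonal]
      exact continuousAt_inv₀ (Finset.prod_ne_zero_iff.2 fun a _ => hdiag a))
  have hlim := hcont.tendsto.comp (hD.tendsto_gram H hX hf (fun y => (hf_pos y).le) hL hN)
  have hrow := tendsto_pi_nhds.1 (tendsto_pi_nhds.1 hlim 0) a
  rwa [hinv, Matrix.diagonal_apply, hD.diag_zero hq] at hrow

theorem tendsto_sum_localWeight (hD : LocalDesign L l h x β ζ Z D) (H : Localized l h x β x₀ β₀)
    (hq : 1 ≤ q) (hX : IsRandomDesign μ f X) (hf : Continuous f) (hf_pos : ∀ y, 0 < f y)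
    (hL : IsDirectionalKernel L) (hN : Tendsto (fun i => (N i : ℝ) * h i ^ q) l atTop)
    {φ : ι → Sph q → ℝ} {Φ : Tan q → ℝ} (hφ : LocalLimit l h x β φ Φ) :
    Tendsto (fun z : ι × Ω => ∑ j, localWeight L X (N z.1) (h z.1) (x z.1) (ζ z.1) z.2 j *
      φ z.1 (X j z.2)) (probFilter μ l)
      (𝓝 ((lambdaLim q L)⁻¹ * ∫ v : Tan q, L (‖v‖ ^ 2 / 2) * Φ v)) := by
  have hlim := tendsto_finsetSum Finset.univ fun a _ =>
    (hD.tendsto_gram_inv H hq hX hf hf_pos hL hN a).mul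
      (H.tendsto_kernelAvg hX hf (fun y => (hf_pos y).le) hL hN ((hD.limit a).mul hφ))
  simp only [ite_mul, zero_mul, Finset.sum_ite_eq, Finset.mem_univ, if_true, hD.limit_zero,
    one_mul] at hlim
  have := (hf_pos x₀).ne'
  simp_rw [sum_localWeight_mul]
  convert hlim using 2
  field_simp

theorem tendsto_sum_localWeight_sq (hD : LocalDesign L l h x β ζ Z D)
    (H : Localized l h x β x₀ β₀) (hq : 1 ≤ q) (hX : IsRandomDesign μ f X) (hf : Continuous f)
    (hf_pos : ∀ y, 0 < f y) (hL : IsDirectionalKernel L)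
    (hN : Tendsto (fun i => (N i : ℝ) * h i ^ q) l atTop) {v : Sph q → ℝ} (hv : Continuous v) :
    Tendsto (fun z : ι × Ω => (N z.1 : ℝ) * h z.1 ^ q *
      ∑ j, localWeight L X (N z.1) (h z.1) (x z.1) (ζ z.1) z.2 j ^ 2 * v (X j z.2))
      (probFilter μ l)
      (𝓝 (lambdaLim q (fun r => L r ^ 2) * (lambdaLim q L ^ 2)⁻¹ / f x₀ * v x₀)) := by
  have hlim := tendsto_finsetSum Finset.univ fun a _ => tendsto_finsetSum Finset.univ fun b _ =>
    ((hD.tendsto_gram_inv H hq hX hf hf_pos hL hN a).mul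
      (hD.tendsto_gram_inv H hq hX hf hf_pos hL hN b)).mul
      (H.tendsto_kernelAvg hX hf (fun y => (hf_pos y).le) hL.sq hN
        (((hD.limit a).mul (hD.limit b)).mul (H.localLimit_continuous hv)))
  simp only [ite_mul, mul_ite, zero_mul, mul_zero, Finset.sum_ite_eq, Finset.mem_univ, if_true,
    hD.limit_zero, one_mul] at hlim
  rw [integral_mul_const, integral_kernel_norm hq fun r => L r ^ 2] at hlim
  have := (hf_pos x₀).ne'
  have := (lambdaLim_pos hq hL).ne'
  simp_rw [sum_localWeight_sq_mul]
  convert hlim using 2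
  field_simp

end LocalDesign

theorem integral_kernel_norm_sq_pos (hq : 1 ≤ q) (hL : IsDirectionalKernel L) :
    0 < ∫ v : Tan q, L (‖v‖ ^ 2 / 2) * ‖v‖ ^ 2 := by
  have hint : Integrable fun v : Tan q => L (‖v‖ ^ 2 / 2) * ‖v‖ ^ 2 :=
    integrable_kernel_norm_mul hL (by fun_prop) (C := 1) (k := 2) fun v => by
      rw [abs_of_nonneg (by positivity), one_mul]
      exact pow_le_pow_left₀ (norm_nonneg _) (by simp) 2
  have hcont : Continuous fun v : Tan q => L (‖v‖ ^ 2 / 2) * ‖v‖ ^ 2 :=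
    (continuous_kernel_norm hL).mul (by fun_prop)
  rw [integral_pos_iff_support_of_nonneg
    (fun v => mul_nonneg (hL.nonneg _ (by positivity)) (by positivity)) hint]
  refine hcont.isOpen_support.measure_pos _ ?_
  obtain ⟨r, hr, hLr⟩ := exists_kernel_pos hL
  refine ⟨EuclideanSpace.single ⟨0, hq⟩ (√(2 * r)), ?_⟩
  rw [Function.mem_support, PiLp.norm_single, Real.norm_of_nonneg (Real.sqrt_nonneg _),
    Real.sq_sqrt (by positivity), mul_div_cancel_left₀ _ two_ne_zero]
  positivity

theorem Localized.localDesign_const (H : Localized l h x β x₀ β₀) (hq : 1 ≤ q)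
    (hL : IsDirectionalKernel L) :
    LocalDesign (d := 0) L l h x β (fun _ _ _ => 1) (fun _ _ => 1) (fun _ => lambdaLim q L) where
  limit_zero _ := rfl
  limit _ := H.localLimit_continuous continuous_const
  orthogonal a b := by
    rw [if_pos (Subsingleton.elim (α := Fin 1) a b), ← integral_kernel_norm hq]
    simp
  ne_zero _ := (lambdaLim_pos hq hL).ne'

/-- The regression functions of the local linear estimator: the constant one and the tangential
coordinates, in units of the bandwidth. -/
def linDesign (h : ℝ) (x : Sph q) (β : Fin q → Amb q) : Fin (q + 1) → Sph q → ℝ :=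
  Fin.cons (fun _ => 1) fun k y => inner ℝ ((y : Amb q) - x) (β k) / h

theorem integral_kernel_coord (L : ℝ → ℝ) (k : Fin q) :
    ∫ v : Tan q, L (‖v‖ ^ 2 / 2) * v k = 0 := by
  have hneg := integral_neg_eq_self (fun v : Tan q => L (‖v‖ ^ 2 / 2) * v k) volume
  simp only [norm_neg, PiLp.neg_apply, mul_neg, integral_neg] at hneg
  linarith

theorem Localized.localDesign_lin (H : Localized l h x β x₀ β₀) (hq : 1 ≤ q)
    (hL : IsDirectionalKernel L) :
    LocalDesign L l h x β (fun i => linDesign (h i) (x i) (β i))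
      (Fin.cons (fun _ => 1) fun k v => v k)
      (Fin.cons (lambdaLim q L) fun _ => (∫ v : Tan q, L (‖v‖ ^ 2 / 2) * ‖v‖ ^ 2) / q) where
  limit_zero _ := rfl
  limit a := by
    cases a using Fin.cases with
    | zero => exact H.localLimit_continuous continuous_const
    | succ k => exact H.localLimit_coord k
  orthogonal a b := by
    cases a using Fin.cases with
    | zero =>
      cases b using Fin.cases with
      | zero => simp [integral_kernel_norm hq]
      | succ k => simpa [(Fin.succ_ne_zero k).symm] using integral_kernel_coord L k
    | succ j =>
      cases b using Fin.cases with
      | zero => simpa using integral_kernel_coord L j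
      | succ k =>
        simp only [Fin.cons_succ, Fin.succ_inj]
        split_ifs with hjk
        · rw [hjk, integral_kernel_coord_sq hL]
        · exact integral_kernel_coord_mul_of_ne L hjk
  ne_zero a := by
    cases a using Fin.cases with
    | zero => exact (lambdaLim_pos hq hL).ne'
    | succ k =>
      have hq_pos : (0 : ℝ) < q := by exact_mod_cast hq
      exact (div_pos (integral_kernel_norm_sq_pos hq hL) hq_pos).ne'

end LocalDesign

/-! ### Bias -/

section LinearPart

variable {q : ℕ} {g : Sph q → ℝ}

/-- The linear part of the first order expansion of `g` at `x`, see `remainder`. -/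
def linearPart (g : Sph q → ℝ) (x y : Sph q) : ℝ :=
  fderiv ℝ (radialExt g) (x : Amb q) ((y : Amb q) - x)

theorem measurable_linearPart (g : Sph q → ℝ) (x : Sph q) : Measurable (linearPart g x) := by
  unfold linearPart
  fun_prop

theorem exists_bound_linearPart (hg : ContDiffOn ℝ 1 (radialExt g) {0}ᶜ) :
    ∃ C : ℝ, 0 ≤ C ∧ ∀ x y, |linearPart g x y| ≤ C := by
  obtain ⟨C, hC_nonneg, hC⟩ := exists_bound_annulus fun z hz => continuousAt_fderiv_radialExt hg hz
  refine ⟨C * 2, by positivity, fun x y => ?_⟩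
  have hchord : ‖(y : Amb q) - x‖ ≤ 2 :=
    (norm_sub_le _ _).trans (by rw [norm_eq_of_mem_sphere, norm_eq_of_mem_sphere]; norm_num)
  exact ContinuousLinearMap.le_of_opNorm_le_of_le _ (hC x (by simp [norm_eq_of_mem_sphere])) hchord

namespace IsFrameAt

variable {x : Sph q} {β : Fin q → Amb q}

theorem linearPart_gnomonic (h : IsFrameAt x β) (hg : ContDiffOn ℝ 1 (radialExt g) {0}ᶜ)
    (u : Tan q) : linearPart g x (gnomonic x β u) =
      (√(1 + ‖u‖ ^ 2))⁻¹ * fderiv ℝ (radialExt g) (x : Amb q) (frameMap β u) := by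
  rw [linearPart, h.coe_gnomonic]
  simp only [map_sub, map_smul, map_add, smul_eq_mul,
    fderiv_radialExt_self hg (ne_zero_of_mem_unit_sphere x), zero_add, sub_zero]

theorem linearPart_eq_sum (h : IsFrameAt x β) (hg : ContDiffOn ℝ 1 (radialExt g) {0}ᶜ)
    (y : Sph q) : linearPart g x y = ∑ k, fderiv ℝ (radialExt g) (x : Amb q) (β k) *
      inner ℝ ((y : Amb q) - x) (β k) := by
  rw [linearPart, ← h.basis.sum_repr' ((y : Amb q) - x), map_sum, Fin.sum_univ_succ]
  simp only [map_smul, h.coe_basis, Fin.cons_zero, Fin.cons_succ, smul_eq_mul,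
    fderiv_radialExt_self hg (ne_zero_of_mem_unit_sphere x), mul_zero, zero_add]
  rw [← h.coe_basis, h.basis.sum_repr']
  exact Finset.sum_congr rfl fun k _ => by rw [mul_comm, real_inner_comm]

end IsFrameAt

end LinearPart

section FrameMoments

variable {q : ℕ} {L : ℝ → ℝ}

theorem integral_kernel_frameMap (hq : 1 ≤ q) (hL : IsDirectionalKernel L)
    (β : Fin q → Amb q) (A : Amb q →L[ℝ] Amb q →L[ℝ] ℝ) :
    ∫ v : Tan q, L (‖v‖ ^ 2 / 2) * A (frameMap β v) (frameMap β v) =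
      2 * bConst q L * lambdaLim q L / q * ∑ k, A (β k) (β k) := by
  have hexpand : ∀ v : Tan q, A (frameMap β v) (frameMap β v) =
      ∑ i, ∑ j, A (β i) (β j) * (v i * v j) := by
    intro v
    simp only [frameMap_apply, map_sum, map_smul, _root_.sum_apply, _root_.smul_apply,
      smul_eq_mul, Finset.mul_sum]
    rw [Finset.sum_comm]
    exact Finset.sum_congr rfl fun i _ => Finset.sum_congr rfl fun j _ => by ring
  simp_rw [hexpand, integral_kernel_bilin hq hL]

theorem integral_kernel_frameMap_mul (hq : 1 ≤ q) (hL : IsDirectionalKernel L)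
    (β : Fin q → Amb q) (A B : Amb q →L[ℝ] ℝ) :
    ∫ v : Tan q, L (‖v‖ ^ 2 / 2) * (A (frameMap β v) * B (frameMap β v)) =
      2 * bConst q L * lambdaLim q L / q * ∑ k, A (β k) * B (β k) := by
  simpa using integral_kernel_frameMap hq hL β (A.smulRight B)

end FrameMoments

/-- The centred linear part of the bias of the local constant estimator. It is the source of the
`O_P(h / √(n h^q))` term. -/
def linearNoise {q : ℕ} {Ω : Type*} (L : ℝ → ℝ) (X : ℕ → Ω → Sph q) (f m : Sph q → ℝ) (n : ℕ)
    (h : ℝ) (x : Sph q) (ω : Ω) : ℝ :=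
  (kernelAvg L X n h x (fun _ => 1) ω)⁻¹ *
    (kernelAvg L X n h x (linearPart m x) ω - kernelMean L f h x (linearPart m x))

section LocalWeights

variable {q d : ℕ} {Ω : Type*} {m : Sph q → ℝ} {X : ℕ → Ω → Sph q} {L : ℝ → ℝ} {n : ℕ} {h : ℝ}
  {x : Sph q} {ω : Ω}

theorem sum_localWeight_sub {ζ : Fin (d + 1) → Sph q → ℝ} (hdet : (gram L X n h x ζ ω).det ≠ 0)
    (hζ : ∀ y, ζ 0 y = 1) (m : Sph q → ℝ) :
    (∑ j, localWeight L X n h x ζ ω j * m (X j ω)) - m x =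
      (∑ j, localWeight L X n h x ζ ω j * remainder m x (X j ω)) +
        ∑ j, localWeight L X n h x ζ ω j * linearPart m x (X j ω) := by
  have hone := sum_localWeight_mul_self hdet 0
  simp only [hζ, mul_one, if_true] at hone
  calc _ = (∑ j, localWeight L X n h x ζ ω j * m (X j ω)) -
        (∑ j, localWeight L X n h x ζ ω j) * m x := by rw [hone, one_mul]
    _ = _ := by
      rw [Finset.sum_mul, ← Finset.sum_sub_distrib, ← Finset.sum_add_distrib]
      refine Finset.sum_congr rfl fun j _ => ?_
      rw [remainder, linearPart]
      ring

theorem IsFrameAt.sum_localWeight_linearPart {β : Fin q → Amb q} (hβ : IsFrameAt x β) (hh : h ≠ 0)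
    (hdet : (gram L X n h x (linDesign h x β) ω).det ≠ 0)
    (hm : ContDiffOn ℝ 1 (radialExt m) {0}ᶜ) :
    ∑ j, localWeight L X n h x (linDesign h x β) ω j * linearPart m x (X j ω) = 0 := by
  have hcoord : ∀ k : Fin q, ∑ j, localWeight L X n h x (linDesign h x β) ω j *
      inner ℝ ((X j ω : Amb q) - x) (β k) = 0 := by
    intro k
    have hk := sum_localWeight_mul_self hdet k.succ
    simp only [linDesign, Fin.cons_succ, Fin.succ_ne_zero, if_false, ← mul_div_assoc] at hk
    rwa [← Finset.sum_div, div_eq_zero_iff, or_iff_left hh] at hk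
  simp_rw [hβ.linearPart_eq_sum hm, Finset.mul_sum, mul_left_comm (localWeight _ _ _ _ _ _ _ _)]
  rw [Finset.sum_comm]
  simp_rw [← Finset.mul_sum, hcoord, mul_zero, Finset.sum_const_zero]

theorem sum_localWeight_const (hdet : (gram (d := 0) L X n h x (fun _ _ => 1) ω).det ≠ 0)
    (φ : Sph q → ℝ) : ∑ j, localWeight (d := 0) L X n h x (fun _ _ => 1) ω j * φ (X j ω) =
      (kernelAvg L X n h x (fun _ => 1) ω)⁻¹ * kernelAvg L X n h x φ ω := by
  have hone := sum_localWeight_mul_self hdet 0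
  rw [if_pos rfl, sum_localWeight_mul fun _ => 1] at hone
  rw [sum_localWeight_mul]
  simp only [Nat.reduceAdd, Finset.univ_unique, Finset.sum_singleton, Fin.default_eq_zero,
    one_mul] at hone ⊢
  rw [eq_inv_of_mul_eq_one_left hone]

end LocalWeights

section Localized

variable {q d : ℕ} {Ω : Type*} [MeasurableSpace Ω] {μ : Measure Ω}
  {f g m : Sph q → ℝ} {X : ℕ → Ω → Sph q} {ι : Type*} {l : Filter ι} {h : ι → ℝ} {x : ι → Sph q}
  {β : ι → Fin q → Amb q} {x₀ : Sph q} {β₀ : Fin q → Amb q} {L : ℝ → ℝ} {N : ι → ℕ}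
  {ζ : ι → Fin (d + 1) → Sph q → ℝ} {Z : Fin (d + 1) → Tan q → ℝ} {D : Fin (d + 1) → ℝ}

namespace Localized

theorem polyBounded_linearPart (H : Localized l h x β x₀ β₀)
    (hg : ContDiffOn ℝ 1 (radialExt g) {0}ᶜ) (k : ℕ) :
    PolyBounded l h fun i y => linearPart g (x i) y / h i ^ k := by
  obtain ⟨C, hC_nonneg, hC⟩ := exists_bound_linearPart hg
  refine ⟨C, k, hC_nonneg, Eventually.of_forall fun i y => ?_⟩
  have hh := pow_pos (H.h_pos i) k
  rw [abs_div, abs_of_pos hh, div_eq_mul_inv, inv_pow]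
  exact mul_le_mul_of_nonneg_right (hC _ _) (inv_nonneg.2 hh.le)

theorem localLimit_linearPart (H : Localized l h x β x₀ β₀)
    (hg : ContDiffOn ℝ 1 (radialExt g) {0}ᶜ) :
    LocalLimit l h x β (fun i y => linearPart g (x i) y / h i)
      (fun v => fderiv ℝ (radialExt g) (x₀ : Amb q) (frameMap β₀ v)) := by
  have hchart : ∀ i v, linearPart g (x i) (gnomonic (x i) (β i) (h i • v)) / h i =
      (√(1 + ‖h i • v‖ ^ 2))⁻¹ * fderiv ℝ (radialExt g) (x i : Amb q) (frameMap (β i) v) := by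
    intro i v
    have := (H.h_pos i).ne'
    rw [(H.frame i).linearPart_gnomonic hg, map_smul, map_smul, smul_eq_mul]
    field_simp
  refine ⟨fun i => (measurable_linearPart g (x i)).div_const _, ?_, ?_, fun v => ?_⟩
  · simpa only [pow_one] using H.polyBounded_linearPart hg 1
  · obtain ⟨C, hC_nonneg, hC⟩ :=
      exists_bound_annulus fun z hz => continuousAt_fderiv_radialExt hg hz
    refine ⟨C, 1, hC_nonneg, Eventually.of_forall fun i v _ => ?_⟩
    have hsqrt : (√(1 + ‖h i • v‖ ^ 2))⁻¹ ≤ 1 :=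
      inv_le_one_of_one_le₀ (Real.one_le_sqrt.2 (by simp))
    calc _ ≤ |fderiv ℝ (radialExt g) (x i : Amb q) (frameMap (β i) v)| := by
          rw [hchart, abs_mul, abs_of_pos (by positivity)]
          exact mul_le_of_le_one_left (abs_nonneg _) hsqrt
      _ ≤ C * ‖frameMap (β i) v‖ :=
        ContinuousLinearMap.le_of_opNorm_le _ (hC _ (by simp [norm_eq_of_mem_sphere])) _
      _ ≤ C * (1 + ‖v‖) ^ 1 := by
        rw [(H.frame i).norm_frameMap, pow_one]
        gcongr
        simp
  · simp_rw [hchart]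
    simpa using ((tendsto_sqrt_one_add_norm_smul_sq H.h_zero v).inv₀ one_ne_zero).mul
      (H.tendsto_fderiv hg H.tendsto_coe v)

theorem tendsto_trace_sphHessian (H : Localized l h x β x₀ β₀)
    (hg : ContDiffOn ℝ 2 (radialExt g) {0}ᶜ) :
    Tendsto (fun i => (sphHessian g (x i)).trace) l (𝓝 (sphHessian g x₀).trace) := by
  simp_rw [trace_sphHessian hg H.frame₀, fun i => trace_sphHessian hg (H.frame i)]
  have hsecond := (continuousAt_fderiv_fderiv_radialExt hg
    (ne_zero_of_mem_unit_sphere x₀)).tendsto.comp H.tendsto_coe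
  exact tendsto_finsetSum _ fun j _ =>
    tendsto_clm_apply (tendsto_clm_apply hsecond (H.tendsto_β j)) (H.tendsto_β j)

theorem tendsto_inner_sphGrad (H : Localized l h x β x₀ β₀)
    (hf : ContDiffOn ℝ 1 (radialExt f) {0}ᶜ) (hm : ContDiffOn ℝ 1 (radialExt m) {0}ᶜ) :
    Tendsto (fun i => inner ℝ (sphGrad f (x i)) (sphGrad m (x i))) l
      (𝓝 (inner ℝ (sphGrad f x₀) (sphGrad m x₀))) := by
  rw [inner_sphGrad_sphGrad hf H.frame₀]
  simp_rw [fun i => inner_sphGrad_sphGrad (m := m) hf (H.frame i)]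
  have hderiv : ∀ {g : Sph q → ℝ}, ContDiffOn ℝ 1 (radialExt g) {0}ᶜ → ∀ j,
      Tendsto (fun i => fderiv ℝ (radialExt g) (x i : Amb q) (β i j)) l
        (𝓝 (fderiv ℝ (radialExt g) (x₀ : Amb q) (β₀ j))) := fun hg j =>
    tendsto_clm_apply ((continuousAt_fderiv_radialExt hg
      (ne_zero_of_mem_unit_sphere x₀)).tendsto.comp H.tendsto_coe) (H.tendsto_β j)
  exact tendsto_finsetSum _ fun j _ => (hderiv hf j).mul (hderiv hm j)

theorem tendsto_biasTerm (H : Localized l h x β x₀ β₀)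
    (hf : ContDiffOn ℝ 1 (radialExt f) {0}ᶜ) (hm : ContDiffOn ℝ 2 (radialExt m) {0}ᶜ)
    (hf_pos : ∀ y, 0 < f y) (p : Fin 2) :
    Tendsto (fun i => biasTerm f m p (x i)) l (𝓝 (biasTerm f m p x₀)) := by
  have htrace := H.tendsto_trace_sphHessian hm
  have hdensity := ((continuous_of_contDiffOn_radialExt hf).tendsto x₀).comp H.tendsto_x
  have hgrad := H.tendsto_inner_sphGrad hf (hm.of_le one_le_two)
  fin_cases p
  · exact ((hgrad.const_mul 2).div hdensity (hf_pos x₀).ne').add htrace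
  · exact htrace

/- The linear part is odd in the gnomonic chart, so that only its product with the variation of the
density contributes: writing `f y = f x + (f y - f x)` makes the mean of order `h²` instead of
`h`. -/
theorem tendsto_kernelMean_linearPart [l.IsCountablyGenerated] (H : Localized l h x β x₀ β₀)
    (hq : 1 ≤ q) (hL : IsDirectionalKernel L) (hf : ContDiffOn ℝ 1 (radialExt f) {0}ᶜ)
    (hm : ContDiffOn ℝ 1 (radialExt m) {0}ᶜ) :
    Tendsto (fun i => kernelMean L f (h i) (x i) (linearPart m (x i)) / h i ^ 2) l
      (𝓝 (2 * bConst q L * lambdaLim q L / q * inner ℝ (sphGrad f x₀) (sphGrad m x₀))) := by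
  have hf_cont := continuous_of_contDiffOn_radialExt hf
  have hlinear_meas : ∀ i, Measurable fun y => linearPart m (x i) y / h i ^ 2 := fun i =>
    (measurable_linearPart m (x i)).div_const _
  have hlinear_far := H.polyBounded_linearPart hm 2
  have hprod := (H.localLimit_slope hf).mul (H.localLimit_linearPart hm)
  have hvariation := hprod.tendsto_integral hL H.h_pos H.h_zero H.frame
  have hodd := tendsto_integral_of_odd hL H.h_pos H.h_zero H.frame hlinear_meas hlinear_far
    fun i u => by
      rw [(H.frame i).linearPart_gnomonic hm, (H.frame i).linearPart_gnomonic hm, norm_neg,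
        map_neg, map_neg, mul_neg, neg_div]
  have hsum := hvariation.add (((hf_cont.tendsto x₀).comp H.tendsto_x).mul hodd)
  rw [mul_zero, add_zero, integral_kernel_frameMap_mul hq hL,
    ← inner_sphGrad_sphGrad hf H.frame₀] at hsum
  refine hsum.congr' ?_
  filter_upwards [eventually_integrable_rawKernel_mul (x := x) hL hprod.measurable hprod.far,
    eventually_integrable_rawKernel_mul (x := x) hL hlinear_meas hlinear_far] with i hi hi'
  have hh := (H.h_pos i).ne'
  rw [kernelMean, mul_div_assoc, Function.comp_apply, mul_left_comm, ← mul_add,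
    ← integral_const_mul, ← integral_add hi (hi'.const_mul _), ← integral_div]
  congr 2
  ext y
  field_simp
  ring

end Localized

variable [IsProbabilityMeasure μ] [l.IsCountablyGenerated]

theorem LocalDesign.tendsto_sum_remainder (hD : LocalDesign L l h x β ζ Z D)
    (H : Localized l h x β x₀ β₀) (hq : 1 ≤ q) (hX : IsRandomDesign μ f X) (hf : Continuous f)
    (hf_pos : ∀ y, 0 < f y) (hm : ContDiffOn ℝ 2 (radialExt m) {0}ᶜ)
    (hL : IsDirectionalKernel L) (hN : Tendsto (fun i => (N i : ℝ) * h i ^ q) l atTop) :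
    Tendsto (fun z : ι × Ω => (∑ j, localWeight L X (N z.1) (h z.1) (x z.1) (ζ z.1) z.2 j *
      remainder m (x z.1) (X j z.2)) / h z.1 ^ 2) (probFilter μ l)
      (𝓝 (bConst q L / q * (sphHessian m x₀).trace)) := by
  have hlim := hD.tendsto_sum_localWeight H hq hX hf hf_pos hL hN (H.localLimit_remainder hm)
  simp_rw [mul_div_assoc', integral_div, integral_kernel_frameMap hq hL,
    ← trace_sphHessian hm H.frame₀, ← Finset.sum_div] at hlim
  have := (lambdaLim_pos hq hL).ne'
  convert hlim using 2
  field_simp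

namespace Localized

theorem tendsto_bias_lin (H : Localized l h x β x₀ β₀) (hq : 1 ≤ q) (hX : IsRandomDesign μ f X)
    (hf : Continuous f) (hf_pos : ∀ y, 0 < f y) (hm : ContDiffOn ℝ 2 (radialExt m) {0}ᶜ)
    (hL : IsDirectionalKernel L) (hN : Tendsto (fun i => (N i : ℝ) * h i ^ q) l atTop) :
    Tendsto (fun z : ι × Ω => ((∑ j, localWeight L X (N z.1) (h z.1) (x z.1)
      (linDesign (h z.1) (x z.1) (β z.1)) z.2 j * m (X j z.2)) - m (x z.1)) / h z.1 ^ 2)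
      (probFilter μ l) (𝓝 (bConst q L / q * biasTerm f m 1 x₀)) := by
  have hD := H.localDesign_lin hq hL
  refine (hD.tendsto_sum_remainder H hq hX hf hf_pos hm hL hN).congr' ?_
  filter_upwards [hD.eventually_det_gram_ne_zero H hX hf hf_pos hL hN] with z hz
  rw [sum_localWeight_sub hz (fun _ => rfl), (H.frame z.1).sum_localWeight_linearPart
    (H.h_pos _).ne' hz (hm.of_le one_le_two), add_zero]

theorem tendsto_kernelAvg_one (H : Localized l h x β x₀ β₀) (hq : 1 ≤ q)
    (hX : IsRandomDesign μ f X) (hf : Continuous f) (hf_nonneg : ∀ y, 0 ≤ f y)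
    (hL : IsDirectionalKernel L) (hN : Tendsto (fun i => (N i : ℝ) * h i ^ q) l atTop) :
    Tendsto (fun z : ι × Ω => kernelAvg L X (N z.1) (h z.1) (x z.1) (fun _ => 1) z.2)
      (probFilter μ l) (𝓝 (f x₀ * lambdaLim q L)) := by
  simpa only [mul_one, integral_kernel_norm hq] using
    H.tendsto_kernelAvg hX hf hf_nonneg hL hN
      (H.localLimit_continuous (g := fun _ => 1) continuous_const)

theorem tendsto_bias_const (H : Localized l h x β x₀ β₀) (hq : 1 ≤ q) (hX : IsRandomDesign μ f X)
    (hf : ContDiffOn ℝ 1 (radialExt f) {0}ᶜ) (hf_pos : ∀ y, 0 < f y)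
    (hm : ContDiffOn ℝ 2 (radialExt m) {0}ᶜ) (hL : IsDirectionalKernel L)
    (hN : Tendsto (fun i => (N i : ℝ) * h i ^ q) l atTop) :
    Tendsto (fun z : ι × Ω => ((∑ j, localWeight (d := 0) L X (N z.1) (h z.1) (x z.1)
      (fun _ _ => 1) z.2 j * m (X j z.2)) - m (x z.1) -
      linearNoise L X f m (N z.1) (h z.1) (x z.1) z.2) / h z.1 ^ 2)
      (probFilter μ l) (𝓝 (bConst q L / q * biasTerm f m 0 x₀)) := by
  have hf_cont := continuous_of_contDiffOn_radialExt hf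
  have hD := H.localDesign_const hq hL
  have hremainder := hD.tendsto_sum_remainder H hq hX hf_cont hf_pos hm hL hN
  have hmass := H.tendsto_kernelAvg_one hq hX hf_cont (fun y => (hf_pos y).le) hL hN
  have hlambda := (lambdaLim_pos hq hL).ne'
  have hf₀ := (hf_pos x₀).ne'
  have hlinear := (hmass.inv₀ (mul_ne_zero hf₀ hlambda)).mul
    ((H.tendsto_kernelMean_linearPart hq hL hf (hm.of_le one_le_two)).comp
      (tendsto_fst_probFilter (μ := μ)))
  have hlim : (f x₀ * lambdaLim q L)⁻¹ *
      (2 * bConst q L * lambdaLim q L / q * inner ℝ (sphGrad f x₀) (sphGrad m x₀)) =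
      bConst q L / q * (2 * inner ℝ (sphGrad f x₀) (sphGrad m x₀) / f x₀) := by
    field_simp
  have hsum := hlinear.add hremainder
  rw [hlim, ← mul_add] at hsum
  refine hsum.congr' ?_
  filter_upwards [hD.eventually_det_gram_ne_zero H hX hf_cont hf_pos hL hN] with z hz
  rw [sum_localWeight_sub hz (fun _ => rfl), sum_localWeight_const hz (linearPart m (x z.1)),
    Function.comp_apply, linearNoise]
  ring

end Localized

end Localized

theorem kernelAvg_div_const {q : ℕ} {Ω : Type*} (L : ℝ → ℝ) (X : ℕ → Ω → Sph q) (n : ℕ) (h : ℝ)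
    (x : Sph q) (φ : Sph q → ℝ) (c : ℝ) (ω : Ω) :
    kernelAvg L X n h x (fun y => φ y / c) ω = kernelAvg L X n h x φ ω / c := by
  simp only [kernelAvg, ← mul_div_assoc, ← Finset.sum_div]

theorem kernelMean_div_const {q : ℕ} (L : ℝ → ℝ) (f : Sph q → ℝ) (h : ℝ) (x : Sph q)
    (φ : Sph q → ℝ) (c : ℝ) :
    kernelMean L f h x (fun y => φ y / c) = kernelMean L f h x φ / c := by
  simp only [kernelMean, ← mul_div_assoc, div_mul_eq_mul_div, integral_div]

section LinearNoise

variable {q : ℕ} {Ω : Type*} [MeasurableSpace Ω] {μ : Measure Ω} [IsProbabilityMeasure μ]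
  {f m : Sph q → ℝ} {X : ℕ → Ω → Sph q} {ι : Type*} {l : Filter ι} [l.IsCountablyGenerated]
  {h : ι → ℝ} {x : ι → Sph q} {β : ι → Fin q → Amb q} {x₀ : Sph q} {β₀ : Fin q → Amb q}
  {L : ℝ → ℝ} {N : ι → ℕ} {φ : ι → Sph q → ℝ} {Φ : Tan q → ℝ}

namespace Localized

theorem bddInProb_kernelAvg_sub_kernelMean (H : Localized l h x β x₀ β₀)
    (hX : IsRandomDesign μ f X) (hf : Continuous f) (hf_nonneg : ∀ y, 0 ≤ f y)
    (hL : IsDirectionalKernel L) (hN : Tendsto (fun i => (N i : ℝ) * h i ^ q) l atTop)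
    (hφ : LocalLimit l h x β φ Φ) :
    BddInProb μ l fun i ω => √((N i : ℝ) * h i ^ q) *
      (kernelAvg L X (N i) (h i) (x i) (φ i) ω - kernelMean L f (h i) (x i) (φ i)) := by
  have hbdd := hφ.far.eventually_bound
  have hN_ne := eventually_ne_zero_of_tendsto_mul_atTop hN
  have hsecond := H.tendsto_kernelMean hf hL.sq (hφ.mul hφ)
  refine (bddInProb_sub_integral
    (A := fun i ω => √((N i : ℝ) * h i ^ q) * kernelAvg L X (N i) (h i) (x i) (φ i) ω)
    (V := f x₀ * (∫ v : Tan q, L (‖v‖ ^ 2 / 2) ^ 2 * (Φ v * Φ v)) + 1) ?_ ?_).congr ?_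
  · filter_upwards [hbdd] with i ⟨C, hC⟩
    exact (hX.memLp_kernelAvg hL _ _ _ (hφ.measurable i) hC).const_mul _
  · filter_upwards [hbdd, hN_ne, hN.eventually_gt_atTop 0,
      hsecond.eventually_le_const (lt_add_one _)] with i ⟨C, hC⟩ hi hNh hle
    calc variance (fun ω => √((N i : ℝ) * h i ^ q) * kernelAvg L X (N i) (h i) (x i) (φ i) ω) μ
        = ((N i : ℝ) * h i ^ q) * variance (kernelAvg L X (N i) (h i) (x i) (φ i)) μ := by
          rw [variance_const_mul, Real.sq_sqrt hNh.le]
      _ ≤ ((N i : ℝ) * h i ^ q) * (((N i : ℝ) * h i ^ q)⁻¹ *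
            kernelMean (fun r => L r ^ 2) f (h i) (x i) (fun y => φ i y * φ i y)) := by
          gcongr
          exact hX.variance_kernelAvg_le hf.measurable hf_nonneg hL hi (H.h_pos i).ne' _
            (hφ.measurable i) hC
      _ ≤ _ := by rwa [mul_inv_cancel_left₀ hNh.ne']
  · filter_upwards [hbdd, hN_ne] with i ⟨C, hC⟩ hi
    ext ω
    rw [integral_const_mul, mul_sub, hX.integral_kernelAvg hf.measurable hf_nonneg hL hi _ _
      (hφ.measurable i) hC]

theorem bddInProb_linearNoise (H : Localized l h x β x₀ β₀) (hq : 1 ≤ q)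
    (hX : IsRandomDesign μ f X) (hf : Continuous f) (hf_pos : ∀ y, 0 < f y)
    (hm : ContDiffOn ℝ 1 (radialExt m) {0}ᶜ) (hL : IsDirectionalKernel L)
    (hN : Tendsto (fun i => (N i : ℝ) * h i ^ q) l atTop) :
    BddInProb μ l fun i ω =>
      linearNoise L X f m (N i) (h i) (x i) ω / (h i / √((N i : ℝ) * h i ^ q)) := by
  have hf_nonneg : ∀ y, 0 ≤ f y := fun y => (hf_pos y).le
  have hcentred := H.bddInProb_kernelAvg_sub_kernelMean hX hf hf_nonneg hL hN
    (H.localLimit_linearPart hm)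
  have hmass := (H.tendsto_kernelAvg_one hq hX hf hf_nonneg hL hN).inv₀
    (mul_pos (hf_pos x₀) (lambdaLim_pos hq hL)).ne'
  refine (hcentred.mul_tendsto
    (B := fun i ω => (kernelAvg L X (N i) (h i) (x i) (fun _ => 1) ω)⁻¹) hmass).congr
    (Eventually.of_forall fun i => funext fun ω => ?_)
  rw [kernelAvg_div_const, kernelMean_div_const, linearNoise, ← sub_div, ← mul_div_assoc,
    div_div_eq_mul_div]
  ring

end Localized

end LinearNoise

/-! ### The projected local estimators -/

section ProjWeight

variable {q n : ℕ}

/-- The weight of the `j`-th response in the projected local estimator. -/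
def projWeight (L : ℝ → ℝ) (b : Sph q → Fin q → Amb q) (h : ℝ) (p : Fin 2) (x : Sph q)
    (xs : Fin n → Sph q) (j : Fin n) : ℝ :=
  match p with
  | 0 => wlsWeight (designZero n) (fun i => kernelH L h x (xs i)) j
  | 1 => wlsWeight (designOne b x xs) (fun i => kernelH L h x (xs i)) j

theorem projLocalEst_eq_sum (L : ℝ → ℝ) (b : Sph q → Fin q → Amb q) (h : ℝ) (p : Fin 2) (x : Sph q)
    (xs : Fin n → Sph q) (ys : Fin n → ℝ) :
    projLocalEst L b h p x xs ys = ∑ j, projWeight L b h p x xs j * ys j := by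
  fin_cases p <;> exact wlsIntercept_eq_sum _ _ _

theorem measurable_projWeight {L : ℝ → ℝ} (hL : IsDirectionalKernel L) (b : Sph q → Fin q → Amb q)
    (h : ℝ) (p : Fin 2) (x : Sph q) :
    Measurable fun xs : Fin n → Sph q => projWeight L b h p x xs := by
  have hkernel : ∀ i : Fin n, Measurable fun xs : Fin n → Sph q => kernelH L h x (xs i) := fun i =>
    ((continuous_rawKernel hL h x).measurable.const_mul (lambdaH q h L * h ^ q)⁻¹).comp
      (measurable_pi_apply i)
  refine measurable_pi_lambda _ fun j => ?_
  fin_cases p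
  · exact measurable_wlsWeight (D := fun _ => designZero n) (fun _ _ => measurable_const) hkernel j
  · refine measurable_wlsWeight (D := designOne b x) (fun i a => ?_) hkernel j
    induction a using Fin.cases with
    | zero => exact measurable_const
    | succ k =>
      simp only [designOne, Matrix.of_apply, Fin.cons_succ]
      fun_prop

variable {Ω : Type*} {X : ℕ → Ω → Sph q} {L : ℝ → ℝ} {h : ℝ}

theorem wlsWeight_kernelH {d : ℕ} (D : Matrix (Fin n) (Fin (d + 1)) ℝ)
    (hlambda : lambdaH q h L ≠ 0) (hh : h ≠ 0) (hn : n ≠ 0) (x : Sph q) (ω : Ω) :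
    wlsWeight D (fun j => kernelH L h x (X j ω)) =
      wlsWeight D (((n : ℝ) * h ^ q)⁻¹ • fun j : Fin n => rawKernel L h x (X j ω)) := by
  have : (n : ℝ) ≠ 0 := Nat.cast_ne_zero.2 hn
  rw [wlsWeight_smul D (by positivity)]
  exact wlsWeight_smul D (c := (lambdaH q h L * h ^ q)⁻¹) (by positivity)
    fun j : Fin n => rawKernel L h x (X j ω)

theorem projWeight_zero (hlambda : lambdaH q h L ≠ 0) (hh : h ≠ 0) (hn : n ≠ 0)
    (b : Sph q → Fin q → Amb q) (x : Sph q) (ω : Ω) :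
    projWeight L b h 0 x (fun i : Fin n => X i ω) =
      localWeight (d := 0) L X n h x (fun _ _ => 1) ω :=
  wlsWeight_kernelH (designZero n) hlambda hh hn x ω

theorem projWeight_one (hlambda : lambdaH q h L ≠ 0) (hh : h ≠ 0) (hn : n ≠ 0)
    (b : Sph q → Fin q → Amb q) (x : Sph q) (ω : Ω) :
    projWeight L b h 1 x (fun i : Fin n => X i ω) =
      localWeight L X n h x (linDesign h x (b x)) ω := by
  have hdesign : designOne b x (fun i : Fin n => X i ω) =
      (Matrix.of fun (j : Fin n) a => linDesign h x (b x) a (X j ω)) *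
        Matrix.diagonal (Fin.cons 1 fun _ => h : Fin (q + 1) → ℝ) := by
    ext j a
    rw [Matrix.mul_diagonal]
    induction a using Fin.cases with
    | zero => simp [designOne, linDesign]
    | succ k => simp [designOne, linDesign, hh]
  have hscale : ∀ a : Fin (q + 1), (Fin.cons 1 fun _ => h : Fin (q + 1) → ℝ) a ≠ 0 :=
    Fin.cases one_ne_zero fun _ => hh
  calc projWeight L b h 1 x (fun i : Fin n => X i ω)
      = wlsWeight (designOne b x fun i : Fin n => X i ω)
          (((n : ℝ) * h ^ q)⁻¹ • fun j : Fin n => rawKernel L h x (X j ω)) :=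
        wlsWeight_kernelH _ hlambda hh hn x ω
    _ = localWeight L X n h x (linDesign h x (b x)) ω := by
        rw [hdesign, wlsWeight_mul_diagonal _ hscale rfl]
        rfl

end ProjWeight

theorem IsTangentFrame.localized {q : ℕ} {b : Sph q → Fin q → Amb q} (hb : IsTangentFrame b)
    {h : ℕ → ℝ} (h_pos : ∀ n, 0 < h n) (h_zero : Tendsto h atTop (𝓝 0)) (P : FrameSpace q) :
    Localized ((atTop ×ˢ ⊤) ⊓ comap (fun i : ℕ × Sph q => hb.frameSpace i.2) (𝓝 P))
      (fun i => h i.1) (fun i => i.2) (fun i => b i.2) P.1.1 (fun j => (P.1.2 j : Amb q)) := by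
  have hframe : Tendsto (fun i : ℕ × Sph q => (hb.frameSpace i.2).1)
      ((atTop ×ˢ ⊤) ⊓ comap (fun i : ℕ × Sph q => hb.frameSpace i.2) (𝓝 P)) (𝓝 P.1) :=
    (continuous_subtype_val.tendsto P).comp (tendsto_comap.mono_left inf_le_right)
  have hcoord : ∀ j, Continuous fun P : Sph q × (Fin q → Sph q) => (P.2 j : Amb q) := by fun_prop
  exact
    { h_pos := fun i => h_pos i.1
      h_zero := h_zero.comp (tendsto_fst.mono_left inf_le_left)
      frame := fun i => hb i.2
      frame₀ := P.2
      tendsto_x := (continuous_fst.tendsto P.1).comp hframe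
      tendsto_β := fun j => ((hcoord j).tendsto P.1).comp hframe }

section Localized

variable {q : ℕ} {Ω : Type*} {f m v : Sph q → ℝ}
  {X : ℕ → Ω → Sph q} {L : ℝ → ℝ} {ι : Type*} {l : Filter ι} {h : ι → ℝ}
  {x : ι → Sph q} {b : Sph q → Fin q → Amb q} {x₀ : Sph q} {β₀ : Fin q → Amb q} {N : ι → ℕ}

namespace Localized

theorem eventually_projWeight (H : Localized l h x (fun i => b (x i)) x₀ β₀) (hq : 1 ≤ q)
    (hL : IsDirectionalKernel L) (hN : Tendsto (fun i => (N i : ℝ) * h i ^ q) l atTop) :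
    ∀ᶠ i in l, ∀ ω : Ω,
      projWeight L b (h i) 0 (x i) (fun j : Fin (N i) => X j ω) =
        localWeight (d := 0) L X (N i) (h i) (x i) (fun _ _ => 1) ω ∧
      projWeight L b (h i) 1 (x i) (fun j : Fin (N i) => X j ω) =
        localWeight L X (N i) (h i) (x i) (linDesign (h i) (x i) (b (x i))) ω := by
  have h_zero : Tendsto h l (𝓝[>] 0) :=
    tendsto_nhdsWithin_iff.2 ⟨H.h_zero, Eventually.of_forall H.h_pos⟩
  filter_upwards [h_zero.eventually (eventually_lambdaH_pos hq hL),
    eventually_ne_zero_of_tendsto_mul_atTop hN] with i hlambda hn ω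
  exact ⟨projWeight_zero hlambda.ne' (H.h_pos i).ne' hn b _ ω,
    projWeight_one hlambda.ne' (H.h_pos i).ne' hn b _ ω⟩

variable [MeasurableSpace Ω] {μ : Measure Ω} [IsProbabilityMeasure μ] [l.IsCountablyGenerated]

theorem tendsto_projWeight_sq (H : Localized l h x (fun i => b (x i)) x₀ β₀) (hq : 1 ≤ q)
    (hX : IsRandomDesign μ f X) (hf : Continuous f) (hf_pos : ∀ y, 0 < f y) (hv : Continuous v)
    (hL : IsDirectionalKernel L) (hN : Tendsto (fun i => (N i : ℝ) * h i ^ q) l atTop)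
    (p : Fin 2) :
    Tendsto (fun z : ι × Ω => (N z.1 : ℝ) * h z.1 ^ q *
      ∑ j, projWeight L b (h z.1) p (x z.1) (fun j : Fin (N z.1) => X j z.2) j ^ 2 * v (X j z.2))
      (probFilter μ l)
      (𝓝 (lambdaLim q (fun r => L r ^ 2) * (lambdaLim q L ^ 2)⁻¹ / f x₀ * v x₀)) := by
  have hweight := tendsto_fst_probFilter (μ := μ) |>.eventually
    (H.eventually_projWeight (X := X) hq hL hN)
  fin_cases p
  · refine ((H.localDesign_const hq hL).tendsto_sum_localWeight_sq H hq hX hf hf_pos hL hN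
      hv).congr' ?_
    filter_upwards [hweight] with z hz
    rw [← (hz z.2).1]
    rfl
  · refine ((H.localDesign_lin hq hL).tendsto_sum_localWeight_sq H hq hX hf hf_pos hL hN
      hv).congr' ?_
    filter_upwards [hweight] with z hz
    rw [← (hz z.2).2]
    rfl

theorem tendsto_projWeight_bias (H : Localized l h x (fun i => b (x i)) x₀ β₀) (hq : 1 ≤ q)
    (hX : IsRandomDesign μ f X) (hf : ContDiffOn ℝ 1 (radialExt f) {0}ᶜ) (hf_pos : ∀ y, 0 < f y)
    (hm : ContDiffOn ℝ 2 (radialExt m) {0}ᶜ) (hL : IsDirectionalKernel L)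
    (hN : Tendsto (fun i => (N i : ℝ) * h i ^ q) l atTop) (p : Fin 2) :
    Tendsto (fun z : ι × Ω =>
      ((∑ j, projWeight L b (h z.1) p (x z.1) (fun j : Fin (N z.1) => X j z.2) j * m (X j z.2)) -
        m (x z.1) - if p = 0 then linearNoise L X f m (N z.1) (h z.1) (x z.1) z.2 else 0) /
          h z.1 ^ 2)
      (probFilter μ l) (𝓝 (bConst q L / q * biasTerm f m p x₀)) := by
  have hweight := tendsto_fst_probFilter (μ := μ) |>.eventually
    (H.eventually_projWeight (X := X) hq hL hN)
  fin_cases p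
  · refine (H.tendsto_bias_const hq hX hf hf_pos hm hL hN).congr' ?_
    filter_upwards [hweight] with z hz
    rw [← (hz z.2).1]
    rfl
  · refine (H.tendsto_bias_lin hq hX (continuous_of_contDiffOn_radialExt hf) hf_pos hm hL
      hN).congr' ?_
    filter_upwards [hweight] with z hz
    rw [← (hz z.2).2]
    simp

end Localized

end Localized

section UniformExpansion

variable {q : ℕ} {Ω : Type*} [MeasurableSpace Ω] {μ : Measure Ω} [IsProbabilityMeasure μ]
  {f m v : Sph q → ℝ} {X : ℕ → Ω → Sph q} {Y : ℕ → Ω → ℝ} {L : ℝ → ℝ} {h : ℕ → ℝ}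
  {b : Sph q → Fin q → Amb q}

theorem tendsto_mul_pow_of_le_prod {l : Filter (ℕ × Sph q)} (hl : l ≤ atTop ×ˢ ⊤)
    (h_inf : Tendsto (fun n : ℕ => (n : ℝ) * h n ^ q) atTop atTop) :
    Tendsto (fun i : ℕ × Sph q => (i.1 : ℝ) * h i.1 ^ q) l atTop :=
  h_inf.comp (tendsto_fst.mono_left hl)

theorem unifBigOP_linearNoise (hq : 1 ≤ q) (hX : IsRandomDesign μ f X) (hf : Continuous f)
    (hf_pos : ∀ y, 0 < f y) (hm : ContDiffOn ℝ 1 (radialExt m) {0}ᶜ) (hL : IsDirectionalKernel L)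
    (h_pos : ∀ n, 0 < h n) (h_zero : Tendsto h atTop (𝓝 0))
    (h_inf : Tendsto (fun n : ℕ => (n : ℝ) * h n ^ q) atTop atTop) (hb : IsTangentFrame b) :
    UnifBigOP μ (fun n x ω => linearNoise L X f m n (h n) x ω)
      (fun n => h n / √((n : ℝ) * h n ^ q)) := by
  refine unifBigOP_of_inf_comap ?_ (fun i => hb.frameSpace i.2) fun P => ?_
  · filter_upwards [h_inf.eventually_gt_atTop 0] with n hn
    exact div_pos (h_pos n) (Real.sqrt_pos.2 hn)
  · exact (hb.localized h_pos h_zero P).bddInProb_linearNoise hq hX hf hf_pos hm hL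
      (tendsto_mul_pow_of_le_prod inf_le_left h_inf)

theorem unifLittleOP_condMean (hq : 1 ≤ q) (hs : IsMeanVarianceSample μ f m v X Y)
    (hf : ContDiffOn ℝ 1 (radialExt f) {0}ᶜ) (hf_pos : ∀ y, 0 < f y)
    (hm : ContDiffOn ℝ 2 (radialExt m) {0}ᶜ) (hL : IsDirectionalKernel L)
    (h_pos : ∀ n, 0 < h n) (h_zero : Tendsto h atTop (𝓝 0))
    (h_inf : Tendsto (fun n : ℕ => (n : ℝ) * h n ^ q) atTop atTop) (hb : IsTangentFrame b)
    (p : Fin 2) :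
    UnifLittleOP μ (fun n x ω => condMean μ (fun ω' => projLocalEst L b (h n) p x
        (fun i : Fin n => X i ω') (fun i => Y i ω') - m x) (fun ω' (i : Fin n) => X i ω') ω -
      bConst q L / q * biasTerm f m p x * h n ^ 2 -
      if p = 0 then linearNoise L X f m n (h n) x ω else 0) (fun n => h n ^ 2) := by
  have hm_meas := (continuous_of_contDiffOn_radialExt (hm.of_le one_le_two)).measurable
  refine unifLittleOP_of_inf_comap (Eventually.of_forall fun n => pow_pos (h_pos n) 2)
    (fun i => hb.frameSpace i.2) fun P => ?_
  have H := hb.localized h_pos h_zero P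
  have hbias := (H.tendsto_projWeight_bias hq hs.isRandomDesign hf hf_pos hm hL
    (tendsto_mul_pow_of_le_prod inf_le_left h_inf) p).sub
    (((H.tendsto_biasTerm hf hm hf_pos p).const_mul (bConst q L / q)).comp
      (tendsto_fst_probFilter (μ := μ)))
  rw [sub_self] at hbias
  refine hbias.congr' ?_
  filter_upwards [eventually_probFilter_of_ae fun i : ℕ × Sph q => hs.ae_condMean_condVariance
    hm_meas (measurable_projWeight (n := i.1) hL b (h i.1) p i.2) (m i.2)] with z hz
  have := (h_pos z.1.1).ne'
  simp_rw [projLocalEst_eq_sum, Function.comp_apply]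
  rw [hz.1]
  field_simp
  ring

theorem unifLittleOP_condVariance (hq : 1 ≤ q) (hs : IsMeanVarianceSample μ f m v X Y)
    (hf : Continuous f) (hf_pos : ∀ y, 0 < f y) (hm : Measurable m) (hv : Continuous v)
    (hL : IsDirectionalKernel L) (h_pos : ∀ n, 0 < h n) (h_zero : Tendsto h atTop (𝓝 0))
    (h_inf : Tendsto (fun n : ℕ => (n : ℝ) * h n ^ q) atTop atTop) (hb : IsTangentFrame b)
    (p : Fin 2) :
    UnifLittleOP μ (fun n x ω => condVariance μ (fun ω' => projLocalEst L b (h n) p x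
        (fun i : Fin n => X i ω') (fun i => Y i ω')) (fun ω' (i : Fin n) => X i ω') ω -
      lambdaLim q (fun r => L r ^ 2) * (lambdaLim q L ^ 2)⁻¹ / ((n : ℝ) * h n ^ q * f x) * v x)
      (fun n => ((n : ℝ) * h n ^ q)⁻¹) := by
  refine unifLittleOP_of_inf_comap ?_ (fun i => hb.frameSpace i.2) fun P => ?_
  · filter_upwards [h_inf.eventually_gt_atTop 0] with n hn using inv_pos.2 hn
  have H := hb.localized h_pos h_zero P
  have hN := tendsto_mul_pow_of_le_prod
    (l := (atTop ×ˢ ⊤) ⊓ comap (fun i : ℕ × Sph q => hb.frameSpace i.2) (𝓝 P)) inf_le_left h_inf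
  have hmain : Continuous fun y =>
      lambdaLim q (fun r => L r ^ 2) * (lambdaLim q L ^ 2)⁻¹ / f y * v y :=
    (continuous_const.div hf fun y => (hf_pos y).ne').mul hv
  have hvar := (H.tendsto_projWeight_sq hq hs.isRandomDesign hf hf_pos hv hL hN p).sub
    (((hmain.tendsto _).comp H.tendsto_x).comp (tendsto_fst_probFilter (μ := μ)))
  rw [sub_self] at hvar
  refine hvar.congr' ?_
  filter_upwards [eventually_probFilter_of_ae fun i : ℕ × Sph q => hs.ae_condMean_condVariance
      hm (measurable_projWeight (n := i.1) hL b (h i.1) p i.2) (m i.2),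
    (tendsto_fst_probFilter (μ := μ)).eventually (hN.eventually_gt_atTop 0)] with z hz hz'
  simp_rw [projLocalEst_eq_sum, Function.comp_apply]
  rw [hz.2, div_inv_eq_mul, sub_mul, mul_comm (Finset.sum _ _)]
  have := hz'.ne'
  congr 1
  generalize (z.1.1 : ℝ) * h z.1.1 ^ q = u at this ⊢
  field_simp

end UniformExpansion

end ProjLocal

end

theorem theorem1_general {q : ℕ} (hq : 1 ≤ q) {Ω : Type*} [MeasurableSpace Ω]
    (μ : Measure Ω) [IsProbabilityMeasure μ]
    (f m v : Sph q → ℝ) (X : ℕ → Ω → Sph q) (Y : ℕ → Ω → ℝ)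
    (hsample : IsMeanVarianceSample μ f m v X Y)
    (hm : ContDiffOn ℝ 2 (radialExt m) {0}ᶜ)
    (hf : ContDiffOn ℝ 1 (radialExt f) {0}ᶜ)
    (hf_pos : ∀ x, 0 < f x) (hv : Continuous v)
    (L : ℝ → ℝ) (hL : IsDirectionalKernel L)
    (h : ℕ → ℝ) (h_pos : ∀ n, 0 < h n) (h_zero : Tendsto h atTop (𝓝 0))
    (h_inf : Tendsto (fun n : ℕ => (n : ℝ) * h n ^ q) atTop atTop)
    (b : Sph q → Fin q → EuclideanSpace ℝ (Fin (q + 1))) (hb : IsTangentFrame b)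
    (p : Fin 2) :
    (∃ R T : ℕ → Sph q → Ω → ℝ,
      UnifLittleOP μ R (fun n => h n ^ 2) ∧
      UnifBigOP μ T (fun n => h n / √((n : ℝ) * h n ^ q)) ∧
      ∀ n x ω,
        condMean μ
            (fun ω' => projLocalEst L b (h n) p x (fun i : Fin n => X i ω') (fun i => Y i ω') - m x)
            (fun ω' (i : Fin n) => X i ω') ω
          = bConst q L / q * biasTerm f m p x * h n ^ 2 + R n x ω
            + (if p = 0 then T n x ω else 0)) ∧
    UnifLittleOP μ
      (fun n x ω =>
        condVariance μ
            (fun ω' => projLocalEst L b (h n) p x (fun i : Fin n => X i ω') (fun i => Y i ω'))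
            (fun ω' (i : Fin n) => X i ω') ω
          - lambdaLim q (fun r => L r ^ 2) * (lambdaLim q L ^ 2)⁻¹ / ((n : ℝ) * h n ^ q * f x)
            * v x)
      (fun n => ((n : ℝ) * h n ^ q)⁻¹) := by
  have hf_cont := continuous_of_contDiffOn_radialExt hf
  have hm_meas := (continuous_of_contDiffOn_radialExt (hm.of_le one_le_two)).measurable
  refine ⟨⟨_, fun n x ω => linearNoise L X f m n (h n) x ω,
    unifLittleOP_condMean hq hsample hf hf_pos hm hL h_pos h_zero h_inf hb p,
    unifBigOP_linearNoise hq hsample.isRandomDesign hf_cont hf_pos (hm.of_le one_le_two) hL h_pos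
      h_zero h_inf hb,
    fun n x ω => by ring⟩,
    unifLittleOP_condVariance hq hsample hf_cont hf_pos hm_meas hv hL h_pos h_zero h_inf hb p⟩

theorem theorem1 {q : ℕ} (hq : 1 ≤ q) {Ω : Type*} [MeasurableSpace Ω]
    (μ : Measure Ω) [IsProbabilityMeasure μ]
    (f m σ : Sph q → ℝ) (X : ℕ → Ω → Sph q) (Y ε : ℕ → Ω → ℝ)
    (hsample : IsRegressionSample μ f m σ X Y ε)
    (hm : ContDiffOn ℝ 3 (radialExt m) {0}ᶜ)
    (hf : ContDiffOn ℝ 2 (radialExt f) {0}ᶜ)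
    (hf_pos : ∃ c : ℝ, 0 < c ∧ ∀ x, c ≤ f x)
    (hσ : UniformContinuous fun x => σ x ^ 2)
    (hσ_pos : ∃ c : ℝ, 0 < c ∧ ∀ x, c ≤ σ x ^ 2)
    (L : ℝ → ℝ) (hL : IsDirectionalKernel L)
    (h : ℕ → ℝ) (h_pos : ∀ n, 0 < h n) (h_zero : Tendsto h atTop (𝓝 0))
    (h_inf : Tendsto (fun n : ℕ => (n : ℝ) * h n ^ q) atTop atTop)
    (b : Sph q → Fin q → EuclideanSpace ℝ (Fin (q + 1))) (hb : IsTangentFrame b)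
    (p : Fin 2) :
    (∃ R T : ℕ → Sph q → Ω → ℝ,
      UnifLittleOP μ R (fun n => h n ^ 2) ∧
      UnifBigOP μ T (fun n => h n / √((n : ℝ) * h n ^ q)) ∧
      ∀ n x ω,
        condMean μ
            (fun ω' => projLocalEst L b (h n) p x (fun i : Fin n => X i ω') (fun i => Y i ω') - m x)
            (fun ω' (i : Fin n) => X i ω') ω
          = bConst q L / q * biasTerm f m p x * h n ^ 2 + R n x ω
            + (if p = 0 then T n x ω else 0)) ∧
    UnifLittleOP μ
      (fun n x ω =>
        condVariance μ
            (fun ω' => projLocalEst L b (h n) p x (fun i : Fin n => X i ω') (fun i => Y i ω'))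
            (fun ω' (i : Fin n) => X i ω') ω
          - lambdaLim q (fun r => L r ^ 2) * (lambdaLim q L ^ 2)⁻¹ / ((n : ℝ) * h n ^ q * f x)
            * σ x ^ 2)
      (fun n => ((n : ℝ) * h n ^ q)⁻¹) :=
  theorem1_general hq μ f m (fun x => σ x ^ 2) X Y (hsample.isMeanVarianceSample hσ.continuous)
    (hm.of_le (by norm_num)) (hf.of_le one_le_two)
    (fun x => hf_pos.choose_spec.1.trans_le (hf_pos.choose_spec.2 x)) hσ.continuous
    L hL h h_pos h_zero h_inf b hb p
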